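/- **Lemma (Rényi capacity of products).** *Definitions.* Let $(\mathcal Y,\mathcal A)$ be a measurable space, let $\alpha\in(0,\infty]$, and let $\mathcal W$ be a non-empty set of probability measures on $(\mathcal Y,\mathcal A)$. For a probability mass function $P$ with finite support contained in $\mathcal W$, put $\mu_{1,P}=\sum_W P(W)\,W$ and, for any reference measure $\nu$ (a $\sigma$-finite measure dominating every $W$ with $P(W)>0$, for instance $\nu=\mu_{1,P}$; the choice is immaterial), let $\mu_{\alpha,P}$ be the measure with density $$\frac{d\mu_{\alpha,P}}{d\nu}=\Bigl(\sum_W P(W)\bigl(\tfrac{dW}{d\nu}\bigr)^{\alpha}\Bigr)^{1/\alpha}\ (\alpha<\infty),\qquad \frac{d\mu_{\infty,P}}{d\nu}=\max_{W:P(W)>0}\tfrac{dW}{d\nu}.$$ The order $\alpha$ Rényi information is $$I_\alpha(P;\mathcal W)=\begin{cases}\frac{\alpha}{\alpha-1}\ln \mu_{\alpha,P}(\mathcal Y) & \alpha\in(0,\infty)\setminus\{1\},\\[2pt] \int \sum_{W:P(W)>0} \pi(W|y)\ln\frac{\pi(W|y)}{P(W)}\,\mu_{1,P}(dy),\quad \pi(W|y)=P(W)\frac{dW}{d\mu_{1,P}}(y),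 & \alpha=1,\\[2pt] \ln\mu_{\infty,P}(\mathcal Y)&\alpha=\infty,\end{cases}$$ and the order $\alpha$ Rényi capacity is $C_\alpha(\mathcal W)=\sup_P I_\alpha(P;\mathcal W)\in[0,\infty]$, the supremum being over all such $P$. For probability measures $W,Q$ and any $\sigma$-finite $\nu$ dominating both (the choice is again immaterial), the order $\alpha$ Rényi divergence $D_\alpha(W\|Q)$ is $\frac1{\alpha-1}\ln\int(\frac{dW}{d\nu})^{\alpha}(\frac{dQ}{d\nu})^{1-\alpha}d\nu$ for $\alpha\in(0,\infty)\setminus\{1\}$, the Kullback–Leibler divergence for $\alpha=1$, and $\ln\operatorname{ess\,sup}_\nu \frac{dW}{d\nu}/\frac{dQ}{d\nu}$ for $\alpha=\infty$. An order $\alpha$ Rényi center of $\mathcal W$ is a probability measure $q$ on $(\mathcal Y,\mathcal A)$ with $C_\alpha(\mathcal W)=\sup_{W\in\mathcal W}D_\alpha(W\|q)$; when there is exactly one, it is denoted $q_{\alpha,\mathcal W}$. *Statement.* Let $\mathcal T$ be a finite index set. For each $t\in\mathcal T$ let $(\mathcal Y_t,\mathcal A_t)$ be a measurable space and $\mathcal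 W_t$ a non-empty set of probability measures on it. On the product space $(\prod_t\mathcal Y_t,\bigotimes_t\mathcal A_t)$ let $$\mathcal W=\Bigl\{\bigotimes_{t\in\mathcal T}W_t:\ W_t\in\mathcal W_t\text{ for all }t\in\mathcal T\Bigr\}.$$ Then $$C_\alpha(\mathcal W)=\sum_{t\in\mathcal T}C_\alpha(\mathcal W_t)\qquad\text{for all }\alpha\in(0,\infty].$$ Furthermore, for every $\alpha\in(0,\infty]$ with $C_\alpha(\mathcal W)<\infty$, each $\mathcal W_t$ and $\mathcal W$ have exactly one order $\alpha$ Rényi center, and $$q_{\alpha,\mathcal W}=\bigotimes_{t\in\mathcal T}q_{\alpha,\mathcal W_t}.$$ -/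

import Mathlib

open MeasureTheory
open scoped ENNReal NNReal

noncomputable section

namespace RenyiCapacity

variable {Ω : Type*} [MeasurableSpace Ω]

/-- The probability mass functions with finite support on a set `𝒲` of probability measures. -/
def priors (𝒲 : Set (ProbabilityMeasure Ω)) : Set (ProbabilityMeasure Ω →₀ ℝ≥0) :=
  {P | (∀ W ∈ P.support, W ∈ 𝒲) ∧ ∑ W ∈ P.support, P W = 1}

/-- The mixture `∑ W, P(W) W`. It dominates every `W` in the support of `P`. -/
def mixture (P : ProbabilityMeasure Ω →₀ ℝ≥0) : Measure Ω :=
  ∑ W ∈ P.support, P W • (W : Measure Ω)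

/-- The order `α` mean, `α ∈ (0,∞]`, of the Radon-Nikodym derivatives `dW/dν` for the prior `P`,
where `ν` is a reference measure for the support of `P`:
`(∑ W, P(W) (dW/dν)^α)^(1/α)` for finite `α`, and the maximum over the support for `α = ∞`. -/
def meanDensity (α : ℝ≥0∞) (P : ProbabilityMeasure Ω →₀ ℝ≥0) (ν : Measure Ω) (y : Ω) : ℝ≥0∞ :=
  if α = ∞ then ⨆ W ∈ P.support, (W : Measure Ω).rnDeriv ν y
  else (∑ W ∈ P.support, (P W : ℝ≥0∞) * (W : Measure Ω).rnDeriv ν y ^ α.toReal) ^ (1 / α.toReal)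

/-- The order `α` mean measure for the prior `P`, `α ∈ (0,∞]`. It does not depend on the reference
measure; the mixture is used here. For `α = 1` it is the mixture itself. -/
def meanMeasure (α : ℝ≥0∞) (P : ProbabilityMeasure Ω →₀ ℝ≥0) : Measure Ω :=
  (mixture P).withDensity (meanDensity α P (mixture P))

/-- The (order one) posterior `P(W) dW/dμ₁(y)`, `μ₁` the mixture. -/
def posterior (P : ProbabilityMeasure Ω →₀ ℝ≥0) (W : ProbabilityMeasure Ω) (y : Ω) : ℝ :=
  P W * ((W : Measure Ω).rnDeriv (mixture P) y).toReal

/-- The order `α` Rényi information for the prior `P`, `α ∈ (0,∞]`. (The mean measure has finite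
positive mass, and the integrand of the order one case is bounded.) -/
def renyiInformation (α : ℝ≥0∞) (P : ProbabilityMeasure Ω →₀ ℝ≥0) : ℝ :=
  if α = ∞ then Real.log (meanMeasure α P Set.univ).toReal
  else if α = 1 then
    ∫ y, ∑ W ∈ P.support, posterior P W y * Real.log (posterior P W y / P W) ∂(mixture P)
  else α.toReal / (α.toReal - 1) * Real.log (meanMeasure α P Set.univ).toReal

/-- The order `α` Rényi capacity of a set of probability measures, `α ∈ (0,∞]`. -/
def renyiCapacity (α : ℝ≥0∞) (𝒲 : Set (ProbabilityMeasure Ω)) : EReal :=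
  ⨆ P ∈ priors 𝒲, (renyiInformation α P : EReal)

/-- The order `α` Rényi divergence between probability measures, `α ∈ (0,∞]`, with reference measure
`W + Q`; at order one it is the Kullback-Leibler divergence. -/
def renyiDiv (α : ℝ≥0∞) (W Q : ProbabilityMeasure Ω) : EReal :=
  let ν : Measure Ω := (W : Measure Ω) + (Q : Measure Ω)
  let w : Ω → ℝ≥0∞ := (W : Measure Ω).rnDeriv ν
  let q : Ω → ℝ≥0∞ := (Q : Measure Ω).rnDeriv ν
  if α = ∞ then ENNReal.log (essSup (fun y => w y / q y) ν)
  else if α = 1 then (InformationTheory.klDiv (W : Measure Ω) (Q : Measure Ω) : EReal)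
  else ((1 / (α.toReal - 1) : ℝ) : EReal) *
    ENNReal.log (∫⁻ y, w y ^ α.toReal * q y ^ (1 - α.toReal) ∂ν)

/-- `Q` is an order `α` Rényi center of `𝒲`: the radius of `𝒲` relative to `Q` is the capacity. -/
def IsRenyiCenter (α : ℝ≥0∞) (𝒲 : Set (ProbabilityMeasure Ω)) (Q : ProbabilityMeasure Ω) : Prop :=
  renyiCapacity α 𝒲 = ⨆ W ∈ 𝒲, renyiDiv α W Q

/-- The set of all product measures `⊗ₜ Wₜ` with `Wₜ ∈ 𝒲ₜ` for all `t`. -/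
def productFamily {T : Type*} [Fintype T] {Ω : T → Type*} [∀ t, MeasurableSpace (Ω t)]
    (𝒲 : ∀ t, Set (ProbabilityMeasure (Ω t))) : Set (ProbabilityMeasure (∀ t, Ω t)) :=
  {W | ∃ V : ∀ t, ProbabilityMeasure (Ω t), (∀ t, V t ∈ 𝒲 t) ∧ W = ProbabilityMeasure.pi V}

end RenyiCapacity

end

/-! The argument rests on Sibson's identity. For a prior `P` let `q_P` be its order `α` mean
measure, normalized. For every `q`, the conditional divergence of `P` relative to `q` equals `I_α(P)
+ D_α(q_P ‖ q)`. Since divergences are nonnegative, `C_α(𝒲) ≤ sup_W D_α(W ‖ q)` for every `q`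
(`SibsonSystem.capacity_le_iSup`).

If the capacity `c` is finite, some `q` attains equality. Mixing two nearly optimal priors cannot
raise the information above `c`, so by Sibson's identity both of their centers lie near the center
of the mixture. The centers of a maximizing sequence are therefore Cauchy in total variation. Mixing
in a little mass at a single `W` gives, near each of these centers, a measure whose divergence from
`W` is at most slightly above `c`, and lower semicontinuity carries this to the limit. Any center
`q'` satisfies `D_α(q_P ‖ q') ≤ c - I_α(P)`, hence equals that limit. This part uses only the
properties collected in `SibsonSystem`, which are verified separately for the orders in `(0,1)`,
`1`, `(1,∞)` and `∞`.

For products, information is additive over product priors (`renyiInformation_productPrior`), so `∑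
C_α(𝒲 t) ≤ C_α(𝒲)`. Divergence bounds add over product measures (`renyiDiv_pi_le`), so the product
of the centers `q t` has radius at most `∑ C_α(𝒲 t)`. As `C_α(𝒲)` is at most any radius, all these
quantities coincide. The product of the centers is thus a center, and uniqueness identifies it. -/

noncomputable section

namespace RenyiCapacity

open Filter Topology

/-! ### Setwise uniform (total variation) convergence of probability measures. -/

section Setwise

variable {Ω : Type*} [MeasurableSpace Ω]

/-- The two measures differ by at most `δ` on every measurable set. -/
def SetwiseClose (p q : ProbabilityMeasure Ω) (δ : ℝ) : Prop :=
  ∀ A, MeasurableSet A → |(p : Measure Ω).real A - (q : Measure Ω).real A| ≤ δ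

lemma SetwiseClose.symm {p q : ProbabilityMeasure Ω} {δ : ℝ} (h : SetwiseClose p q δ) :
    SetwiseClose q p δ := fun A hA => by rw [abs_sub_comm]; exact h A hA

lemma SetwiseClose.trans {p q r : ProbabilityMeasure Ω} {δ ε : ℝ} (h : SetwiseClose p q δ)
    (h' : SetwiseClose q r ε) : SetwiseClose p r (δ + ε) := fun A hA =>
  (abs_sub_le _ _ _).trans (add_le_add (h A hA) (h' A hA))

lemma SetwiseClose.mono {p q : ProbabilityMeasure Ω} {δ ε : ℝ} (h : SetwiseClose p q δ)
    (hδ : δ ≤ ε) : SetwiseClose p q ε := fun A hA => (h A hA).trans hδ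

/-- Passing to complements exchanges the two one-sided estimates. -/
lemma SetwiseClose.of_le {p q : ProbabilityMeasure Ω} {δ : ℝ}
    (h : ∀ A, MeasurableSet A → (p : Measure Ω).real A ≤ (q : Measure Ω).real A + δ) :
    SetwiseClose p q δ := by
  intro A hA
  have h1 := h A hA
  have h2 := h Aᶜ hA.compl
  rw [probReal_compl_eq_one_sub hA, probReal_compl_eq_one_sub hA] at h2
  rw [abs_le]
  constructor <;> linarith

lemma eq_of_forall_setwiseClose {p q : ProbabilityMeasure Ω}
    (h : ∀ δ > 0, SetwiseClose p q δ) : p = q := by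
  apply ProbabilityMeasure.toMeasure_injective
  ext A hA
  have h0 : |(p : Measure Ω).real A - (q : Measure Ω).real A| ≤ 0 :=
    le_of_forall_pos_le_add fun δ hδ => by simpa using h δ hδ A hA
  have h1 : (p : Measure Ω).real A = (q : Measure Ω).real A := by
    have := abs_nonpos_iff.mp h0
    linarith
  exact (ENNReal.toReal_eq_toReal_iff' (measure_ne_top _ _) (measure_ne_top _ _)).mp h1

/-- Probability measures are complete for setwise uniform convergence. -/
lemma exists_setwise_limit (u : ℕ → ProbabilityMeasure Ω)
    (h : ∀ δ > 0, ∃ N, ∀ n ≥ N, ∀ m ≥ N, SetwiseClose (u n) (u m) δ) :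
    ∃ q : ProbabilityMeasure Ω, ∀ δ > 0, ∃ N, ∀ n ≥ N, SetwiseClose (u n) q δ := by
  -- The junk value `0` on nonmeasurable sets lets `choose` produce a set function defined
  -- everywhere.
  have hlim : ∀ A, ∃ l, MeasurableSet A →
      Tendsto (fun n => ((u n : Measure Ω)).real A) atTop (𝓝 l) := by
    intro A
    by_cases hA : MeasurableSet A
    · have : CauchySeq (fun n => ((u n : Measure Ω)).real A) := by
        rw [Metric.cauchySeq_iff]
        intro ε hε
        obtain ⟨N, hN⟩ := h (ε / 2) (by positivity)
        refine ⟨N, fun m hm n hn => ?_⟩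
        rw [Real.dist_eq]
        exact (hN m hm n hn A hA).trans_lt (by linarith)
      obtain ⟨l, hl⟩ := cauchySeq_tendsto_of_complete this
      exact ⟨l, fun _ => hl⟩
    · exact ⟨0, fun h => absurd h hA⟩
  choose L hL using hlim
  have hclose : ∀ δ > 0, ∃ N, ∀ n ≥ N, ∀ A, MeasurableSet A →
      |(u n : Measure Ω).real A - L A| ≤ δ := by
    intro δ hδ
    obtain ⟨N, hN⟩ := h δ hδ
    refine ⟨N, fun n hn A hA => ?_⟩
    refine le_of_tendsto ((tendsto_const_nhds.sub (hL A hA)).abs) ?_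
    filter_upwards [eventually_ge_atTop N] with m hm using hN n hn m hm A hA
  have hL0 : ∀ A, MeasurableSet A → 0 ≤ L A := fun A hA =>
    ge_of_tendsto' (hL A hA) fun n => measureReal_nonneg
  have hLempty : L ∅ = 0 := by
    have := hL ∅ MeasurableSet.empty
    simp only [measureReal_empty] at this
    exact tendsto_nhds_unique this tendsto_const_nhds
  have hsum : ∀ f : ℕ → Set Ω, (∀ i, MeasurableSet (f i)) → Pairwise (Function.onFun Disjoint f) →
      HasSum (fun i => L (f i)) (L (⋃ i, f i)) := by
    intro f hf hd
    rw [hasSum_iff_tendsto_nat_of_nonneg (fun i => hL0 _ (hf i))]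
    have hfin : ∀ (v : ℕ) (k : ℕ), ∑ i ∈ Finset.range k, ((u v : Measure Ω)).real (f i) =
        ((u v : Measure Ω)).real (⋃ i ∈ Finset.range k, f i) := by
      intro v k
      rw [measureReal_biUnion_finset (fun i _ j _ hij => hd hij) (fun i _ => hf i)]
    have hmk : ∀ k, MeasurableSet (⋃ i ∈ Finset.range k, f i) := fun k =>
      Finset.measurableSet_biUnion _ fun i _ => hf i
    have hLfin : ∀ k, ∑ i ∈ Finset.range k, L (f i) = L (⋃ i ∈ Finset.range k, f i) := by
      intro k
      refine tendsto_nhds_unique (tendsto_finsetSum _ fun i _ => hL _ (hf i)) ?_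
      simp_rw [hfin]
      exact hL _ (hmk k)
    rw [Metric.tendsto_atTop]
    intro ε hε
    -- Three errors of `ε / 4`: the distance from `L` to `u N` on the partial union and on the full
    -- union, and the countable additivity of the single measure `u N`.
    obtain ⟨N, hN⟩ := hclose (ε / 4) (by positivity)
    have hu : Tendsto (fun k => ∑ i ∈ Finset.range k, ((u N : Measure Ω)).real (f i)) atTop
        (𝓝 (((u N : Measure Ω)).real (⋃ i, f i))) := by
      rw [← hasSum_iff_tendsto_nat_of_nonneg (fun i => measureReal_nonneg)]
      have h2 : ((u N : Measure Ω)) (⋃ i, f i) = ∑' i, ((u N : Measure Ω)) (f i) :=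
        measure_iUnion hd hf
      have h3 : Summable (fun i => ((u N : Measure Ω)).real (f i)) :=
        ENNReal.summable_toReal (by rw [← h2]; exact measure_ne_top _ _)
      have h4 : ((u N : Measure Ω)).real (⋃ i, f i) = ∑' i, ((u N : Measure Ω)).real (f i) := by
        rw [measureReal_def, h2, ENNReal.tsum_toReal_eq (fun i => measure_ne_top _ _)]
        rfl
      rw [h4]
      exact h3.hasSum
    obtain ⟨K, hK⟩ := (Metric.tendsto_atTop.mp hu) (ε / 4) (by positivity)
    refine ⟨K, fun k hk => ?_⟩
    have e1 := hK k hk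
    rw [Real.dist_eq, hfin] at e1
    rw [Real.dist_eq, hLfin]
    have e2 := hN N le_rfl _ (hmk k)
    have e3 := hN N le_rfl _ (MeasurableSet.iUnion hf)
    rw [abs_lt] at *
    rw [abs_le] at e2 e3
    constructor <;> linarith [e1.1, e1.2, e2.1, e2.2, e3.1, e3.2]
  let μ : Measure Ω := Measure.ofMeasurable (fun s _ => ENNReal.ofReal (L s)) (by simp [hLempty])
    (fun f hf hd => by
      have hs := hsum f hf hd
      rw [← hs.tsum_eq, ENNReal.ofReal_tsum_of_nonneg (fun i => hL0 _ (hf i)) hs.summable])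
  have hμ : ∀ A, MeasurableSet A → μ A = ENNReal.ofReal (L A) := fun A hA =>
    Measure.ofMeasurable_apply A hA
  have huniv : L Set.univ = 1 := by
    have := hL Set.univ MeasurableSet.univ
    simp only [probReal_univ] at this
    exact tendsto_nhds_unique this tendsto_const_nhds
  refine ⟨⟨μ, ⟨by rw [hμ _ MeasurableSet.univ, huniv, ENNReal.ofReal_one]⟩⟩, fun δ hδ => ?_⟩
  obtain ⟨N, hN⟩ := hclose δ hδ
  refine ⟨N, fun n hn A hA => ?_⟩
  have : (μ).real A = L A := by
    rw [measureReal_def, hμ A hA, ENNReal.toReal_ofReal (hL0 A hA)]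
  simpa [this] using hN n hn A hA

end Setwise

/-! ### Existence and uniqueness of the center from the abstract properties. -/

section System

/-- The properties of the order `α` Rényi information, divergence and mean measure from which the
existence and uniqueness of the Rényi center follow. `Bound P q x` expresses that the order `α`
Rényi divergence of the prior `P` relative to `q` is at most `x`, and `ψ` is the scale on which this
conditional divergence is averaged over mixtures of priors. -/
structure SibsonSystem (α : ℝ≥0∞) (Ω : Type*) [MeasurableSpace Ω] where
  ψ : ℝ → ℝ
  center : (ProbabilityMeasure Ω →₀ ℝ≥0) → ProbabilityMeasure Ω
  Bound : (ProbabilityMeasure Ω →₀ ℝ≥0) → ProbabilityMeasure Ω → ℝ → Prop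
  strictMono : StrictMono ψ
  continuous : Continuous ψ
  -- The direction of Sibson's identity that is needed.
  div_center_le : ∀ P ∈ priors (Set.univ : Set (ProbabilityMeasure Ω)), ∀ q x,
    Bound P q (renyiInformation α P + x) → renyiDiv α (center P) q ≤ (x : EReal)
  close_of_div_le : ∀ δ > 0, ∃ η > (0 : ℝ), ∀ p q : ProbabilityMeasure Ω,
    renyiDiv α p q ≤ (η : EReal) → SetwiseClose p q δ
  nonneg_of_div_le : ∀ (p q : ProbabilityMeasure Ω) (x : ℝ), renyiDiv α p q ≤ (x : EReal) → 0 ≤ x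
  -- Pigeonhole: on the scale `ψ`, a mixture's divergence from its own center is at most `ψ` of its
  -- information, so `P` and `P'` cannot both exceed bounds whose average is at least that.
  bound_or_bound : ∀ P ∈ priors (Set.univ : Set (ProbabilityMeasure Ω)),
    ∀ P' ∈ priors (Set.univ : Set (ProbabilityMeasure Ω)), ∀ s t : ℝ≥0, 0 < s → 0 < t →
    s + t = 1 → ∀ a b : ℝ,
    ψ (renyiInformation α (s • P + t • P')) ≤ s * ψ a + t * ψ b →
    Bound P (center (s • P + t • P')) a ∨ Bound P' (center (s • P + t • P')) b
  -- Lower semicontinuity in the second argument.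
  div_le_of_close : ∀ (W q : ProbabilityMeasure Ω) (c : ℝ),
    (∀ δ > 0, ∃ q', SetwiseClose q' q δ ∧ renyiDiv α W q' ≤ (c : EReal)) →
    renyiDiv α W q ≤ (c : EReal)
  bound_of_forall : ∀ P ∈ priors (Set.univ : Set (ProbabilityMeasure Ω)), ∀ q (c : ℝ),
    (∀ W ∈ P.support, renyiDiv α W q ≤ (c : EReal)) → Bound P q c
  div_le_of_bound_single : ∀ W q (c : ℝ), Bound (Finsupp.single W 1) q c →
    renyiDiv α W q ≤ (c : EReal)

variable {Ω : Type*} [MeasurableSpace Ω] {𝒲 : Set (ProbabilityMeasure Ω)}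

lemma priors_mono_univ {P : ProbabilityMeasure Ω →₀ ℝ≥0} (hP : P ∈ priors 𝒲) :
    P ∈ priors (Set.univ : Set (ProbabilityMeasure Ω)) := ⟨fun _ _ => Set.mem_univ _, hP.2⟩

lemma single_mem_priors {W : ProbabilityMeasure Ω} (hW : W ∈ 𝒲) :
    Finsupp.single W (1 : ℝ≥0) ∈ priors 𝒲 := by
  classical
  have hs : (Finsupp.single W (1 : ℝ≥0)).support = {W} := by
    simp [Finsupp.support_single]
  constructor
  · intro V hV
    rw [hs, Finset.mem_singleton] at hV
    rwa [hV]
  · simp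

lemma sum_add_smul {M : Type*} [AddCommMonoid M] {P P' : ProbabilityMeasure Ω →₀ ℝ≥0}
    (s t : ℝ≥0) (g : ProbabilityMeasure Ω → ℝ≥0 → M) (h0 : ∀ W, g W 0 = 0)
    (hadd : ∀ W x y, g W (x + y) = g W x + g W y) :
    (s • P + t • P').sum g = P.sum (fun W x => g W (s * x)) + P'.sum (fun W x => g W (t * x)) := by
  classical
  rw [Finsupp.sum_add_index' h0 hadd, Finsupp.sum_smul_index h0, Finsupp.sum_smul_index h0]

lemma mix_mem_priors {P P' : ProbabilityMeasure Ω →₀ ℝ≥0} (hP : P ∈ priors 𝒲)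
    (hP' : P' ∈ priors 𝒲) {s t : ℝ≥0} (hst : s + t = 1) : s • P + t • P' ∈ priors 𝒲 := by
  classical
  constructor
  · intro W hW
    rcases Finset.mem_union.mp (Finsupp.support_add hW) with h | h
    · exact hP.1 W (Finsupp.support_smul h)
    · exact hP'.1 W (Finsupp.support_smul h)
  · have := sum_add_smul (P := P) (P' := P') s t (fun _ x => x) (fun _ => rfl) (fun _ _ _ => rfl)
    simp only [Finsupp.sum, ← Finset.mul_sum, hP.2, hP'.2, mul_one, hst] at this
    exact this

/-- Source of the small parameters below: a strict inequality at `0` survives a small positive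
perturbation. -/
lemma exists_pos_lt_of_continuous {g : ℝ → ℝ} (hg : Continuous g) {v : ℝ} (h : v < g 0) {r : ℝ}
    (hr : 0 < r) : ∃ η > 0, η < r ∧ v < g η := by
  have h1 : ∀ᶠ η in 𝓝[>] (0 : ℝ), v < g η :=
    (hg.continuousAt.eventually_const_lt h).filter_mono nhdsWithin_le_nhds
  have h2 : ∀ᶠ η in 𝓝[>] (0 : ℝ), η ∈ Set.Ioo 0 r := Ioo_mem_nhdsGT hr
  obtain ⟨η, h3, h4⟩ := (h1.and h2).exists
  exact ⟨η, h4.1, h4.2, h3⟩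

lemma information_le_renyiCapacity {α : ℝ≥0∞} {P : ProbabilityMeasure Ω →₀ ℝ≥0}
    (hP : P ∈ priors 𝒲) : (renyiInformation α P : EReal) ≤ renyiCapacity α 𝒲 :=
  le_iSup₂ (f := fun P (_ : P ∈ priors 𝒲) => (renyiInformation α P : EReal)) P hP

lemma exists_renyiCapacity_eq_coe {α : ℝ≥0∞} (h𝒲 : 𝒲.Nonempty) (hfin : renyiCapacity α 𝒲 < ⊤) :
    ∃ c : ℝ, renyiCapacity α 𝒲 = c ∧ ∀ ε > 0, ∃ P ∈ priors 𝒲, c - ε < renyiInformation α P := by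
  obtain ⟨W₀, hW₀⟩ := h𝒲
  have hbot : renyiCapacity α 𝒲 ≠ ⊥ := fun h => by
    have := information_le_renyiCapacity (α := α) (single_mem_priors hW₀)
    rw [h, le_bot_iff] at this
    exact EReal.coe_ne_bot _ this
  refine ⟨_, (EReal.coe_toReal hfin.ne hbot).symm, fun ε hε => ?_⟩
  by_contra! hcon
  have : renyiCapacity α 𝒲 ≤ (((renyiCapacity α 𝒲).toReal - ε : ℝ) : EReal) :=
    iSup₂_le fun P hP => EReal.coe_le_coe_iff.mpr (hcon P hP)
  rw [← EReal.coe_toReal hfin.ne hbot, EReal.coe_le_coe_iff, EReal.toReal_coe] at this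
  linarith

namespace SibsonSystem

variable {α : ℝ≥0∞} (S : SibsonSystem α Ω)
include S

/-- Sibson's identity together with nonnegativity of the divergence from the center. -/
lemma information_le_of_bound {P : ProbabilityMeasure Ω →₀ ℝ≥0}
    (hP : P ∈ priors (Set.univ : Set (ProbabilityMeasure Ω))) {q : ProbabilityMeasure Ω} {y : ℝ}
    (h : S.Bound P q y) : renyiInformation α P ≤ y := by
  have h1 := S.div_center_le P hP q (y - renyiInformation α P) (by simpa using h)
  linarith [S.nonneg_of_div_le _ _ _ h1]

lemma information_le_iSup {P : ProbabilityMeasure Ω →₀ ℝ≥0} (hP : P ∈ priors 𝒲)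
    (q : ProbabilityMeasure Ω) :
    (renyiInformation α P : EReal) ≤ ⨆ W ∈ 𝒲, renyiDiv α W q := by
  rw [← EReal.le_of_forall_lt_iff_le]
  intro z hz
  refine EReal.coe_le_coe_iff.mpr ?_
  refine S.information_le_of_bound (q := q) (priors_mono_univ hP)
    (S.bound_of_forall P (priors_mono_univ hP) q z ?_)
  intro W hW
  exact (le_iSup₂ (f := fun W (_ : W ∈ 𝒲) => renyiDiv α W q) W (hP.1 W hW)).trans hz.le

theorem capacity_le_iSup (q : ProbabilityMeasure Ω) :
    renyiCapacity α 𝒲 ≤ ⨆ W ∈ 𝒲, renyiDiv α W q :=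
  iSup₂_le fun _ hP => S.information_le_iSup hP q

/-- Apply the pigeonhole to the half-half mixture with bounds `I(P) + η₀` and `I(P') - η`. The
second is impossible, as a bound on `P'` is at least its information; so the first holds, and
Sibson's identity puts the center of `P` within divergence `η₀` of the center of the mixture. The
same holds for `P'` by symmetry. -/
lemma exists_close_centers {c : ℝ} (hc : ∀ P ∈ priors 𝒲, renyiInformation α P ≤ c) {δ : ℝ}
    (hδ : 0 < δ) : ∃ η > 0, ∀ P ∈ priors 𝒲, ∀ P' ∈ priors 𝒲, c - η ≤ renyiInformation α P →
      c - η ≤ renyiInformation α P' → SetwiseClose (S.center P) (S.center P') δ := by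
  obtain ⟨η₀, hη₀, hclose⟩ := S.close_of_div_le (δ / 2) (by positivity)
  have hψ := S.continuous
  obtain ⟨η, hη, -, hlt⟩ := exists_pos_lt_of_continuous
    (g := fun η => (1 / 2 : ℝ) * S.ψ (c - η + η₀) + (1 / 2 : ℝ) * S.ψ (c - η - η)) (by fun_prop)
    (v := S.ψ c) (by
      have : S.ψ c < S.ψ (c + η₀) := S.strictMono (by linarith)
      simp only [sub_zero]; linarith) zero_lt_one
  have hhalf : ((1 / 2 : ℝ≥0) : ℝ) = 1 / 2 := by simp
  have key : ∀ P ∈ priors 𝒲, ∀ P' ∈ priors 𝒲, c - η ≤ renyiInformation α P →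
      c - η ≤ renyiInformation α P' → ∀ R, (R = (1 / 2 : ℝ≥0) • P + (1 / 2 : ℝ≥0) • P') →
      SetwiseClose (S.center P) (S.center R) (δ / 2) := by
    rintro P hP P' hP' h h' R rfl
    apply hclose
    have hmem := mix_mem_priors hP hP' (s := 1 / 2) (t := 1 / 2) (by norm_num)
    rcases S.bound_or_bound P (priors_mono_univ hP) P' (priors_mono_univ hP') (1 / 2) (1 / 2)
      (by norm_num) (by norm_num) (by norm_num) (renyiInformation α P + η₀)
      (renyiInformation α P' - η) (by
        rw [hhalf]
        have e1 : S.ψ (c - η + η₀) ≤ S.ψ (renyiInformation α P + η₀) :=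
          S.strictMono.monotone (by linarith)
        have e2 : S.ψ (c - η - η) ≤ S.ψ (renyiInformation α P' - η) :=
          S.strictMono.monotone (by linarith)
        have e3 := S.strictMono.monotone (hc _ hmem)
        linarith) with h1 | h1
    · exact S.div_center_le P (priors_mono_univ hP) _ _ h1
    · have := S.information_le_of_bound (priors_mono_univ hP') h1
      linarith
  refine ⟨η, hη, fun P hP P' hP' h h' => ?_⟩
  have h1 := key P hP P' hP' h h' _ rfl
  have h2 := key P' hP' P hP h' h ((1 / 2 : ℝ≥0) • P + (1 / 2 : ℝ≥0) • P') (add_comm _ _)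
  exact (h1.trans h2.symm).mono (by linarith)

/-- The measure `q` is the center of `(1 - t) P + t δ_W`. The pigeonhole is used twice on this
mixture: with bounds `I(P) + η₀` and `-1`, where the negative one is impossible, it gives closeness
to the center of `P`; with bounds `I(P) - η` and `c'`, where the first is impossible, it bounds the
divergence of `W`. -/
lemma exists_close_div_le {c : ℝ} (hc : ∀ P ∈ priors 𝒲, renyiInformation α P ≤ c)
    {W : ProbabilityMeasure Ω} (hW : W ∈ 𝒲) {c' : ℝ} (hc' : c < c') {δ : ℝ} (hδ : 0 < δ) :
    ∃ η > 0, ∀ P ∈ priors 𝒲, c - η ≤ renyiInformation α P →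
      ∃ q, SetwiseClose (S.center P) q δ ∧ renyiDiv α W q ≤ (c' : EReal) := by
  obtain ⟨η₀, hη₀, hclose⟩ := S.close_of_div_le δ hδ
  have hψ := S.continuous
  have hlt1 : S.ψ c < S.ψ (c + η₀) := S.strictMono (by linarith)
  have hlt2 : S.ψ c < S.ψ c' := S.strictMono hc'
  -- The weight `t` is so small that the term `ψ (-1)` does not cancel the gain `ψ (c + η₀) > ψ c`.
  -- Only afterwards is `η` chosen, depending on `t`.
  obtain ⟨t, ht, ht1, hlt⟩ := exists_pos_lt_of_continuous
    (g := fun t => (1 - t) * S.ψ (c + η₀) + t * S.ψ (-1)) (by fun_prop)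
    (v := S.ψ c) (by simpa using hlt1) zero_lt_one
  obtain ⟨η, hη, -, hlt3⟩ := exists_pos_lt_of_continuous
    (g := fun η => min ((1 - t) * S.ψ (c - η + η₀) + t * S.ψ (-1))
      ((1 - t) * S.ψ (c - η - η) + t * S.ψ c')) (by fun_prop)
    (v := S.ψ c) (by
      simp only [sub_zero, lt_min_iff]
      exact ⟨hlt, by nlinarith⟩) zero_lt_one
  rw [lt_min_iff] at hlt3
  refine ⟨η, hη, fun P hP h => ?_⟩
  lift t to ℝ≥0 using ht.le
  have ht' : t < 1 := by exact_mod_cast ht1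
  have hst : (1 - t) + t = 1 := tsub_add_cancel_of_le ht'.le
  have hs : ((1 - t : ℝ≥0) : ℝ) = 1 - t := by rw [NNReal.coe_sub ht'.le]; simp
  have hPu := priors_mono_univ hP
  have hWp := single_mem_priors hW
  have hWu := priors_mono_univ hWp
  have hmem := mix_mem_priors hP hWp hst
  have e0 := S.strictMono.monotone (hc _ hmem)
  have ht0 : 0 < t := by exact_mod_cast ht
  have hs0 : (0 : ℝ) ≤ 1 - t := by linarith
  refine ⟨S.center ((1 - t) • P + t • Finsupp.single W 1), hclose _ _ ?_, ?_⟩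
  · rcases S.bound_or_bound P hPu _ hWu (1 - t) t (tsub_pos_of_lt ht') ht0 hst
      (renyiInformation α P + η₀) (-1) (by
        rw [hs]
        have e1 : S.ψ (c - η + η₀) ≤ S.ψ (renyiInformation α P + η₀) :=
          S.strictMono.monotone (by linarith)
        nlinarith [mul_le_mul_of_nonneg_left e1 hs0]) with h1 | h1
    · exact S.div_center_le P hPu _ _ h1
    · have := S.nonneg_of_div_le _ _ _ (S.div_le_of_bound_single _ _ _ h1)
      linarith
  · rcases S.bound_or_bound P hPu _ hWu (1 - t) t (tsub_pos_of_lt ht') ht0 hst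
      (renyiInformation α P - η) c' (by
        rw [hs]
        have e1 : S.ψ (c - η - η) ≤ S.ψ (renyiInformation α P - η) :=
          S.strictMono.monotone (by linarith)
        nlinarith [mul_le_mul_of_nonneg_left e1 hs0]) with h1 | h1
    · have := S.information_le_of_bound hPu h1
      linarith
    · exact S.div_le_of_bound_single _ _ _ h1

theorem existsUnique_isRenyiCenter (h𝒲 : 𝒲.Nonempty) (hfin : renyiCapacity α 𝒲 < ⊤) :
    ∃! q, IsRenyiCenter α 𝒲 q := by
  obtain ⟨c, hcap, hsup⟩ := exists_renyiCapacity_eq_coe h𝒲 hfin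
  have hc : ∀ P ∈ priors 𝒲, renyiInformation α P ≤ c := fun P hP => by
    have := information_le_renyiCapacity (α := α) hP
    rwa [hcap, EReal.coe_le_coe_iff] at this
  have happ : ∀ n : ℕ, ∃ P ∈ priors 𝒲, c - 1 / ((n : ℝ) + 1) < renyiInformation α P :=
    fun n => hsup _ (by positivity)
  choose P hP hPI using happ
  have hlarge : ∀ η > 0, ∃ N, ∀ n ≥ N, c - η ≤ renyiInformation α (P n) := by
    intro η hη
    obtain ⟨N, hN⟩ := exists_nat_one_div_lt hη
    refine ⟨N, fun n hn => ?_⟩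
    have h1 : 1 / ((n : ℝ) + 1) ≤ 1 / ((N : ℝ) + 1) := Nat.one_div_le_one_div hn
    linarith [hPI n]
  obtain ⟨q, hq⟩ := exists_setwise_limit (fun n => S.center (P n)) (by
    intro δ hδ
    obtain ⟨η, hη, h⟩ := S.exists_close_centers hc hδ
    obtain ⟨N, hN⟩ := hlarge η hη
    exact ⟨N, fun n hn m hm => h _ (hP n) _ (hP m) (hN n hn) (hN m hm)⟩)
  refine ⟨q, le_antisymm (S.capacity_le_iSup q) (iSup₂_le fun W hW => ?_), fun q' hq' => ?_⟩
  · rw [hcap, ← EReal.le_of_forall_lt_iff_le]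
    intro c' hc'
    apply S.div_le_of_close
    intro δ hδ
    obtain ⟨η, hη, h⟩ := S.exists_close_div_le hc hW (EReal.coe_lt_coe_iff.mp hc')
      (half_pos hδ)
    obtain ⟨N, hN⟩ := hlarge η hη
    obtain ⟨M, hM⟩ := hq (δ / 2) (half_pos hδ)
    obtain ⟨q', h1, h2⟩ := h _ (hP (max N M)) (hN _ (le_max_left _ _))
    exact ⟨q', (h1.symm.trans (hM _ (le_max_right _ _))).mono (by linarith), h2⟩
  · apply eq_of_forall_setwiseClose
    intro δ hδ
    obtain ⟨η, hη, h⟩ := S.close_of_div_le (δ / 2) (half_pos hδ)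
    obtain ⟨N, hN⟩ := hlarge η hη
    obtain ⟨M, hM⟩ := hq (δ / 2) (half_pos hδ)
    have h1 := hM _ (le_max_right N M)
    -- For a competing center `q'` every divergence is at most `c ≤ I(P n) + η`, so Sibson's
    -- identity leaves at most `η` for the divergence from the center of `P n`.
    have h2 := h (S.center (P (max N M))) q' (by
      refine S.div_center_le _ (priors_mono_univ (hP _)) _ _
        (S.bound_of_forall _ (priors_mono_univ (hP _)) _ _ fun W hW => ?_)
      have h3 : renyiDiv α W q' ≤ (c : EReal) := by
        rw [← hcap, hq']
        exact le_iSup₂ (f := fun W (_ : W ∈ 𝒲) => renyiDiv α W q') W ((hP _).1 W hW)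
      refine h3.trans (EReal.coe_le_coe_iff.mpr ?_)
      linarith [hN _ (le_max_left N M)])
    exact (h2.symm.trans h1).mono (by linarith)

end SibsonSystem

end System

/-! ### Integrals and densities on finite products. -/

section Pi

lemma lintegral_fin_prod_eq_prod {n : ℕ} {E : Fin n → Type*}
    {mE : ∀ i, MeasurableSpace (E i)} {μ : (i : Fin n) → Measure (E i)} [∀ i, SigmaFinite (μ i)]
    (f : (i : Fin n) → E i → ℝ≥0∞) (hf : ∀ i, Measurable (f i)) :
    ∫⁻ x : (i : Fin n) → E i, ∏ i, f i (x i) ∂(Measure.pi μ) = ∏ i, ∫⁻ x, f i x ∂(μ i) := by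
  induction n with
  | zero => simp
  | succ n ih =>
      calc
        _ = ∫⁻ x : E 0 × ((i : Fin n) → E (Fin.succ i)),
            f 0 x.1 * ∏ i : Fin n, f (Fin.succ i) (x.2 i)
            ∂((μ 0).prod (Measure.pi (fun i ↦ μ i.succ))) := by
          rw [← ((measurePreserving_piFinSuccAbove μ 0).symm).lintegral_comp_emb
            (MeasurableEquiv.measurableEmbedding _)]
          refine lintegral_congr fun x => ?_
          rw [Fin.prod_univ_succ]
          rfl
        _ = (∫⁻ x, f 0 x ∂μ 0)
            * ∏ i : Fin n, ∫⁻ (x : E (Fin.succ i)), f (Fin.succ i) x ∂(μ i.succ) := by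
          have h2 : Measurable fun x : (i : Fin n) → E (Fin.succ i) =>
              ∏ i : Fin n, f (Fin.succ i) (x i) :=
            Finset.measurable_prod _ fun i _ => (hf _).comp (measurable_pi_apply i)
          rw [← ih _ (fun i => hf _),
            lintegral_prod_mul (f := f 0) (g := fun x : (i : Fin n) → E (Fin.succ i) =>
              ∏ i : Fin n, f (Fin.succ i) (x i)) (hf 0).aemeasurable h2.aemeasurable]
        _ = ∏ i, ∫⁻ x, f i x ∂(μ i) := by rw [Fin.prod_univ_succ]

/-- Tonelli's theorem for a product of functions of one variable each. -/
theorem lintegral_pi_prod {T : Type*} [Fintype T] {E : T → Type*}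
    {mE : ∀ i, MeasurableSpace (E i)} {μ : (i : T) → Measure (E i)} [∀ i, SigmaFinite (μ i)]
    (f : (i : T) → E i → ℝ≥0∞) (hf : ∀ i, Measurable (f i)) :
    ∫⁻ x : (i : T) → E i, ∏ i, f i (x i) ∂(Measure.pi μ) = ∏ i, ∫⁻ x, f i x ∂(μ i) := by
  let e := (Fintype.equivFin T).symm
  rw [← (measurePreserving_piCongrLeft _ e).lintegral_comp_emb
    (MeasurableEquiv.measurableEmbedding _)]
  simp_rw [← e.prod_comp, MeasurableEquiv.coe_piCongrLeft, Equiv.piCongrLeft_apply_apply]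
  exact lintegral_fin_prod_eq_prod (fun i => f (e i)) fun i => hf (e i)

/-- It suffices to compare on boxes, where the indicator times the density is again a product of
functions of one coordinate. -/
theorem pi_eq_withDensity {T : Type*} [Fintype T] {E : T → Type*}
    [∀ i, MeasurableSpace (E i)] {μ ν : (i : T) → Measure (E i)} [∀ i, SigmaFinite (μ i)]
    [∀ i, SigmaFinite (ν i)] {f : (i : T) → E i → ℝ≥0∞} (hf : ∀ i, Measurable (f i))
    (h : ∀ i, μ i = (ν i).withDensity (f i)) :
    Measure.pi μ = (Measure.pi ν).withDensity (fun y => ∏ i, f i (y i)) := by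
  refine Measure.pi_eq fun s hs => ?_
  rw [withDensity_apply _ (MeasurableSet.univ_pi hs),
    ← lintegral_indicator (MeasurableSet.univ_pi hs)]
  have h1 : ∀ y, (Set.univ.pi s).indicator (fun y => ∏ i, f i (y i)) y =
      ∏ i, (s i).indicator (f i) (y i) := by
    intro y
    by_cases hy : y ∈ Set.univ.pi s
    · rw [Set.indicator_of_mem hy]
      exact Finset.prod_congr rfl fun i _ => (Set.indicator_of_mem (hy i trivial) _).symm
    · rw [Set.indicator_of_notMem hy]
      simp only [Set.mem_pi, Set.mem_univ, true_implies, not_forall] at hy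
      obtain ⟨i, hi⟩ := hy
      exact (Finset.prod_eq_zero (Finset.mem_univ i) (Set.indicator_of_notMem hi _)).symm
  simp_rw [h1]
  rw [lintegral_pi_prod _ fun i => (hf i).indicator (hs i)]
  refine Finset.prod_congr rfl fun i _ => ?_
  rw [lintegral_indicator (hs i), h i, withDensity_apply _ (hs i)]

end Pi

/-! ### Hellinger integrals and their comparison with the affinity (order `1 / 2`). -/

section Hellinger

variable {Ω : Type*} [MeasurableSpace Ω]

/-- Homogeneity of degree one, which makes the Hellinger integral independent of the reference
measure. Finiteness of `x` and `y` is asked only for `r ≠ 0`, which is all that holds almost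
everywhere for Radon-Nikodym derivatives. -/
lemma mul_rpow_mul_mul_rpow {a : ℝ} (ha : 0 < a) {r x y : ℝ≥0∞} (hr : r ≠ ∞) (hx : r ≠ 0 → x ≠ ∞)
    (hy : r ≠ 0 → y ≠ ∞) :
    (r * x) ^ a * (r * y) ^ (1 - a) = r * (x ^ a * y ^ (1 - a)) := by
  by_cases h0 : r = 0
  · simp [h0, ENNReal.zero_rpow_of_pos ha]
  · rw [ENNReal.mul_rpow_of_ne_top hr (hx h0), ENNReal.mul_rpow_of_ne_top hr (hy h0)]
    have : r ^ a * r ^ (1 - a) = r := by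
      rw [← ENNReal.rpow_add _ _ h0 hr]; simp
    calc _ = (r ^ a * r ^ (1 - a)) * (x ^ a * y ^ (1 - a)) := by ring
      _ = _ := by rw [this]

lemma ae_rnDeriv_eq_mul {μ κ ν : Measure Ω} [IsFiniteMeasure μ] [IsFiniteMeasure κ]
    [IsFiniteMeasure ν] (hμκ : μ ≪ κ) :
    ∀ᵐ y ∂ν, μ.rnDeriv ν y = κ.rnDeriv ν y * μ.rnDeriv κ y := by
  filter_upwards [Measure.rnDeriv_mul_rnDeriv (κ := ν) hμκ] with y hy
  rw [← hy, Pi.mul_apply, mul_comm]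

/-- The derivative is finite `κ`-almost everywhere, and `κ`-null sets are those that are `ν`-null
off the zero set of the density of `κ`. -/
lemma ae_rnDeriv_ne_top_of_ne_zero {μ κ ν : Measure Ω} [IsFiniteMeasure μ] [IsFiniteMeasure κ]
    [IsFiniteMeasure ν] (hκν : κ ≪ ν) :
    ∀ᵐ y ∂ν, κ.rnDeriv ν y ≠ 0 → μ.rnDeriv κ y ≠ ∞ := by
  rw [← ae_withDensity_iff (Measure.measurable_rnDeriv _ _),
    Measure.withDensity_rnDeriv_eq _ _ hκν]
  exact Measure.rnDeriv_ne_top _ _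

/-- The order `a` Hellinger integral of two probability measures. -/
def hellinger (a : ℝ) (p q : ProbabilityMeasure Ω) : ℝ≥0∞ :=
  ∫⁻ y, (p : Measure Ω).rnDeriv (p + q) y ^ a * (q : Measure Ω).rnDeriv (p + q) y ^ (1 - a)
    ∂((p : Measure Ω) + (q : Measure Ω))

lemma hellinger_eq_lintegral {a : ℝ} (ha : 0 < a) {p q : ProbabilityMeasure Ω} {ν : Measure Ω}
    [IsFiniteMeasure ν] (hp : (p : Measure Ω) ≪ ν) (hq : (q : Measure Ω) ≪ ν) :
    hellinger a p q = ∫⁻ y, (p : Measure Ω).rnDeriv ν y ^ a *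
      (q : Measure Ω).rnDeriv ν y ^ (1 - a) ∂ν := by
  have hκ : (p : Measure Ω) + (q : Measure Ω) ≪ ν := hp.add_left hq
  have hpκ : (p : Measure Ω) ≪ (p : Measure Ω) + (q : Measure Ω) :=
    Measure.absolutelyContinuous_of_le (Measure.le_add_right le_rfl)
  have hqκ : (q : Measure Ω) ≪ (p : Measure Ω) + (q : Measure Ω) :=
    Measure.absolutelyContinuous_of_le (Measure.le_add_left le_rfl)
  rw [hellinger, ← lintegral_rnDeriv_mul hκ (by fun_prop)]
  refine lintegral_congr_ae ?_
  filter_upwards [ae_rnDeriv_eq_mul (ν := ν) hpκ, ae_rnDeriv_eq_mul (ν := ν) hqκ,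
    ae_rnDeriv_ne_top_of_ne_zero (μ := (p : Measure Ω)) hκ,
    ae_rnDeriv_ne_top_of_ne_zero (μ := (q : Measure Ω)) hκ,
    Measure.rnDeriv_ne_top ((p : Measure Ω) + (q : Measure Ω)) ν] with y h1 h2 h3 h4 h5
  rw [h1, h2, mul_rpow_mul_mul_rpow ha h5 h3 h4]

lemma hellinger_eq_of_withDensity {a : ℝ} (ha : 0 < a) {p q : ProbabilityMeasure Ω}
    {ν : Measure Ω} [IsFiniteMeasure ν] {f g : Ω → ℝ≥0∞} (hf : Measurable f) (hg : Measurable g)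
    (hp : (p : Measure Ω) = ν.withDensity f) (hq : (q : Measure Ω) = ν.withDensity g) :
    hellinger a p q = ∫⁻ y, f y ^ a * g y ^ (1 - a) ∂ν := by
  rw [hellinger_eq_lintegral ha (hp ▸ withDensity_absolutelyContinuous _ _)
    (hq ▸ withDensity_absolutelyContinuous _ _)]
  refine lintegral_congr_ae ?_
  filter_upwards [Measure.rnDeriv_withDensity ν hf, Measure.rnDeriv_withDensity ν hg] with y h1 h2
  rw [hp, hq, h1, h2]

lemma hellinger_self {a : ℝ} (ha : 0 < a) (p : ProbabilityMeasure Ω) : hellinger a p p = 1 := by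
  have h : (p : Measure Ω) = (p : Measure Ω).withDensity fun _ => 1 := by simp
  rw [hellinger_eq_of_withDensity ha measurable_const measurable_const h h]
  simp

/-- A common reference measure with measurable, everywhere finite densities. -/
lemma exists_densities (p q : ProbabilityMeasure Ω) : ∃ (ν : Measure Ω) (f g : Ω → ℝ≥0∞),
    IsFiniteMeasure ν ∧ Measurable f ∧ Measurable g ∧ (p : Measure Ω) = ν.withDensity f ∧
    (q : Measure Ω) = ν.withDensity g ∧ (∀ᵐ y ∂ν, f y ≠ ∞) ∧ (∀ᵐ y ∂ν, g y ≠ ∞) ∧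
    ∫⁻ y, f y ∂ν = 1 ∧ ∫⁻ y, g y ∂ν = 1 := by
  set ν : Measure Ω := (p : Measure Ω) + (q : Measure Ω) with hν
  have hp : (p : Measure Ω) ≪ ν :=
    Measure.absolutelyContinuous_of_le (Measure.le_add_right le_rfl)
  have hq : (q : Measure Ω) ≪ ν :=
    Measure.absolutelyContinuous_of_le (Measure.le_add_left le_rfl)
  refine ⟨ν, (p : Measure Ω).rnDeriv ν, (q : Measure Ω).rnDeriv ν, inferInstance,
    Measure.measurable_rnDeriv _ _, Measure.measurable_rnDeriv _ _,
    (Measure.withDensity_rnDeriv_eq _ _ hp).symm, (Measure.withDensity_rnDeriv_eq _ _ hq).symm,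
    Measure.rnDeriv_ne_top _ _, Measure.rnDeriv_ne_top _ _, ?_, ?_⟩
  · rw [Measure.lintegral_rnDeriv hp]; simp
  · rw [Measure.lintegral_rnDeriv hq]; simp

lemma hellinger_le_one {a : ℝ} (ha : 0 < a) (ha1 : a ≤ 1) (p q : ProbabilityMeasure Ω) :
    hellinger a p q ≤ 1 := by
  obtain ⟨ν, f, g, hν, hf, hg, hp, hq, -, -, hf1, hg1⟩ := exists_densities p q
  rw [hellinger_eq_of_withDensity ha hf hg hp hq]
  refine (ENNReal.lintegral_mul_norm_pow_le hf.aemeasurable hg.aemeasurable ha.le (by linarith)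
    (by ring)).trans ?_
  simp [hf1, hg1]

/-- Hölder's inequality for `f ^ a g ^ (1 - a) = (√f √g) ^ (2 a) · g ^ (1 - 2 a)`. -/
lemma hellinger_le_rpow_affinity_of_le_half {a : ℝ} (ha : 0 < a) (ha1 : a ≤ 1 / 2)
    (p q : ProbabilityMeasure Ω) : hellinger a p q ≤ hellinger (1 / 2) p q ^ (2 * a) := by
  obtain ⟨ν, f, g, hν, hf, hg, hp, hq, hft, hgt, hf1, hg1⟩ := exists_densities p q
  rw [hellinger_eq_of_withDensity ha hf hg hp hq,
    hellinger_eq_of_withDensity (by norm_num) hf hg hp hq]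
  have h := ENNReal.lintegral_mul_norm_pow_le (μ := ν)
    (f := fun y => f y ^ (1 / 2 : ℝ) * g y ^ (1 - 1 / 2 : ℝ)) (g := g) (by fun_prop)
    hg.aemeasurable (p := 2 * a) (q := 1 - 2 * a) (by linarith) (by linarith) (by ring)
  rw [hg1, ENNReal.one_rpow, mul_one] at h
  refine le_trans (le_of_eq (lintegral_congr fun y => ?_)) h
  rw [ENNReal.mul_rpow_of_nonneg _ _ (by linarith), ← ENNReal.rpow_mul, ← ENNReal.rpow_mul,
    mul_assoc, ← ENNReal.rpow_add_of_nonneg _ _ (by linarith) (by linarith)]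
  ring_nf

/-- Hölder's inequality for `f ^ a g ^ (1 - a) = (√f √g) ^ (2 (1 - a)) · f ^ (2 a - 1)`. -/
lemma hellinger_le_rpow_affinity_of_half_le {a : ℝ} (ha : 1 / 2 ≤ a) (ha1 : a < 1)
    (p q : ProbabilityMeasure Ω) :
    hellinger a p q ≤ hellinger (1 / 2) p q ^ (2 * (1 - a)) := by
  obtain ⟨ν, f, g, hν, hf, hg, hp, hq, hft, hgt, hf1, hg1⟩ := exists_densities p q
  rw [hellinger_eq_of_withDensity (by linarith) hf hg hp hq,
    hellinger_eq_of_withDensity (by norm_num) hf hg hp hq]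
  have h := ENNReal.lintegral_mul_norm_pow_le (μ := ν)
    (f := fun y => f y ^ (1 / 2 : ℝ) * g y ^ (1 - 1 / 2 : ℝ)) (g := f) (by fun_prop)
    hf.aemeasurable (p := 2 * (1 - a)) (q := 2 * a - 1) (by linarith) (by linarith) (by ring)
  rw [hf1, ENNReal.one_rpow, mul_one] at h
  refine le_trans (le_of_eq (lintegral_congr fun y => ?_)) h
  rw [ENNReal.mul_rpow_of_nonneg _ _ (by linarith), ← ENNReal.rpow_mul, ← ENNReal.rpow_mul,
    mul_right_comm, ← ENNReal.rpow_add_of_nonneg _ _ (by linarith) (by linarith)]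
  ring_nf

/-- Hölder's inequality for `f = (f ^ a g ^ (1 - a)) ^ θ (√f √g) ^ (1 - θ)` with `θ = 1 / (2 a -
1)`, the exponent that cancels `g`. The infinite case is separate because the product could be `∞ *
0 = 0`. -/
lemma one_le_rpow_hellinger_mul_rpow_affinity {a : ℝ} (ha : 1 < a)
    (p q : ProbabilityMeasure Ω) :
    1 ≤ hellinger a p q ^ (1 / (2 * a - 1)) *
      hellinger (1 / 2) p q ^ (2 * (a - 1) / (2 * a - 1)) ∨ hellinger a p q = ∞ := by
  by_cases hH : hellinger a p q = ∞
  · exact Or.inr hH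
  left
  have hd : 0 < 2 * a - 1 := by linarith
  obtain ⟨ν, f, g, hν, hf, hg, hp, hq, hft, hgt, hf1, hg1⟩ := exists_densities p q
  rw [hellinger_eq_of_withDensity (by linarith) hf hg hp hq] at hH ⊢
  rw [hellinger_eq_of_withDensity (by norm_num) hf hg hp hq]
  have h := ENNReal.lintegral_mul_norm_pow_le (μ := ν)
    (f := fun y => f y ^ a * g y ^ (1 - a))
    (g := fun y => f y ^ (1 / 2 : ℝ) * g y ^ (1 - 1 / 2 : ℝ)) (by fun_prop)
    (by fun_prop) (p := 1 / (2 * a - 1)) (q := 2 * (a - 1) / (2 * a - 1)) (by positivity)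
    (div_nonneg (by linarith) hd.le) (by field_simp; ring)
  refine le_trans (le_of_eq ?_) h
  rw [← hf1]
  refine lintegral_congr_ae ?_
  filter_upwards [ae_lt_top' (by fun_prop) hH, hft, hgt] with y h1 h2 h3
  have hθ : 0 < 1 / (2 * a - 1) := by positivity
  have hθ' : 0 < 2 * (a - 1) / (2 * a - 1) := div_pos (by linarith) hd
  by_cases hf0 : f y = 0
  · rw [hf0, ENNReal.zero_rpow_of_pos (by linarith), zero_mul, ENNReal.zero_rpow_of_pos hθ,
      zero_mul]
  have hg0 : g y ≠ 0 := by
    intro hg0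
    rw [hg0, ENNReal.zero_rpow_of_neg (by linarith), ENNReal.mul_top] at h1
    · exact lt_irrefl _ h1
    · simp [ENNReal.rpow_eq_zero_iff, hf0, h2]
  have e1 := ENNReal.rpow_ne_top_of_ne_zero (y := a) hf0 h2
  have e2 := ENNReal.rpow_ne_top_of_ne_zero (y := 1 - a) hg0 h3
  have e3 := ENNReal.rpow_ne_top_of_ne_zero (y := (1 / 2 : ℝ)) hf0 h2
  have e4 := ENNReal.rpow_ne_top_of_ne_zero (y := (1 - 1 / 2 : ℝ)) hg0 h3
  rw [ENNReal.mul_rpow_of_ne_top e1 e2, ENNReal.mul_rpow_of_ne_top e3 e4, ← ENNReal.rpow_mul,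
    ← ENNReal.rpow_mul, ← ENNReal.rpow_mul, ← ENNReal.rpow_mul, mul_mul_mul_comm,
    ← ENNReal.rpow_add _ _ hf0 h2, ← ENNReal.rpow_add _ _ hg0 h3]
  have x1 : a * (1 / (2 * a - 1)) + 1 / 2 * (2 * (a - 1) / (2 * a - 1)) = 1 := by
    calc _ = (2 * a - 1) / (2 * a - 1) := by ring
      _ = 1 := div_self hd.ne'
  have x2 : (1 - a) * (1 / (2 * a - 1)) + (1 - 1 / 2) * (2 * (a - 1) / (2 * a - 1)) = 0 := by ring
  rw [x1, x2]; simp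

lemma one_le_hellinger {a : ℝ} (ha : 1 < a) (p q : ProbabilityMeasure Ω) :
    1 ≤ hellinger a p q := by
  rcases one_le_rpow_hellinger_mul_rpow_affinity ha p q with h | h
  · have hd : 0 < 2 * a - 1 := by linarith
    have h2 : hellinger (1 / 2) p q ^ (2 * (a - 1) / (2 * a - 1)) ≤ 1 :=
      ENNReal.rpow_le_one (hellinger_le_one (by norm_num) (by norm_num) p q)
        (div_nonneg (by linarith) hd.le)
    have h3 : 1 ≤ hellinger a p q ^ (1 / (2 * a - 1)) :=
      h.trans (mul_le_of_le_one_right' h2)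
    by_contra! hlt
    exact absurd h3 (not_le.mpr (ENNReal.rpow_lt_one hlt (by positivity)))
  · rw [h]; exact le_top

/-- A Pinsker type inequality: if the affinity is close to one, so are the measures. -/
lemma setwiseClose_of_affinity {p q : ProbabilityMeasure Ω} {δ κ : ℝ} (hδ : 0 < δ)
    (hκ : κ ≤ δ ^ 2 / 8) (h : ENNReal.ofReal (1 - κ) ≤ hellinger (1 / 2) p q) :
    SetwiseClose p q δ := by
  obtain ⟨ν, f, g, hν, hf, hg, hp, hq, hft, hgt, hf1, hg1⟩ := exists_densities p q
  apply SetwiseClose.of_le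
  intro A hA
  have hpA : (p : Measure Ω) A = ∫⁻ y, A.indicator f y ∂ν := by
    rw [hp, withDensity_apply _ hA, lintegral_indicator hA]
  have hqA : (q : Measure Ω) A = ∫⁻ y, A.indicator g y ∂ν := by
    rw [hq, withDensity_apply _ hA, lintegral_indicator hA]
  -- With `u = √f`, `v = √g`, the weighted AM-GM inequality `|u - v| (u + v) ≤ (u - v)² / (2e) + e
  -- (u + v)² / 2` integrates to an error of at most `2e + κ / e`; at `e = δ / 4` each term is at
  -- most `δ / 2`.
  set e : ℝ := δ / 4 with he
  have he0 : 0 < e := by positivity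
  set k : ℝ := 1 / (2 * e) + e with hk
  have hk0 : 0 < k := by positivity
  -- The affinity is kept on the left-hand side, so that no truncated subtraction occurs.
  have hpt : ∀ᵐ y ∂ν, A.indicator f y + ENNReal.ofReal (1 / e) *
      (f y ^ (1 / 2 : ℝ) * g y ^ (1 - 1 / 2 : ℝ)) ≤
      A.indicator g y + ENNReal.ofReal k * (f y + g y) := by
    filter_upwards [hft, hgt] with y h2 h3
    have hff : f y = ENNReal.ofReal (f y).toReal := (ENNReal.ofReal_toReal h2).symm
    have hgg : g y = ENNReal.ofReal (g y).toReal := (ENNReal.ofReal_toReal h3).symm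
    set u := Real.sqrt (f y).toReal with hu
    set v := Real.sqrt (g y).toReal with hv
    have hu0 : 0 ≤ u := Real.sqrt_nonneg _
    have hv0 : 0 ≤ v := Real.sqrt_nonneg _
    have hu2 : (f y).toReal = u ^ 2 := (Real.sq_sqrt ENNReal.toReal_nonneg).symm
    have hv2 : (g y).toReal = v ^ 2 := (Real.sq_sqrt ENNReal.toReal_nonneg).symm
    have e1 : f y ^ (1 / 2 : ℝ) = ENNReal.ofReal u := by
      rw [hff, ENNReal.ofReal_rpow_of_nonneg ENNReal.toReal_nonneg (by norm_num), hu,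
        Real.sqrt_eq_rpow]
    have e2 : g y ^ (1 - 1 / 2 : ℝ) = ENNReal.ofReal v := by
      rw [hgg, ENNReal.ofReal_rpow_of_nonneg ENNReal.toReal_nonneg (by norm_num), hv,
        Real.sqrt_eq_rpow]
      norm_num
    have hre : |u ^ 2 - v ^ 2| + 1 / e * (u * v) ≤ k * (u ^ 2 + v ^ 2) := by
      have h4 : |u ^ 2 - v ^ 2| = |u - v| * (u + v) := by
        rw [sq_sub_sq, abs_mul, abs_of_nonneg (by positivity), mul_comm]
      have h5 : |u - v| * (u + v) ≤ 1 / (2 * e) * (u - v) ^ 2 + e / 2 * (u + v) ^ 2 := by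
        have h6 : 0 ≤ 1 / (2 * e) * (|u - v| - e * (u + v)) ^ 2 := by positivity
        have h7 : 1 / (2 * e) * (|u - v| - e * (u + v)) ^ 2 =
          1 / (2 * e) * |u - v| ^ 2 - |u - v| * (u + v) + e / 2 * (u + v) ^ 2 := by
          field_simp; ring
        rw [h7, sq_abs] at h6
        linarith
      have h8 : 1 / (2 * e) * (u - v) ^ 2 + 1 / e * (u * v) = 1 / (2 * e) * (u ^ 2 + v ^ 2) := by
        field_simp; ring
      have h9 : (u + v) ^ 2 ≤ 2 * (u ^ 2 + v ^ 2) := by nlinarith [sq_nonneg (u - v)]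
      have h10 : e / 2 * (u + v) ^ 2 ≤ e / 2 * (2 * (u ^ 2 + v ^ 2)) := by gcongr
      rw [h4, hk, add_mul]
      linarith
    by_cases hy : y ∈ A
    · rw [Set.indicator_of_mem hy, Set.indicator_of_mem hy, e1, e2, hff, hgg, hu2, hv2,
        ← ENNReal.ofReal_mul hu0, ← ENNReal.ofReal_mul (by positivity),
        ← ENNReal.ofReal_add (by positivity) (by positivity),
        ← ENNReal.ofReal_add (by positivity) (by positivity),
        ← ENNReal.ofReal_mul hk0.le, ← ENNReal.ofReal_add (by positivity) (by positivity)]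
      refine ENNReal.ofReal_le_ofReal ?_
      linarith [le_abs_self (u ^ 2 - v ^ 2)]
    · rw [Set.indicator_of_notMem hy, Set.indicator_of_notMem hy, e1, e2, hff, hgg, hu2, hv2,
        ← ENNReal.ofReal_mul hu0, ← ENNReal.ofReal_mul (by positivity),
        ← ENNReal.ofReal_add (by positivity) (by positivity),
        ← ENNReal.ofReal_mul hk0.le, zero_add, zero_add]
      refine ENNReal.ofReal_le_ofReal ?_
      linarith [abs_nonneg (u ^ 2 - v ^ 2)]
  have hint := lintegral_mono_ae hpt
  rw [lintegral_add_left (hf.indicator hA), lintegral_add_left (hg.indicator hA),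
    lintegral_const_mul _ (by fun_prop), lintegral_const_mul _ (by fun_prop),
    lintegral_add_left hf, hf1, hg1, ← hpA, ← hqA,
    ← hellinger_eq_of_withDensity (by norm_num) hf hg hp hq] at hint
  have hint2 : (p : Measure Ω) A + ENNReal.ofReal (1 / e) * ENNReal.ofReal (1 - κ) ≤
      (q : Measure Ω) A + ENNReal.ofReal k * (1 + 1) :=
    le_trans (by gcongr) hint
  have hr := ENNReal.toReal_mono (by finiteness) hint2
  rw [ENNReal.toReal_add (by finiteness) (by finiteness),
    ENNReal.toReal_add (by finiteness) (by finiteness), ENNReal.toReal_mul, ENNReal.toReal_mul,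
    ENNReal.toReal_ofReal (one_div_pos.mpr he0).le, ENNReal.toReal_ofReal hk0.le] at hr
  have h2 : (1 + 1 : ℝ≥0∞).toReal = 2 := by norm_num
  rw [h2] at hr
  have h3 : 1 - κ ≤ (ENNReal.ofReal (1 - κ)).toReal := by
    rw [ENNReal.toReal_ofReal']; exact le_max_left _ _
  have h4 : 1 / e * (1 - κ) ≤ 1 / e * (ENNReal.ofReal (1 - κ)).toReal := by gcongr
  have h5 : k * 2 = 1 / e + 2 * e := by rw [hk]; field_simp
  have h6 : 1 / e * κ ≤ δ / 2 := by
    have : 1 / e * κ ≤ 1 / e * (δ ^ 2 / 8) := by gcongr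
    refine this.trans (le_of_eq ?_)
    rw [he]; field_simp; ring
  change ((p : Measure Ω) A).toReal ≤ ((q : Measure Ω) A).toReal + δ
  have h7 : 2 * e = δ / 2 := by rw [he]; ring
  have h8 : 1 / e * (1 - κ) = 1 / e - 1 / e * κ := by ring
  linarith

end Hellinger

/-! ### Mixtures, mean measures and their normalization. -/

section Mean

variable {Ω : Type*} [MeasurableSpace Ω]

lemma mixture_apply (P : ProbabilityMeasure Ω →₀ ℝ≥0) (A : Set Ω) :
    mixture P A = ∑ W ∈ P.support, (P W : ℝ≥0∞) * (W : Measure Ω) A := by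
  rw [mixture, Measure.finsetSum_apply]
  rfl

instance isFiniteMeasure_mixture (P : ProbabilityMeasure Ω →₀ ℝ≥0) :
    IsFiniteMeasure (mixture P) := by
  refine ⟨?_⟩
  rw [mixture_apply]
  exact ENNReal.sum_lt_top.mpr fun W _ => by finiteness

lemma absolutelyContinuous_mixture {P : ProbabilityMeasure Ω →₀ ℝ≥0} {W : ProbabilityMeasure Ω}
    (hW : W ∈ P.support) : (W : Measure Ω) ≪ mixture P := by
  intro A hA
  rw [mixture_apply, Finset.sum_eq_zero_iff] at hA
  have := hA W hW
  rw [mul_eq_zero] at this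
  refine this.resolve_left ?_
  simpa using hW

lemma mixture_absolutelyContinuous {P : ProbabilityMeasure Ω →₀ ℝ≥0} {ν : Measure Ω}
    (h : ∀ W ∈ P.support, (W : Measure Ω) ≪ ν) : mixture P ≪ ν := by
  intro A hA
  rw [mixture_apply, Finset.sum_eq_zero_iff]
  intro W hW
  rw [h W hW hA, mul_zero]

/-- The order `α` mean, weighted by the prior `P`, of a family of functions. -/
def weightedMean (α : ℝ≥0∞) (P : ProbabilityMeasure Ω →₀ ℝ≥0)
    (w : ProbabilityMeasure Ω → Ω → ℝ≥0∞) (y : Ω) : ℝ≥0∞ :=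
  if α = ∞ then ⨆ W ∈ P.support, w W y
  else (∑ W ∈ P.support, (P W : ℝ≥0∞) * w W y ^ α.toReal) ^ (1 / α.toReal)

lemma meanDensity_eq (α : ℝ≥0∞) (P : ProbabilityMeasure Ω →₀ ℝ≥0) (ν : Measure Ω) :
    meanDensity α P ν = weightedMean α P (fun W => (W : Measure Ω).rnDeriv ν) := rfl

variable {α : ℝ≥0∞} {P : ProbabilityMeasure Ω →₀ ℝ≥0} {w : ProbabilityMeasure Ω → Ω → ℝ≥0∞}

lemma measurable_weightedMean (hw : ∀ W, Measurable (w W)) :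
    Measurable (weightedMean α P w) := by
  unfold weightedMean
  by_cases h : α = ∞
  · simp only [h, if_true]
    exact Measurable.biSup _ P.support.countable_toSet fun W _ => hw W
  · simp only [h, if_false]
    fun_prop

/-- This homogeneity makes the mean measure independent of the reference measure. -/
lemma weightedMean_mul (hα : 0 < α) (r : ℝ≥0∞) (y : Ω) :
    weightedMean α P (fun W y => r * w W y) y = r * weightedMean α P w y := by
  unfold weightedMean
  by_cases h : α = ∞
  · simp only [h, if_true, ENNReal.mul_iSup]
  · have ha : 0 < α.toReal := ENNReal.toReal_pos hα.ne' h
    simp only [h, if_false, ENNReal.mul_rpow_of_nonneg _ _ ha.le]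
    have : ∀ W, (P W : ℝ≥0∞) * (r ^ α.toReal * w W y ^ α.toReal) =
      r ^ α.toReal * ((P W : ℝ≥0∞) * w W y ^ α.toReal) := fun W => by ring
    simp only [this]
    rw [← Finset.mul_sum, ENNReal.mul_rpow_of_nonneg _ _ (by positivity), ← ENNReal.rpow_mul,
      mul_one_div_cancel ha.ne', ENNReal.rpow_one]

lemma weightedMean_congr {w' : ProbabilityMeasure Ω → Ω → ℝ≥0∞} {y y' : Ω}
    (h : ∀ W ∈ P.support, w W y = w' W y') : weightedMean α P w y = weightedMean α P w' y' := by
  unfold weightedMean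
  split_ifs
  · exact iSup_congr fun W => iSup_congr fun hW => h W hW
  · exact congrArg (· ^ _) (Finset.sum_congr rfl fun W hW => by rw [h W hW])

/-- A crude bound valid at every order; it makes the mean measure finite. -/
lemma weightedMean_le_sum (hα : 0 < α) (hP : ∑ W ∈ P.support, P W = 1) (y : Ω) :
    weightedMean α P w y ≤ ∑ W ∈ P.support, w W y := by
  unfold weightedMean
  split_ifs with h
  · exact iSup₂_le fun W hW => Finset.single_le_sum (f := fun W => w W y) (fun _ _ => zero_le) hW
  · have ha : 0 < α.toReal := ENNReal.toReal_pos hα.ne' h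
    set s := ∑ W ∈ P.support, w W y
    have h1 : ∑ W ∈ P.support, (P W : ℝ≥0∞) * w W y ^ α.toReal ≤ s ^ α.toReal := by
      calc _ ≤ ∑ W ∈ P.support, (P W : ℝ≥0∞) * s ^ α.toReal := by
            refine Finset.sum_le_sum fun W hW => ?_
            gcongr
            exact Finset.single_le_sum (f := fun W => w W y) (fun _ _ => zero_le) hW
        _ = s ^ α.toReal := by
            rw [← Finset.sum_mul, ← ENNReal.ofNNReal_finsetSum, hP]; simp
    calc _ ≤ (s ^ α.toReal) ^ (1 / α.toReal) := by gcongr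
      _ = s := by rw [← ENNReal.rpow_mul, mul_one_div_cancel ha.ne', ENNReal.rpow_one]

lemma eq_zero_of_weightedMean_eq_zero (hα : 0 < α) {y : Ω} (h : weightedMean α P w y = 0)
    {W : ProbabilityMeasure Ω} (hW : W ∈ P.support) : w W y = 0 := by
  unfold weightedMean at h
  split_ifs at h with h'
  · have := le_iSup₂ (f := fun W (_ : W ∈ P.support) => w W y) W hW
    rw [h] at this
    exact le_antisymm this zero_le
  · have ha : 0 < α.toReal := ENNReal.toReal_pos hα.ne' h'
    rw [ENNReal.rpow_eq_zero_iff_of_pos (by positivity), Finset.sum_eq_zero_iff] at h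
    have h2 := (mul_eq_zero.mp (h W hW)).resolve_left (by simpa using hW)
    rwa [ENNReal.rpow_eq_zero_iff_of_pos ha] at h2

/-- The mean measure can be computed with any reference measure. -/
lemma meanMeasure_eq_withDensity (hα : 0 < α) {ν : Measure Ω} [IsFiniteMeasure ν]
    (hw : ∀ W, Measurable (w W))
    (h : ∀ W ∈ P.support, (W : Measure Ω) = ν.withDensity (w W)) :
    meanMeasure α P = ν.withDensity (weightedMean α P w) := by
  have hac : mixture P ≪ ν := mixture_absolutelyContinuous fun W hW => by
    rw [h W hW]; exact withDensity_absolutelyContinuous _ _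
  have hmeas : Measurable (weightedMean α P fun W => (W : Measure Ω).rnDeriv (mixture P)) :=
    measurable_weightedMean fun W => Measure.measurable_rnDeriv _ _
  have hmul := withDensity_mul ν (Measure.measurable_rnDeriv (mixture P) ν) hmeas
  rw [Measure.withDensity_rnDeriv_eq _ _ hac] at hmul
  rw [meanMeasure, meanDensity_eq, ← hmul]
  refine withDensity_congr_ae ?_
  have h1 : ∀ᵐ y ∂ν, ∀ W ∈ P.support,
      w W y = (mixture P).rnDeriv ν y * (W : Measure Ω).rnDeriv (mixture P) y := by
    refine (ae_ball_iff P.support.countable_toSet).mpr fun W hW => ?_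
    filter_upwards [ae_rnDeriv_eq_mul (ν := ν) (absolutelyContinuous_mixture hW),
      Measure.rnDeriv_withDensity ν (hw W)] with y h2 h3
    rw [← h2, ← h3]
    conv_rhs => rw [h W hW]
  filter_upwards [h1] with y hy
  rw [Pi.mul_apply, ← weightedMean_mul hα]
  exact weightedMean_congr fun W hW => (hy W hW).symm

lemma meanMeasure_univ_ne_top (hα : 0 < α) (hP : ∑ W ∈ P.support, P W = 1) :
    meanMeasure α P Set.univ ≠ ∞ := by
  rw [meanMeasure, withDensity_apply _ MeasurableSet.univ, Measure.restrict_univ, meanDensity_eq]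
  refine ne_top_of_le_ne_top ?_ (lintegral_mono fun y => weightedMean_le_sum hα hP y)
  rw [lintegral_finsetSum _ fun W _ => Measure.measurable_rnDeriv _ _]
  exact (ENNReal.sum_lt_top.mpr fun W _ => Measure.lintegral_rnDeriv_lt_top _ _).ne

lemma exists_mem_support (hP : ∑ W ∈ P.support, P W = 1) : ∃ W, W ∈ P.support := by
  by_contra! h
  rw [Finset.eq_empty_of_forall_notMem h] at hP
  simp at hP

lemma meanMeasure_univ_ne_zero (hα : 0 < α) (hP : ∑ W ∈ P.support, P W = 1) :
    meanMeasure α P Set.univ ≠ 0 := by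
  obtain ⟨W, hW⟩ := exists_mem_support hP
  rw [meanMeasure, withDensity_apply _ MeasurableSet.univ, Measure.restrict_univ, meanDensity_eq]
  intro h0
  rw [lintegral_eq_zero_iff (measurable_weightedMean fun W => Measure.measurable_rnDeriv _ _)] at h0
  have h1 : (W : Measure Ω).rnDeriv (mixture P) =ᵐ[mixture P] 0 := by
    filter_upwards [h0] with y hy using eq_zero_of_weightedMean_eq_zero hα hy hW
  have h2 := Measure.lintegral_rnDeriv (absolutelyContinuous_mixture hW)
  rw [lintegral_congr_ae h1] at h2
  simp at h2

/-- A measure of finite positive mass, normalized to a probability measure. -/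
def normalize (μ : Measure Ω) (h0 : μ Set.univ ≠ 0) (h : μ Set.univ ≠ ∞) :
    ProbabilityMeasure Ω :=
  ⟨(μ Set.univ)⁻¹ • μ, ⟨by simpa using ENNReal.inv_mul_cancel h0 h⟩⟩

/-- The normalized mean measure; a default value is used if `P` is not a prior. -/
def meanCenter (W₀ : ProbabilityMeasure Ω) (α : ℝ≥0∞) (P : ProbabilityMeasure Ω →₀ ℝ≥0) :
    ProbabilityMeasure Ω :=
  if h : meanMeasure α P Set.univ ≠ 0 ∧ meanMeasure α P Set.univ ≠ ∞ then
    normalize (meanMeasure α P) h.1 h.2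
  else W₀

lemma meanCenter_eq_withDensity (W₀ : ProbabilityMeasure Ω) (hα : 0 < α)
    (hP : ∑ W ∈ P.support, P W = 1) {ν : Measure Ω} [IsFiniteMeasure ν]
    (hw : ∀ W, Measurable (w W))
    (h : ∀ W ∈ P.support, (W : Measure Ω) = ν.withDensity (w W)) :
    (meanCenter W₀ α P : Measure Ω) =
      ν.withDensity (fun y => (meanMeasure α P Set.univ)⁻¹ * weightedMean α P w y) := by
  have h1 : (meanCenter W₀ α P : Measure Ω) =
      (meanMeasure α P Set.univ)⁻¹ • meanMeasure α P := by
    rw [meanCenter, dif_pos ⟨meanMeasure_univ_ne_zero hα hP, meanMeasure_univ_ne_top hα hP⟩]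
    rfl
  rw [h1]
  conv_lhs => rw [meanMeasure_eq_withDensity (P := P) hα hw h]
  rw [← withDensity_smul _ (measurable_weightedMean hw), ← meanMeasure_eq_withDensity hα hw h]
  rfl

end Mean

/-! ### From setwise convergence to almost everywhere convergence of densities. -/

section DensityConvergence

variable {Ω : Type*} [MeasurableSpace Ω]

/-- The positive part of `f - g` lives on `{g < f}`, where its integral is the difference of the two
measures of that set. -/
lemma lintegral_tsub_le_of_setwiseClose {p q : ProbabilityMeasure Ω} {δ : ℝ}
    (h : SetwiseClose p q δ) {ν : Measure Ω} {f g : Ω → ℝ≥0∞} (hf : Measurable f)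
    (hg : Measurable g) (hp : (p : Measure Ω) = ν.withDensity f)
    (hq : (q : Measure Ω) = ν.withDensity g) : ∫⁻ y, (f y - g y) ∂ν ≤ ENNReal.ofReal δ := by
  set A := {y | g y < f y} with hA
  have hAm : MeasurableSet A := measurableSet_lt hg hf
  have h1 : ∫⁻ y, (f y - g y) ∂ν = ∫⁻ y in A, (f y - g y) ∂ν := by
    rw [← lintegral_indicator hAm]
    refine lintegral_congr fun y => ?_
    by_cases hy : y ∈ A
    · rw [Set.indicator_of_mem hy]
    · rw [Set.indicator_of_notMem hy]
      exact tsub_eq_zero_of_le (not_lt.mp hy)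
  have hgA : ∫⁻ y in A, g y ∂ν = (q : Measure Ω) A := by rw [hq, withDensity_apply _ hAm]
  have hfA : ∫⁻ y in A, f y ∂ν = (p : Measure Ω) A := by rw [hp, withDensity_apply _ hAm]
  rw [h1, lintegral_sub hg (by rw [hgA]; finiteness)
    ((ae_restrict_iff' hAm).mpr (Eventually.of_forall fun y hy => le_of_lt hy)), hgA, hfA]
  rw [tsub_le_iff_left]
  have h2 := (abs_le.mp (h A hAm)).2
  rw [← ENNReal.ofReal_toReal (measure_ne_top (p : Measure Ω) A),
    ← ENNReal.ofReal_toReal (measure_ne_top (q : Measure Ω) A)]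
  refine le_trans (ENNReal.ofReal_le_ofReal (q := ((q : Measure Ω) A).toReal + δ) ?_)
    ENNReal.ofReal_add_le
  simp only [measureReal_def] at h2
  linarith

/-- Choosing the approximations at distance `2⁻ⁿ` makes the `L¹` distances of the densities
summable, so the densities converge almost everywhere without extracting a subsequence. The
reference measure is `W + q + ∑ 2⁻⁽ⁿ⁺¹⁾ u n`. This feeds Fatou's lemma. -/
lemma exists_seq_tendsto_densities {W q : ProbabilityMeasure Ω}
    {C : ProbabilityMeasure Ω → Prop} (h : ∀ δ > 0, ∃ q', SetwiseClose q' q δ ∧ C q') :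
    ∃ (u : ℕ → ProbabilityMeasure Ω) (ν : Measure Ω), IsFiniteMeasure ν ∧ (∀ n, C (u n)) ∧
      (W : Measure Ω) ≪ ν ∧ (q : Measure Ω) ≪ ν ∧ (∀ n, (u n : Measure Ω) ≪ ν) ∧
      ∀ᵐ y ∂ν, Tendsto (fun n => (u n : Measure Ω).rnDeriv ν y) atTop
        (𝓝 ((q : Measure Ω).rnDeriv ν y)) := by
  choose u hu hC using fun n : ℕ => h ((1 / 2 : ℝ) ^ n) (by positivity)
  let κ : Measure Ω := Measure.sum fun n => ((2 : ℝ≥0∞)⁻¹ ^ (n + 1)) • (u n : Measure Ω)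
  have hκ : IsFiniteMeasure κ := by
    refine ⟨?_⟩
    rw [Measure.sum_apply _ MeasurableSet.univ]
    simp [ENNReal.tsum_geometric_add_one, ENNReal.inv_mul_cancel]
  let ν : Measure Ω := (W : Measure Ω) + q + κ
  have hW : (W : Measure Ω) ≪ ν :=
    Measure.absolutelyContinuous_of_le (Measure.le_add_right (Measure.le_add_right le_rfl))
  have hq : (q : Measure Ω) ≪ ν :=
    Measure.absolutelyContinuous_of_le (Measure.le_add_right (Measure.le_add_left le_rfl))
  have hun : ∀ n, (u n : Measure Ω) ≪ ν := by
    intro n A hA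
    have h1 : κ A = 0 := by
      have : κ ≤ ν := Measure.le_add_left le_rfl
      exact le_antisymm ((this A).trans hA.le) zero_le
    have h2 := Measure.sum_apply_eq_zero.mp h1 n
    simpa using h2
  refine ⟨u, ν, inferInstance, hC, hW, hq, hun, ?_⟩
  set g := (q : Measure Ω).rnDeriv ν
  set G := fun n => (u n : Measure Ω).rnDeriv ν
  have hgm : Measurable g := Measure.measurable_rnDeriv _ _
  have hGm : ∀ n, Measurable (G n) := fun n => Measure.measurable_rnDeriv _ _
  have hgd := (Measure.withDensity_rnDeriv_eq _ _ hq).symm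
  have hGd := fun n => (Measure.withDensity_rnDeriv_eq _ _ (hun n)).symm
  have hsum : ∫⁻ y, ∑' n, ((G n y - g y) + (g y - G n y)) ∂ν ≠ ∞ := by
    rw [lintegral_tsum fun n => by fun_prop]
    have hle : ∀ n, ∫⁻ y, ((G n y - g y) + (g y - G n y)) ∂ν ≤ 2 * (2 : ℝ≥0∞)⁻¹ ^ n := by
      intro n
      have e : ENNReal.ofReal ((1 / 2 : ℝ) ^ n) = (2 : ℝ≥0∞)⁻¹ ^ n := by
        rw [ENNReal.ofReal_pow (by norm_num), one_div, ENNReal.ofReal_inv_of_pos two_pos]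
        simp
      rw [lintegral_add_left (by fun_prop), two_mul, ← e]
      exact add_le_add (lintegral_tsub_le_of_setwiseClose (hu n) (hGm n) hgm (hGd n) hgd)
        (lintegral_tsub_le_of_setwiseClose (hu n).symm hgm (hGm n) hgd (hGd n))
    refine ne_top_of_le_ne_top ?_ (ENNReal.tsum_le_tsum hle)
    rw [ENNReal.tsum_mul_left, ENNReal.tsum_geometric]
    simp [ENNReal.mul_eq_top]
  filter_upwards [ae_lt_top' (by fun_prop) hsum,
    Measure.rnDeriv_ne_top (q : Measure Ω) ν] with y hy hgy
  have h0 := ENNReal.tendsto_atTop_zero_of_tsum_ne_top hy.ne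
  have hlow : Tendsto (fun n => g y - ((G n y - g y) + (g y - G n y))) atTop (𝓝 (g y)) := by
    have := ENNReal.Tendsto.sub (tendsto_const_nhds (x := g y)) h0 (Or.inl hgy)
    simpa using this
  have hup : Tendsto (fun n => g y + ((G n y - g y) + (g y - G n y))) atTop (𝓝 (g y)) := by
    have := (tendsto_const_nhds (x := g y)).add h0
    simpa using this
  refine tendsto_of_tendsto_of_tendsto_of_le_of_le hlow hup (fun n => ?_) fun n => ?_
  · refine tsub_le_iff_left.mpr ?_
    calc g y ≤ (g y - G n y) + G n y := le_tsub_add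
      _ ≤ _ := by gcongr; exact le_add_self
  · calc G n y ≤ g y + (G n y - g y) := le_add_tsub
      _ ≤ _ := by gcongr; exact le_self_add

end DensityConvergence

/-! ### Divergence bounds as Hellinger bounds, and Sibson's identity at finite orders other than
one. -/

section Order

lemma one_div_mul_le_iff_of_pos {r : ℝ} (hr : 0 < r) (L : EReal) (x : ℝ) :
    ((1 / r : ℝ) : EReal) * L ≤ x ↔ L ≤ ((r * x : ℝ) : EReal) := by
  have hr' : 0 < 1 / r := by positivity
  induction L with
  | bot => rw [EReal.coe_mul_bot_of_pos hr']; exact iff_of_true bot_le bot_le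
  | top =>
    rw [EReal.coe_mul_top_of_pos hr']
    exact iff_of_false (not_le.mpr (EReal.coe_lt_top _)) (not_le.mpr (EReal.coe_lt_top _))
  | coe l =>
    rw [← EReal.coe_mul, EReal.coe_le_coe_iff, EReal.coe_le_coe_iff, one_div, inv_mul_le_iff₀ hr]

lemma one_div_mul_le_iff_of_neg {r : ℝ} (hr : r < 0) (L : EReal) (x : ℝ) :
    ((1 / r : ℝ) : EReal) * L ≤ x ↔ ((r * x : ℝ) : EReal) ≤ L := by
  have hr' : 1 / r < 0 := one_div_neg.mpr hr
  induction L with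
  | bot =>
    rw [EReal.coe_mul_bot_of_neg hr']
    exact iff_of_false (not_le.mpr (EReal.coe_lt_top _)) (not_le.mpr (EReal.bot_lt_coe _))
  | top => rw [EReal.coe_mul_top_of_neg hr']; exact iff_of_true bot_le le_top
  | coe l =>
    rw [← EReal.coe_mul, EReal.coe_le_coe_iff, EReal.coe_le_coe_iff, one_div_mul_eq_div,
      div_le_iff_of_neg hr, mul_comm]

lemma log_le_coe_iff (h : ℝ≥0∞) (y : ℝ) :
    ENNReal.log h ≤ (y : EReal) ↔ h ≤ ENNReal.ofReal (Real.exp y) := by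
  rw [← EReal.log_exp (y : EReal), ENNReal.log_le_log_iff, EReal.exp_coe]

lemma coe_le_log_iff (h : ℝ≥0∞) (y : ℝ) :
    (y : EReal) ≤ ENNReal.log h ↔ ENNReal.ofReal (Real.exp y) ≤ h := by
  rw [← EReal.log_exp (y : EReal), ENNReal.log_le_log_iff, EReal.exp_coe]

variable {Ω : Type*} [MeasurableSpace Ω] {α : ℝ≥0∞}

lemma renyiDiv_eq_log_hellinger (hα : α ≠ ∞) (hα1 : α ≠ 1) (W Q : ProbabilityMeasure Ω) :
    renyiDiv α W Q = ((1 / (α.toReal - 1) : ℝ) : EReal) *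
      ENNReal.log (hellinger α.toReal W Q) := by
  rw [renyiDiv, if_neg hα, if_neg hα1]
  rfl

lemma renyiDiv_le_iff_of_one_lt (hα : α ≠ ∞) (hα1 : 1 < α.toReal) (W Q : ProbabilityMeasure Ω)
    (x : ℝ) : renyiDiv α W Q ≤ x ↔
      hellinger α.toReal W Q ≤ ENNReal.ofReal (Real.exp ((α.toReal - 1) * x)) := by
  rw [renyiDiv_eq_log_hellinger hα (by rintro rfl; simp at hα1),
    one_div_mul_le_iff_of_pos (by linarith), log_le_coe_iff]

lemma renyiDiv_le_iff_of_lt_one (hα : α ≠ ∞) (hα1 : α.toReal < 1) (W Q : ProbabilityMeasure Ω)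
    (x : ℝ) : renyiDiv α W Q ≤ x ↔
      ENNReal.ofReal (Real.exp ((α.toReal - 1) * x)) ≤ hellinger α.toReal W Q := by
  rw [renyiDiv_eq_log_hellinger hα (by rintro rfl; simp at hα1),
    one_div_mul_le_iff_of_neg (by linarith), coe_le_log_iff]

/-- The Hellinger integral averaged over a prior. -/
def hellingerSum (a : ℝ) (P : ProbabilityMeasure Ω →₀ ℝ≥0) (q : ProbabilityMeasure Ω) : ℝ≥0∞ :=
  P.sum fun W x => (x : ℝ≥0∞) * hellinger a W q

lemma hellingerSum_mix {a : ℝ} (P P' : ProbabilityMeasure Ω →₀ ℝ≥0) (s t : ℝ≥0)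
    (q : ProbabilityMeasure Ω) :
    hellingerSum a (s • P + t • P') q = s * hellingerSum a P q + t * hellingerSum a P' q := by
  rw [hellingerSum, sum_add_smul _ _ _ (by simp) (by intros; push_cast; ring)]
  simp only [hellingerSum, Finsupp.sum, Finset.mul_sum, ENNReal.coe_mul, mul_assoc]

lemma hellingerSum_single {a : ℝ} (W q : ProbabilityMeasure Ω) :
    hellingerSum a (Finsupp.single W 1) q = hellinger a W q := by
  rw [hellingerSum, Finsupp.sum_single_index] <;> simp

lemma sum_coe_mul_const {P : ProbabilityMeasure Ω →₀ ℝ≥0} (hP : ∑ W ∈ P.support, P W = 1)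
    (c : ℝ≥0∞) : ∑ W ∈ P.support, (P W : ℝ≥0∞) * c = c := by
  rw [← Finset.sum_mul, ← ENNReal.ofNNReal_finsetSum, hP]; simp

/-- Sibson's identity for the Hellinger integrals. -/
lemma hellingerSum_eq (W₀ : ProbabilityMeasure Ω) (hα : 0 < α) (hα' : α ≠ ∞)
    {P : ProbabilityMeasure Ω →₀ ℝ≥0} (hP : ∑ W ∈ P.support, P W = 1)
    (q : ProbabilityMeasure Ω) :
    hellingerSum α.toReal P q =
      meanMeasure α P Set.univ ^ α.toReal * hellinger α.toReal (meanCenter W₀ α P) q := by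
  have ha : 0 < α.toReal := ENNReal.toReal_pos hα.ne' hα'
  set ν : Measure Ω := mixture P + q with hν
  have hq : (q : Measure Ω) ≪ ν :=
    Measure.absolutelyContinuous_of_le (Measure.le_add_left le_rfl)
  have hW : ∀ W ∈ P.support, (W : Measure Ω) ≪ ν := fun W hW =>
    (absolutelyContinuous_mixture hW).trans
      (Measure.absolutelyContinuous_of_le (Measure.le_add_right le_rfl))
  set w : ProbabilityMeasure Ω → Ω → ℝ≥0∞ := fun W => (W : Measure Ω).rnDeriv ν with hw
  have hwm : ∀ W, Measurable (w W) := fun W => Measure.measurable_rnDeriv _ _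
  have hwd : ∀ W ∈ P.support, (W : Measure Ω) = ν.withDensity (w W) := fun W h =>
    (Measure.withDensity_rnDeriv_eq _ _ (hW W h)).symm
  set g := (q : Measure Ω).rnDeriv ν with hg
  have hgm : Measurable g := Measure.measurable_rnDeriv _ _
  have hgd := (Measure.withDensity_rnDeriv_eq _ _ hq).symm
  have hcd := meanCenter_eq_withDensity W₀ hα hP hwm hwd
  set F := meanMeasure α P Set.univ with hF
  have hF0 : F ≠ 0 := meanMeasure_univ_ne_zero hα hP
  have hFt : F ≠ ∞ := meanMeasure_univ_ne_top hα hP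
  have hmm : Measurable (weightedMean α P w) := measurable_weightedMean hwm
  rw [hellinger_eq_of_withDensity ha
    (f := fun y => F⁻¹ * weightedMean α P w y) (measurable_const.mul hmm) hgm hcd hgd]
  -- The `α`-th power of the mean density is the `P`-average of the `α`-th powers, so the integrand
  -- is linear in the prior.
  have hpt : ∀ y, (F⁻¹ * weightedMean α P w y) ^ α.toReal * g y ^ (1 - α.toReal) =
      (F ^ α.toReal)⁻¹ * ∑ W ∈ P.support,
        (P W : ℝ≥0∞) * (w W y ^ α.toReal * g y ^ (1 - α.toReal)) := by
    intro y
    have : weightedMean α P w y ^ α.toReal =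
        ∑ W ∈ P.support, (P W : ℝ≥0∞) * w W y ^ α.toReal := by
      rw [weightedMean, if_neg hα', ← ENNReal.rpow_mul, one_div_mul_cancel ha.ne',
        ENNReal.rpow_one]
    rw [ENNReal.mul_rpow_of_nonneg _ _ ha.le, this, ENNReal.inv_rpow, mul_assoc, Finset.sum_mul]
    simp only [mul_assoc]
  rw [lintegral_congr hpt, lintegral_const_mul _ (by fun_prop), ← mul_assoc, ENNReal.mul_inv_cancel, one_mul,
    lintegral_finsetSum _ fun W _ => by fun_prop]
  · refine Finset.sum_congr rfl fun W h => ?_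
    beta_reduce
    rw [lintegral_const_mul _ (by fun_prop),
      hellinger_eq_of_withDensity ha (hwm W) hgm (hwd W h) hgd]
  · simp [ENNReal.rpow_eq_zero_iff, hF0, hFt]
  · exact ENNReal.rpow_ne_top_of_nonneg ha.le hFt

/-- Turns the factor in the multiplicative identity `hellingerSum_eq` into the information term of
Sibson's additive identity. -/
lemma ofReal_exp_information (hα : 0 < α) (hα' : α ≠ ∞) (hα1 : α ≠ 1)
    {P : ProbabilityMeasure Ω →₀ ℝ≥0} (hP : ∑ W ∈ P.support, P W = 1) :
    ENNReal.ofReal (Real.exp ((α.toReal - 1) * renyiInformation α P)) =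
      meanMeasure α P Set.univ ^ α.toReal := by
  have hF0 : meanMeasure α P Set.univ ≠ 0 := meanMeasure_univ_ne_zero hα hP
  have hFt : meanMeasure α P Set.univ ≠ ∞ := meanMeasure_univ_ne_top hα hP
  have hpos : 0 < (meanMeasure α P Set.univ).toReal := ENNReal.toReal_pos hF0 hFt
  have ha1 : α.toReal - 1 ≠ 0 := by
    intro h
    have : α.toReal = 1 := by linarith
    exact hα1 ((ENNReal.toReal_eq_one_iff _).mp this)
  rw [renyiInformation, if_neg hα', if_neg hα1]
  have e : (α.toReal - 1) * (α.toReal / (α.toReal - 1) *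
      Real.log (meanMeasure α P Set.univ).toReal) =
      Real.log (meanMeasure α P Set.univ).toReal * α.toReal := by
    field_simp
  rw [e, ← Real.rpow_def_of_pos hpos, ← ENNReal.ofReal_rpow_of_pos hpos, ENNReal.ofReal_toReal hFt]

lemma hellingerSum_mix_center (W₀ : ProbabilityMeasure Ω) (hα : 0 < α) (hα' : α ≠ ∞)
    (hα1 : α ≠ 1) {P : ProbabilityMeasure Ω →₀ ℝ≥0} (hP : ∑ W ∈ P.support, P W = 1) :
    hellingerSum α.toReal P (meanCenter W₀ α P) =
      ENNReal.ofReal (Real.exp ((α.toReal - 1) * renyiInformation α P)) := by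
  rw [hellingerSum_eq W₀ hα hα' hP, hellinger_self (ENNReal.toReal_pos hα.ne' hα'), mul_one,
    ofReal_exp_information hα hα' hα1 hP]

/-- Combines `exp (-x) ≥ 1 - x` with `setwiseClose_of_affinity`; `η` is the value for which `k η =
δ² / 8`. -/
lemma exists_setwiseClose_of_exp_le_affinity {Ω : Type*} [MeasurableSpace Ω] {k : ℝ} (hk : 0 < k)
    {C : ℝ → ProbabilityMeasure Ω → ProbabilityMeasure Ω → Prop}
    (h : ∀ η > 0, ∀ p q, C η p q → ENNReal.ofReal (Real.exp (-(k * η))) ≤ hellinger (1 / 2) p q)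
    {δ : ℝ} (hδ : 0 < δ) : ∃ η > 0, ∀ p q, C η p q → SetwiseClose p q δ := by
  refine ⟨δ ^ 2 / 8 / k, by positivity, fun p q hpq => ?_⟩
  refine setwiseClose_of_affinity hδ le_rfl
    (le_trans (ENNReal.ofReal_le_ofReal ?_) (h _ (by positivity) p q hpq))
  have := Real.add_one_le_exp (-(k * (δ ^ 2 / 8 / k)))
  rw [mul_div_cancel₀ _ hk.ne'] at this ⊢
  linarith

lemma ofReal_exp_rpow (x t : ℝ) :
    ENNReal.ofReal (Real.exp x) ^ t = ENNReal.ofReal (Real.exp (x * t)) := by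
  rw [ENNReal.ofReal_rpow_of_pos (Real.exp_pos _), Real.exp_mul]

lemma exp_le_of_exp_le_rpow {x t : ℝ} (ht : 0 < t) {B : ℝ≥0∞}
    (h : ENNReal.ofReal (Real.exp x) ≤ B ^ t) : ENNReal.ofReal (Real.exp (x / t)) ≤ B := by
  have h1 := ENNReal.rpow_le_rpow h (one_div_pos.mpr ht).le
  rwa [ofReal_exp_rpow, ← ENNReal.rpow_mul, mul_one_div_cancel ht.ne', ENNReal.rpow_one,
    mul_one_div] at h1

end Order

/-! ### Orders in `(0,1)`. -/

section LessThanOne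

variable {Ω : Type*} [MeasurableSpace Ω] {α : ℝ≥0∞}

/-- Subadditivity of `x ^ (1 - a)` splits off the contribution of `g' - g`, which Hölder's
inequality bounds by the setwise distance. -/
lemma hellinger_le_add_of_setwiseClose {a : ℝ} (ha : 0 < a) (ha1 : a < 1)
    {W q q' : ProbabilityMeasure Ω} {δ : ℝ} (h : SetwiseClose q' q δ) :
    hellinger a W q' ≤ hellinger a W q + ENNReal.ofReal δ ^ (1 - a) := by
  set ν : Measure Ω := (W : Measure Ω) + q + q' with hν
  have hW : (W : Measure Ω) ≪ ν :=
    Measure.absolutelyContinuous_of_le (Measure.le_add_right (Measure.le_add_right le_rfl))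
  have hq : (q : Measure Ω) ≪ ν :=
    Measure.absolutelyContinuous_of_le (Measure.le_add_right (Measure.le_add_left le_rfl))
  have hq' : (q' : Measure Ω) ≪ ν :=
    Measure.absolutelyContinuous_of_le (Measure.le_add_left le_rfl)
  rw [hellinger_eq_lintegral ha hW hq, hellinger_eq_lintegral ha hW hq']
  set f := (W : Measure Ω).rnDeriv ν
  set g := (q : Measure Ω).rnDeriv ν
  set g' := (q' : Measure Ω).rnDeriv ν
  have hf : Measurable f := Measure.measurable_rnDeriv _ _
  have hg : Measurable g := Measure.measurable_rnDeriv _ _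
  have hg' : Measurable g' := Measure.measurable_rnDeriv _ _
  have hf1 : ∫⁻ y, f y ∂ν = 1 := by rw [Measure.lintegral_rnDeriv hW]; simp
  have h1 := ENNReal.lintegral_mul_norm_pow_le (μ := ν) (f := f) (g := fun y => g' y - g y)
    hf.aemeasurable (by fun_prop) ha.le (by linarith : 0 ≤ 1 - a) (by ring)
  rw [hf1, ENNReal.one_rpow, one_mul] at h1
  have h2 := lintegral_tsub_le_of_setwiseClose h hg' hg
    (Measure.withDensity_rnDeriv_eq _ _ hq').symm (Measure.withDensity_rnDeriv_eq _ _ hq).symm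
  calc ∫⁻ y, f y ^ a * g' y ^ (1 - a) ∂ν
      ≤ ∫⁻ y, (f y ^ a * g y ^ (1 - a) + f y ^ a * (g' y - g y) ^ (1 - a)) ∂ν := by
        refine lintegral_mono fun y => ?_
        dsimp only
        rw [← mul_add]
        gcongr
        refine le_trans (ENNReal.rpow_le_rpow (le_add_tsub (b := g y)) (by linarith)) ?_
        exact ENNReal.rpow_add_le_add_rpow _ _ (by linarith) (by linarith)
    _ = ∫⁻ y, f y ^ a * g y ^ (1 - a) ∂ν + ∫⁻ y, f y ^ a * (g' y - g y) ^ (1 - a) ∂ν :=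
        lintegral_add_left (by fun_prop) _
    _ ≤ _ := by
        gcongr
        exact h1.trans (ENNReal.rpow_le_rpow h2 (by linarith))

/-- The system of the orders in `(0,1)`. -/
def sibsonSystemLtOne (W₀ : ProbabilityMeasure Ω) (hα : 0 < α) (hα' : α ≠ ∞)
    (ha1 : α.toReal < 1) : SibsonSystem α Ω where
  -- As `α - 1 < 0`, the sign makes `ψ` increasing; for the same reason the inequality in `Bound`
  -- points the other way.
  ψ x := -Real.exp ((α.toReal - 1) * x)
  center := meanCenter W₀ α
  Bound P q x := ENNReal.ofReal (Real.exp ((α.toReal - 1) * x)) ≤ hellingerSum α.toReal P q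
  strictMono x y hxy := by
    have : (α.toReal - 1) * y < (α.toReal - 1) * x := mul_lt_mul_of_neg_left hxy (by linarith)
    simpa using this
  continuous := by fun_prop
  div_center_le P hP q x h := by
    have hα1 : α ≠ 1 := by rintro rfl; simp at ha1
    rw [renyiDiv_le_iff_of_lt_one hα' ha1]
    rw [hellingerSum_eq W₀ hα hα' hP.2, mul_add, Real.exp_add,
      ENNReal.ofReal_mul (Real.exp_pos _).le, ofReal_exp_information hα hα' hα1 hP.2] at h
    refine (ENNReal.mul_le_mul_iff_right ?_ ?_).mp h
    · simp [ENNReal.rpow_eq_zero_iff, meanMeasure_univ_ne_zero hα hP.2,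
        meanMeasure_univ_ne_top hα hP.2]
    · exact ENNReal.rpow_ne_top_of_nonneg ENNReal.toReal_nonneg (meanMeasure_univ_ne_top hα hP.2)
  close_of_div_le δ hδ := by
    have ha : 0 < α.toReal := ENNReal.toReal_pos hα.ne' hα'
    simp_rw [renyiDiv_le_iff_of_lt_one hα' ha1]
    -- Dividing the exponent `(α - 1) η` by the Hölder exponent `2 α` or `2 (1 - α)` gives the two
    -- values of `k`.
    rcases le_total α.toReal (1 / 2) with hle | hle
    · refine exists_setwiseClose_of_exp_le_affinity
        (k := (1 - α.toReal) / (2 * α.toReal)) (div_pos (by linarith) (by linarith))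
        (fun η hη p q hpq => ?_) hδ
      have := exp_le_of_exp_le_rpow (by linarith)
        (hpq.trans (hellinger_le_rpow_affinity_of_le_half ha hle p q))
      convert this using 3
      field_simp; ring
    · refine exists_setwiseClose_of_exp_le_affinity (k := 1 / 2) (by norm_num)
        (fun η hη p q hpq => ?_) hδ
      have := exp_le_of_exp_le_rpow (by linarith)
        (hpq.trans (hellinger_le_rpow_affinity_of_half_le hle ha1 p q))
      convert this using 3
      have : 1 - α.toReal ≠ 0 := by linarith
      field_simp; ring
  nonneg_of_div_le p q x h := by
    rw [renyiDiv_le_iff_of_lt_one hα' ha1] at h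
    have h1 := h.trans (hellinger_le_one (ENNReal.toReal_pos hα.ne' hα') ha1.le p q)
    rw [ENNReal.ofReal_le_one, Real.exp_le_one_iff] at h1
    by_contra! hx
    nlinarith
  bound_or_bound P hP P' hP' s t hs ht hst x y h := by
    have hα1 : α ≠ 1 := by rintro rfl; simp at ha1
    have hR := mix_mem_priors hP hP' hst
    have h1 := hellingerSum_mix_center W₀ hα hα' hα1 hR.2
    rw [hellingerSum_mix] at h1
    by_contra! hcon
    have h2 : (s : ℝ≥0∞) * hellingerSum α.toReal P (meanCenter W₀ α (s • P + t • P')) +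
        t * hellingerSum α.toReal P' (meanCenter W₀ α (s • P + t • P')) <
        s * ENNReal.ofReal (Real.exp ((α.toReal - 1) * x)) +
        t * ENNReal.ofReal (Real.exp ((α.toReal - 1) * y)) := by
      refine ENNReal.add_lt_add ?_ ?_
      · exact (ENNReal.mul_lt_mul_iff_right (by simpa using hs.ne') (by simp)).mpr hcon.1
      · exact (ENNReal.mul_lt_mul_iff_right (by simpa using ht.ne') (by simp)).mpr hcon.2
    rw [h1, ← ENNReal.ofReal_coe_nnreal, ← ENNReal.ofReal_coe_nnreal,
      ← ENNReal.ofReal_mul s.coe_nonneg, ← ENNReal.ofReal_mul t.coe_nonneg,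
      ← ENNReal.ofReal_add (by positivity) (by positivity)] at h2
    have h3 := (ENNReal.ofReal_lt_ofReal_iff_of_nonneg (Real.exp_pos _).le).mp h2
    linarith
  div_le_of_close W q c h := by
    have ha : 0 < α.toReal := ENNReal.toReal_pos hα.ne' hα'
    simp_rw [renyiDiv_le_iff_of_lt_one hα' ha1] at h ⊢
    have h1 : ∀ δ > 0, ENNReal.ofReal (Real.exp ((α.toReal - 1) * c)) ≤
        hellinger α.toReal W q + ENNReal.ofReal δ ^ (1 - α.toReal) := fun δ hδ => by
      obtain ⟨q', h2, h3⟩ := h δ hδ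
      exact h3.trans (hellinger_le_add_of_setwiseClose ha ha1 h2)
    have h4 : Tendsto (fun δ : ℝ => hellinger α.toReal W q +
        ENNReal.ofReal δ ^ (1 - α.toReal)) (𝓝[>] 0)
        (𝓝 (hellinger α.toReal W q + ENNReal.ofReal 0 ^ (1 - α.toReal))) := by
      refine Tendsto.mono_left ?_ nhdsWithin_le_nhds
      exact tendsto_const_nhds.add ((ENNReal.continuous_rpow_const.tendsto _).comp
        (ENNReal.continuous_ofReal.tendsto 0))
    rw [ENNReal.ofReal_zero, ENNReal.zero_rpow_of_pos (by linarith), add_zero] at h4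
    refine ge_of_tendsto h4 ?_
    filter_upwards [self_mem_nhdsWithin] with δ hδ using h1 δ hδ
  bound_of_forall P hP q c h := by
    rw [← sum_coe_mul_const hP.2 (ENNReal.ofReal _)]
    refine Finset.sum_le_sum fun W hW => ?_
    have := (renyiDiv_le_iff_of_lt_one hα' ha1 _ _ _).mp (h W hW)
    dsimp only
    gcongr
  div_le_of_bound_single W q c h := by
    rw [hellingerSum_single] at h
    exact (renyiDiv_le_iff_of_lt_one hα' ha1 _ _ _).mpr h

end LessThanOne

/-! ### Finite orders greater than one. -/

section GreaterThanOne

variable {Ω : Type*} [MeasurableSpace Ω] {α : ℝ≥0∞}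

/-- The system of the finite orders greater than one. -/
def sibsonSystemOneLt (W₀ : ProbabilityMeasure Ω) (hα' : α ≠ ∞)
    (ha1 : 1 < α.toReal) : SibsonSystem α Ω where
  ψ x := Real.exp ((α.toReal - 1) * x)
  center := meanCenter W₀ α
  Bound P q x := hellingerSum α.toReal P q ≤ ENNReal.ofReal (Real.exp ((α.toReal - 1) * x))
  strictMono x y hxy := by
    have : (α.toReal - 1) * x < (α.toReal - 1) * y := mul_lt_mul_of_pos_left hxy (by linarith)
    simpa using this
  continuous := by fun_prop
  div_center_le P hP q x h := by
    have hα1 : α ≠ 1 := by rintro rfl; simp at ha1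
    have hα : 0 < α := by rw [pos_iff_ne_zero]; rintro rfl; norm_num at ha1
    rw [renyiDiv_le_iff_of_one_lt hα' ha1]
    rw [hellingerSum_eq W₀ hα hα' hP.2, mul_add, Real.exp_add,
      ENNReal.ofReal_mul (Real.exp_pos _).le, ofReal_exp_information hα hα' hα1 hP.2] at h
    refine (ENNReal.mul_le_mul_iff_right ?_ ?_).mp h
    · simp [ENNReal.rpow_eq_zero_iff, meanMeasure_univ_ne_zero hα hP.2,
        meanMeasure_univ_ne_top hα hP.2]
    · exact ENNReal.rpow_ne_top_of_nonneg ENNReal.toReal_nonneg (meanMeasure_univ_ne_top hα hP.2)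
  close_of_div_le δ hδ := by
    simp_rw [renyiDiv_le_iff_of_one_lt hα' ha1]
    refine exists_setwiseClose_of_exp_le_affinity (k := 1 / 2) (by norm_num)
      (fun η hη p q hpq => ?_) hδ
    have hd : 0 < 2 * α.toReal - 1 := by linarith
    have ht : 0 < 2 * (α.toReal - 1) / (2 * α.toReal - 1) := div_pos (by linarith) hd
    rcases one_le_rpow_hellinger_mul_rpow_affinity ha1 p q with h | h
    -- Dividing `z` by the exponent of the affinity leaves `η / 2`, whence `k = 1 / 2`.
    · set z := (α.toReal - 1) * η * (1 / (2 * α.toReal - 1)) with hz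
      have h1 : 1 ≤ ENNReal.ofReal (Real.exp z) *
          hellinger (1 / 2) p q ^ (2 * (α.toReal - 1) / (2 * α.toReal - 1)) := by
        refine h.trans ?_
        gcongr
        rw [hz, ← ofReal_exp_rpow]
        exact ENNReal.rpow_le_rpow hpq (by positivity)
      have h2 : ENNReal.ofReal (Real.exp (-z)) ≤
          hellinger (1 / 2) p q ^ (2 * (α.toReal - 1) / (2 * α.toReal - 1)) := by
        calc ENNReal.ofReal (Real.exp (-z)) = ENNReal.ofReal (Real.exp (-z)) * 1 := by ring
          _ ≤ ENNReal.ofReal (Real.exp (-z)) * (ENNReal.ofReal (Real.exp z) *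
            hellinger (1 / 2) p q ^ (2 * (α.toReal - 1) / (2 * α.toReal - 1))) := by gcongr
          _ = _ := by
            rw [← mul_assoc, ← ENNReal.ofReal_mul (Real.exp_pos _).le, ← Real.exp_add]
            simp
      have h3 := exp_le_of_exp_le_rpow ht h2
      convert h3 using 3
      have : α.toReal - 1 ≠ 0 := by linarith
      rw [hz]; field_simp
    · rw [h] at hpq
      exact absurd hpq (by simp)
  nonneg_of_div_le p q x h := by
    rw [renyiDiv_le_iff_of_one_lt hα' ha1] at h
    have h1 := (one_le_hellinger ha1 p q).trans h
    rw [ENNReal.one_le_ofReal, Real.one_le_exp_iff] at h1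
    by_contra! hx
    nlinarith
  bound_or_bound P hP P' hP' s t hs ht hst x y h := by
    have hα1 : α ≠ 1 := by rintro rfl; simp at ha1
    have hα : 0 < α := by rw [pos_iff_ne_zero]; rintro rfl; norm_num at ha1
    have hR := mix_mem_priors hP hP' hst
    have h1 := hellingerSum_mix_center W₀ hα hα' hα1 hR.2
    rw [hellingerSum_mix] at h1
    by_contra! hcon
    have h2 : s * ENNReal.ofReal (Real.exp ((α.toReal - 1) * x)) +
        t * ENNReal.ofReal (Real.exp ((α.toReal - 1) * y)) <
        (s : ℝ≥0∞) * hellingerSum α.toReal P (meanCenter W₀ α (s • P + t • P')) +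
        t * hellingerSum α.toReal P' (meanCenter W₀ α (s • P + t • P')) := by
      refine ENNReal.add_lt_add ?_ ?_
      · exact (ENNReal.mul_lt_mul_iff_right (by simpa using hs.ne') (by simp)).mpr hcon.1
      · exact (ENNReal.mul_lt_mul_iff_right (by simpa using ht.ne') (by simp)).mpr hcon.2
    rw [h1, ← ENNReal.ofReal_coe_nnreal, ← ENNReal.ofReal_coe_nnreal,
      ← ENNReal.ofReal_mul s.coe_nonneg, ← ENNReal.ofReal_mul t.coe_nonneg,
      ← ENNReal.ofReal_add (by positivity) (by positivity)] at h2
    have h3 := (ENNReal.ofReal_lt_ofReal_iff_of_nonneg (by positivity)).mp h2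
    linarith
  div_le_of_close W q c h := by
    have ha : 0 < α.toReal := by linarith
    simp_rw [renyiDiv_le_iff_of_one_lt hα' ha1] at h ⊢
    obtain ⟨u, ν, hν, hu, hW, hq, hun, hlim⟩ := exists_seq_tendsto_densities (W := W) h
    -- Pointwise convergence of the integrands, followed by Fatou's lemma.
    have h1 : ∀ᵐ y ∂ν, (W : Measure Ω).rnDeriv ν y ^ α.toReal *
        (q : Measure Ω).rnDeriv ν y ^ (1 - α.toReal) ≤
        liminf (fun n => (W : Measure Ω).rnDeriv ν y ^ α.toReal *
        (u n : Measure Ω).rnDeriv ν y ^ (1 - α.toReal)) atTop := by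
      filter_upwards [hlim, Measure.rnDeriv_ne_top (W : Measure Ω) ν] with y hy hWy
      have h2 : Tendsto (fun n => (W : Measure Ω).rnDeriv ν y ^ α.toReal *
        (u n : Measure Ω).rnDeriv ν y ^ (1 - α.toReal)) atTop (𝓝 _) :=
        ENNReal.Tendsto.const_mul ((ENNReal.continuous_rpow_const.tendsto _).comp hy)
          (Or.inr (ENNReal.rpow_ne_top_of_nonneg ha.le hWy))
      exact h2.liminf_eq.ge
    rw [hellinger_eq_lintegral ha hW hq]
    refine (lintegral_mono_ae h1).trans ((lintegral_liminf_le fun n => by fun_prop).trans ?_)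
    refine liminf_le_of_frequently_le' (Frequently.of_forall fun n => ?_)
    rw [← hellinger_eq_lintegral ha hW (hun n)]
    exact hu n
  bound_of_forall P hP q c h := by
    rw [← sum_coe_mul_const hP.2 (ENNReal.ofReal _)]
    refine Finset.sum_le_sum fun W hW => ?_
    have := (renyiDiv_le_iff_of_one_lt hα' ha1 _ _ _).mp (h W hW)
    dsimp only
    gcongr
  div_le_of_bound_single W q c h := by
    rw [hellingerSum_single] at h
    exact (renyiDiv_le_iff_of_one_lt hα' ha1 _ _ _).mpr h

end GreaterThanOne

/-! ### Order `∞`. -/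

section Infinity

variable {Ω : Type*} [MeasurableSpace Ω]

lemma forall_measure_le_iff_ae_le {μ κ ν : Measure Ω} [IsFiniteMeasure ν] {f g : Ω → ℝ≥0∞}
    (hf : Measurable f) (hg : Measurable g) (hμ : μ = ν.withDensity f) (hκ : κ = ν.withDensity g)
    (c : ℝ≥0∞) :
    (∀ A, MeasurableSet A → μ A ≤ c * κ A) ↔ ∀ᵐ y ∂ν, f y ≤ c * g y := by
  have h : ∀ A, MeasurableSet A → (μ A = ∫⁻ y in A, f y ∂ν ∧
      c * κ A = ∫⁻ y in A, c * g y ∂ν) := fun A hA => by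
    rw [lintegral_const_mul _ hg, hμ, hκ, withDensity_apply _ hA, withDensity_apply _ hA]
    exact ⟨rfl, rfl⟩
  constructor
  · intro h1
    refine ae_le_of_forall_setLIntegral_le_of_sigmaFinite hf fun A hA _ => ?_
    rw [← (h A hA).1, ← (h A hA).2]
    exact h1 A hA
  · intro h1 A hA
    rw [(h A hA).1, (h A hA).2]
    exact lintegral_mono_ae (ae_restrict_of_ae h1)

/-- Without densities, the bound passes directly to setwise limits. -/
lemma renyiDiv_top_le_iff (W Q : ProbabilityMeasure Ω) (x : ℝ) :
    renyiDiv ∞ W Q ≤ (x : EReal) ↔ ∀ A, MeasurableSet A →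
      (W : Measure Ω) A ≤ ENNReal.ofReal (Real.exp x) * (Q : Measure Ω) A := by
  set ν : Measure Ω := (W : Measure Ω) + (Q : Measure Ω) with hν
  have hW : (W : Measure Ω) ≪ ν :=
    Measure.absolutelyContinuous_of_le (Measure.le_add_right le_rfl)
  have hQ : (Q : Measure Ω) ≪ ν :=
    Measure.absolutelyContinuous_of_le (Measure.le_add_left le_rfl)
  rw [forall_measure_le_iff_ae_le (ν := ν) (Measure.measurable_rnDeriv _ _)
    (Measure.measurable_rnDeriv _ _) (Measure.withDensity_rnDeriv_eq _ _ hW).symm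
    (Measure.withDensity_rnDeriv_eq _ _ hQ).symm]
  have h1 : renyiDiv ∞ W Q = ENNReal.log (essSup (fun y => (W : Measure Ω).rnDeriv ν y /
      (Q : Measure Ω).rnDeriv ν y) ν) := by
    rw [renyiDiv, if_pos rfl]
  rw [h1, log_le_coe_iff]
  have h2 : ∀ᵐ y ∂ν, ((W : Measure Ω).rnDeriv ν y / (Q : Measure Ω).rnDeriv ν y ≤
      ENNReal.ofReal (Real.exp x) ↔ (W : Measure Ω).rnDeriv ν y ≤
      ENNReal.ofReal (Real.exp x) * (Q : Measure Ω).rnDeriv ν y) := by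
    filter_upwards [Measure.rnDeriv_ne_top (Q : Measure Ω) ν] with y hy
    exact ENNReal.div_le_iff_le_mul (Or.inr ENNReal.ofReal_ne_top) (Or.inl hy)
  constructor
  · intro h
    filter_upwards [h2, ENNReal.ae_le_essSup (μ := ν) fun y => (W : Measure Ω).rnDeriv ν y /
      (Q : Measure Ω).rnDeriv ν y] with y h3 h4
    exact h3.mp (h4.trans h)
  · intro h
    refine essSup_le_of_ae_le _ ?_
    filter_upwards [h2, h] with y h3 h4 using h3.mpr h4

lemma ofReal_exp_information_top {P : ProbabilityMeasure Ω →₀ ℝ≥0}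
    (hP : ∑ W ∈ P.support, P W = 1) :
    ENNReal.ofReal (Real.exp (renyiInformation ∞ P)) = meanMeasure ∞ P Set.univ := by
  have hF0 : meanMeasure ∞ P Set.univ ≠ 0 := meanMeasure_univ_ne_zero ENNReal.zero_lt_top hP
  have hFt : meanMeasure ∞ P Set.univ ≠ ∞ := meanMeasure_univ_ne_top ENNReal.zero_lt_top hP
  rw [renyiInformation, if_pos rfl, Real.exp_log (ENNReal.toReal_pos hF0 hFt),
    ENNReal.ofReal_toReal hFt]

/-- Sibson's identity at order `∞`. -/
lemma renyiDiv_top_center_le_iff (W₀ : ProbabilityMeasure Ω) {P : ProbabilityMeasure Ω →₀ ℝ≥0}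
    (hP : ∑ W ∈ P.support, P W = 1) (q : ProbabilityMeasure Ω) (x : ℝ) :
    renyiDiv ∞ (meanCenter W₀ ∞ P) q ≤ (x : EReal) ↔
      ∀ W ∈ P.support, renyiDiv ∞ W q ≤ ((renyiInformation ∞ P + x : ℝ) : EReal) := by
  set ν : Measure Ω := mixture P + q with hν
  have hq : (q : Measure Ω) ≪ ν :=
    Measure.absolutelyContinuous_of_le (Measure.le_add_left le_rfl)
  have hW : ∀ W ∈ P.support, (W : Measure Ω) ≪ ν := fun W hW =>
    (absolutelyContinuous_mixture hW).trans
      (Measure.absolutelyContinuous_of_le (Measure.le_add_right le_rfl))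
  set w : ProbabilityMeasure Ω → Ω → ℝ≥0∞ := fun W => (W : Measure Ω).rnDeriv ν with hw
  have hwm : ∀ W, Measurable (w W) := fun W => Measure.measurable_rnDeriv _ _
  have hwd : ∀ W ∈ P.support, (W : Measure Ω) = ν.withDensity (w W) := fun W h =>
    (Measure.withDensity_rnDeriv_eq _ _ (hW W h)).symm
  have hgm : Measurable ((q : Measure Ω).rnDeriv ν) := Measure.measurable_rnDeriv _ _
  have hgd := (Measure.withDensity_rnDeriv_eq _ _ hq).symm
  have hcd := meanCenter_eq_withDensity W₀ ENNReal.zero_lt_top hP hwm hwd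
  have hF0 : meanMeasure ∞ P Set.univ ≠ 0 := meanMeasure_univ_ne_zero ENNReal.zero_lt_top hP
  have hFt : meanMeasure ∞ P Set.univ ≠ ∞ := meanMeasure_univ_ne_top ENNReal.zero_lt_top hP
  have hmm : Measurable (weightedMean ∞ P w) := measurable_weightedMean hwm
  rw [renyiDiv_top_le_iff,
    forall_measure_le_iff_ae_le (f := fun y => (meanMeasure ∞ P Set.univ)⁻¹ *
      weightedMean ∞ P w y) (measurable_const.mul hmm) hgm hcd hgd]
  have h1 : ∀ W ∈ P.support,
      (renyiDiv ∞ W q ≤ ((renyiInformation ∞ P + x : ℝ) : EReal) ↔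
      ∀ᵐ y ∂ν, w W y ≤ meanMeasure ∞ P Set.univ * (ENNReal.ofReal (Real.exp x) *
        (q : Measure Ω).rnDeriv ν y)) := fun W h => by
    rw [renyiDiv_top_le_iff, forall_measure_le_iff_ae_le (hwm W) hgm (hwd W h) hgd, Real.exp_add,
      ENNReal.ofReal_mul (Real.exp_pos _).le, ofReal_exp_information_top hP]
    simp only [mul_assoc]
  rw [forall₂_congr h1]
  have h2 : (∀ W ∈ P.support, ∀ᵐ y ∂ν, w W y ≤ meanMeasure ∞ P Set.univ *
      (ENNReal.ofReal (Real.exp x) * (q : Measure Ω).rnDeriv ν y)) ↔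
      ∀ᵐ y ∂ν, ∀ W ∈ P.support, w W y ≤ meanMeasure ∞ P Set.univ *
      (ENNReal.ofReal (Real.exp x) * (q : Measure Ω).rnDeriv ν y) :=
    (ae_ball_iff P.support.countable_toSet).symm
  rw [h2]
  refine eventually_congr (Eventually.of_forall fun y => ?_)
  rw [weightedMean, if_pos rfl, ENNReal.inv_mul_le_iff hF0 hFt, iSup₂_le_iff]

/-- The system of the order `∞`. -/
def sibsonSystemTop (W₀ : ProbabilityMeasure Ω) : SibsonSystem ∞ Ω where
  ψ x := x
  center := meanCenter W₀ ∞
  Bound P q x := ∀ W ∈ P.support, renyiDiv ∞ W q ≤ (x : EReal)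
  strictMono := strictMono_id
  continuous := continuous_id
  div_center_le P hP q x h := (renyiDiv_top_center_le_iff W₀ hP.2 q x).mpr h
  close_of_div_le δ hδ := by
    -- With this value `p A ≤ (1 + δ) q A ≤ q A + δ`, as `q A ≤ 1`.
    refine ⟨Real.log (1 + δ), Real.log_pos (by linarith), fun p q h => ?_⟩
    rw [renyiDiv_top_le_iff, Real.exp_log (by linarith)] at h
    refine SetwiseClose.of_le fun A hA => ?_
    have h1 := ENNReal.toReal_mono (by finiteness) (h A hA)
    rw [ENNReal.toReal_mul, ENNReal.toReal_ofReal (by linarith)] at h1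
    have h2 : (q : Measure Ω).real A ≤ 1 := measureReal_le_one
    simp only [measureReal_def] at h2 ⊢
    nlinarith
  nonneg_of_div_le p q x h := by
    have h1 := (renyiDiv_top_le_iff p q x).mp h Set.univ MeasurableSet.univ
    simpa [ENNReal.one_le_ofReal] using h1
  bound_or_bound P hP P' hP' s t hs ht hst a b h := by
    classical
    have hR := mix_mem_priors hP hP' hst
    have hc := (renyiDiv_top_center_le_iff W₀ hR.2 (meanCenter W₀ ∞ (s • P + t • P')) 0).mp
      ((renyiDiv_top_le_iff _ _ _).mpr (by simp))
    simp only [add_zero] at hc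
    have hst' : (s : ℝ) + t = 1 := by exact_mod_cast hst
    have hs' : (0 : ℝ) < s := hs
    have ht' : (0 : ℝ) < t := ht
    -- The mixture's support contains both supports, so its information bounds every divergence from
    -- either one; the weights only show that it is at most `a` or at most `b`.
    rcases le_or_gt (renyiInformation ∞ (s • P + t • P')) a with ha | ha
    · left
      intro W hW
      refine (hc W ?_).trans (EReal.coe_le_coe_iff.mpr ha)
      have : P W ≠ 0 := by simpa using hW
      simp [hs.ne', this]
    · right
      intro W hW
      refine (hc W ?_).trans (EReal.coe_le_coe_iff.mpr ?_)
      · have : P' W ≠ 0 := by simpa using hW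
        simp [ht.ne', this]
      · by_contra! hb
        have e1 := mul_lt_mul_of_pos_left ha hs'
        have e2 := mul_lt_mul_of_pos_left hb ht'
        have e3 : s * renyiInformation ∞ (s • P + t • P') +
            t * renyiInformation ∞ (s • P + t • P') = renyiInformation ∞ (s • P + t • P') := by
          rw [← add_mul, hst', one_mul]
        linarith
  div_le_of_close W q c h := by
    simp_rw [renyiDiv_top_le_iff] at h ⊢
    intro A hA
    have h1 : ∀ δ > 0, (W : Measure Ω).real A ≤ Real.exp c * (q : Measure Ω).real A + δ := by
      intro δ hδ
      obtain ⟨q', h2, h3⟩ := h (δ / Real.exp c) (by positivity)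
      have h4 := ENNReal.toReal_mono (by finiteness) (h3 A hA)
      rw [ENNReal.toReal_mul, ENNReal.toReal_ofReal (Real.exp_pos _).le] at h4
      have h5 := (abs_le.mp (h2 A hA)).2
      simp only [measureReal_def] at h5 ⊢
      calc _ ≤ _ := h4
        _ ≤ Real.exp c * (((q : Measure Ω) A).toReal + δ / Real.exp c) := by gcongr; linarith
        _ = _ := by field_simp
    have h2 := le_of_forall_pos_le_add h1
    rw [← ENNReal.toReal_le_toReal (by finiteness) (by finiteness), ENNReal.toReal_mul,
      ENNReal.toReal_ofReal (Real.exp_pos _).le]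
    exact h2
  bound_of_forall P hP q c h := h
  div_le_of_bound_single W q c h := h W (by simp [Finsupp.support_single])

end Infinity

open InformationTheory

/-! ### Order one: the compensation identity and the information as an average divergence. -/

section KullbackLeibler

variable {Ω : Type*} [MeasurableSpace Ω]

/-- The condition `0 ≤ x` is recorded because `ENNReal.ofReal` truncates negative values. -/
lemma renyiDiv_one_le_iff (W Q : ProbabilityMeasure Ω) (x : ℝ) :
    renyiDiv 1 W Q ≤ (x : EReal) ↔
      0 ≤ x ∧ klDiv (W : Measure Ω) (Q : Measure Ω) ≤ ENNReal.ofReal x := by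
  have h1 : renyiDiv 1 W Q = (klDiv (W : Measure Ω) (Q : Measure Ω) : EReal) := by
    rw [renyiDiv, if_neg ENNReal.one_ne_top, if_pos rfl]
  rw [h1]
  constructor
  · intro h
    have hx : 0 ≤ x := by
      have : (0 : EReal) ≤ x := (EReal.coe_ennreal_nonneg _).trans h
      exact_mod_cast this
    refine ⟨hx, ?_⟩
    rw [← EReal.coe_ennreal_le_coe_ennreal_iff, EReal.coe_ennreal_ofReal, max_eq_left hx]
    exact h
  · rintro ⟨hx, h⟩
    rw [← EReal.coe_ennreal_le_coe_ennreal_iff, EReal.coe_ennreal_ofReal, max_eq_left hx] at h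
    exact h

/-- The mixture as a probability measure; a default value is used if `P` is not a prior. -/
def mixtureCenter (W₀ : ProbabilityMeasure Ω) (P : ProbabilityMeasure Ω →₀ ℝ≥0) :
    ProbabilityMeasure Ω :=
  if h : mixture P Set.univ ≠ 0 ∧ mixture P Set.univ ≠ ∞ then normalize (mixture P) h.1 h.2 else W₀

lemma mixture_univ {P : ProbabilityMeasure Ω →₀ ℝ≥0} (hP : ∑ W ∈ P.support, P W = 1) :
    mixture P Set.univ = 1 := by
  simp [mixture_apply, ← ENNReal.ofNNReal_finsetSum, hP]

lemma toMeasure_mixtureCenter (W₀ : ProbabilityMeasure Ω) {P : ProbabilityMeasure Ω →₀ ℝ≥0}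
    (hP : ∑ W ∈ P.support, P W = 1) : (mixtureCenter W₀ P : Measure Ω) = mixture P := by
  have h := mixture_univ hP
  rw [mixtureCenter, dif_pos (by simp [h])]
  change (mixture P Set.univ)⁻¹ • mixture P = mixture P
  rw [h, inv_one, one_smul]

/-- The Kullback-Leibler divergence averaged over a prior. -/
def klSum (P : ProbabilityMeasure Ω →₀ ℝ≥0) (q : Measure Ω) : ℝ≥0∞ :=
  P.sum fun W x => (x : ℝ≥0∞) * klDiv (W : Measure Ω) q

lemma klSum_mix (P P' : ProbabilityMeasure Ω →₀ ℝ≥0) (s t : ℝ≥0) (q : Measure Ω) :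
    klSum (s • P + t • P') q = s * klSum P q + t * klSum P' q := by
  rw [klSum, sum_add_smul _ _ _ (by simp) (by intros; push_cast; ring)]
  simp only [klSum, Finsupp.sum, Finset.mul_sum, ENNReal.coe_mul, mul_assoc]

lemma klSum_single (W : ProbabilityMeasure Ω) (q : Measure Ω) :
    klSum (Finsupp.single W 1) q = klDiv (W : Measure Ω) q := by
  rw [klSum, Finsupp.sum_single_index] <;> simp

lemma rnDeriv_mixture {P : ProbabilityMeasure Ω →₀ ℝ≥0} {ν : Measure Ω} [IsFiniteMeasure ν]
    (h : ∀ W ∈ P.support, (W : Measure Ω) ≪ ν) :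
    ∀ᵐ y ∂ν, (mixture P).rnDeriv ν y =
      ∑ W ∈ P.support, (P W : ℝ≥0∞) * (W : Measure Ω).rnDeriv ν y := by
  have hm : Measurable fun y => ∑ W ∈ P.support, (P W : ℝ≥0∞) * (W : Measure Ω).rnDeriv ν y := by
    fun_prop
  have h1 : mixture P = ν.withDensity
      fun y => ∑ W ∈ P.support, (P W : ℝ≥0∞) * (W : Measure Ω).rnDeriv ν y := by
    ext A hA
    rw [mixture_apply, withDensity_apply _ hA, lintegral_finsetSum _ fun W _ => by fun_prop]
    refine Finset.sum_congr rfl fun W hW => ?_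
    rw [lintegral_const_mul _ (by fun_prop), Measure.setLIntegral_rnDeriv (h W hW)]
  have h2 := Measure.rnDeriv_withDensity ν hm
  rw [← h1] at h2
  exact h2

/-- Averaged over `v` with mean one, this is the compensation identity at a point. -/
lemma klFun_mul (m v : ℝ) (hm : 0 < m) (hv : 0 ≤ v) :
    klFun (m * v) = m * klFun v + v * (m * Real.log m) + 1 - m := by
  rcases hv.eq_or_lt with rfl | hv
  · simp [klFun_apply]
  · rw [klFun_apply, klFun_apply, Real.log_mul hm.ne' hv.ne']; ring

/-- The compensation identity. -/
lemma klSum_eq_add {P : ProbabilityMeasure Ω →₀ ℝ≥0} (hP : ∑ W ∈ P.support, P W = 1)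
    {q : Measure Ω} [IsFiniteMeasure q] (h : ∀ W ∈ P.support, (W : Measure Ω) ≪ q) :
    klSum P q = klSum P (mixture P) + klDiv (mixture P) q := by
  have hmq : mixture P ≪ q := mixture_absolutelyContinuous h
  have hkl : Measurable fun x : ℝ => ENNReal.ofReal (klFun x) :=
    ENNReal.measurable_ofReal.comp measurable_klFun
  have hmeas : ∀ μ κ : Measure Ω, Measurable fun y => ENNReal.ofReal (klFun (μ.rnDeriv κ y).toReal) :=
    fun μ κ => hkl.comp (Measure.measurable_rnDeriv _ _).ennreal_toReal
  -- All three terms become integrals of nonnegative `klFun` expressions against `q`, so no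
  -- integrability is needed and the identity can be checked pointwise.
  have e1 : klSum P q = ∫⁻ y, ∑ W ∈ P.support, (P W : ℝ≥0∞) *
      ENNReal.ofReal (klFun ((W : Measure Ω).rnDeriv q y).toReal) ∂q := by
    rw [lintegral_finsetSum _ fun W _ => (hmeas _ _).const_mul _]
    refine Finset.sum_congr rfl fun W hW => ?_
    beta_reduce
    rw [lintegral_const_mul _ (hmeas _ _), klDiv_eq_lintegral_klFun_of_ac (h W hW)]
  have e2 : klSum P (mixture P) = ∫⁻ y, ∑ W ∈ P.support, (P W : ℝ≥0∞) *
      ((mixture P).rnDeriv q y *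
      ENNReal.ofReal (klFun ((W : Measure Ω).rnDeriv (mixture P) y).toReal)) ∂q := by
    have hprod : ∀ W : ProbabilityMeasure Ω, Measurable fun y => (mixture P).rnDeriv q y *
        ENNReal.ofReal (klFun ((W : Measure Ω).rnDeriv (mixture P) y).toReal) :=
      fun W => (Measure.measurable_rnDeriv _ _).mul (hmeas _ _)
    rw [lintegral_finsetSum _ fun W _ => (hprod W).const_mul _]
    refine Finset.sum_congr rfl fun W hW => ?_
    beta_reduce
    rw [lintegral_const_mul _ (hprod W),
      lintegral_rnDeriv_mul hmq (hmeas _ _).aemeasurable,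
      klDiv_eq_lintegral_klFun_of_ac (absolutelyContinuous_mixture hW)]
  rw [e1, e2, klDiv_eq_lintegral_klFun_of_ac hmq, ← lintegral_add_right _ (hmeas _ _)]
  refine lintegral_congr_ae ?_
  have h1 : ∀ᵐ y ∂q, ∀ W ∈ P.support, (W : Measure Ω).rnDeriv q y =
      (mixture P).rnDeriv q y * (W : Measure Ω).rnDeriv (mixture P) y :=
    (ae_ball_iff P.support.countable_toSet).mpr fun W hW =>
      ae_rnDeriv_eq_mul (absolutelyContinuous_mixture hW)
  have h2 : ∀ᵐ y ∂q, ∀ W ∈ P.support, (mixture P).rnDeriv q y ≠ 0 →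
      (W : Measure Ω).rnDeriv (mixture P) y ≠ ∞ :=
    (ae_ball_iff P.support.countable_toSet).mpr fun W hW => ae_rnDeriv_ne_top_of_ne_zero hmq
  filter_upwards [h1, h2, rnDeriv_mixture h, Measure.rnDeriv_ne_top (mixture P) q]
    with y h1 h2 h3 h4
  set m := (mixture P).rnDeriv q y with hm
  -- Where the mixture has zero density so does every `W` in the support, and both sides equal
  -- `klFun 0 = 1`.
  by_cases h0 : m = 0
  · rw [h0]
    have : ∀ W ∈ P.support, (P W : ℝ≥0∞) *
        ENNReal.ofReal (klFun ((W : Measure Ω).rnDeriv q y).toReal) = (P W : ℝ≥0∞) * 1 := by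
      intro W hW
      rw [h1 W hW, h0]
      simp [klFun_zero]
    rw [Finset.sum_congr rfl this, sum_coe_mul_const hP]
    simp [klFun_zero]
  · have hm0 : 0 < m.toReal := ENNReal.toReal_pos h0 h4
    set v : ProbabilityMeasure Ω → ℝ := fun W =>
      ((W : Measure Ω).rnDeriv (mixture P) y).toReal with hv
    have hv0 : ∀ W, 0 ≤ v W := fun W => ENNReal.toReal_nonneg
    have hsum : ∑ W ∈ P.support, (P W : ℝ) * v W = 1 := by
      have e3 : m = m * ∑ W ∈ P.support, (P W : ℝ≥0∞) * (W : Measure Ω).rnDeriv (mixture P) y := by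
        rw [Finset.mul_sum]
        refine h3.trans (Finset.sum_congr rfl fun W hW => ?_)
        rw [h1 W hW]; ring
      have e4 : ∑ W ∈ P.support, (P W : ℝ≥0∞) * (W : Measure Ω).rnDeriv (mixture P) y = 1 := by
        have := congrArg (fun z => m⁻¹ * z) e3
        simp only [← mul_assoc, ENNReal.inv_mul_cancel h0 h4, one_mul] at this
        exact this.symm
      have e5 := congrArg ENNReal.toReal e4
      rw [ENNReal.toReal_sum fun W hW => ENNReal.mul_ne_top (by simp) (h2 W hW h0)] at e5
      simpa using e5
    have hPr : ∑ W ∈ P.support, (P W : ℝ) = 1 := by exact_mod_cast hP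
    have hk : ∀ W, 0 ≤ klFun (v W) := fun W => klFun_nonneg (hv0 W)
    have e6 : ∀ W ∈ P.support, (P W : ℝ≥0∞) *
        ENNReal.ofReal (klFun ((W : Measure Ω).rnDeriv q y).toReal) =
        ENNReal.ofReal (P W * klFun (m.toReal * v W)) := by
      intro W hW
      rw [h1 W hW, ENNReal.toReal_mul, ENNReal.ofReal_mul (P W).coe_nonneg,
        ENNReal.ofReal_coe_nnreal]
    have e7 : ∀ W ∈ P.support, (P W : ℝ≥0∞) * (m *
        ENNReal.ofReal (klFun ((W : Measure Ω).rnDeriv (mixture P) y).toReal)) =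
        ENNReal.ofReal (P W * (m.toReal * klFun (v W))) := by
      intro W hW
      rw [ENNReal.ofReal_mul (P W).coe_nonneg, ENNReal.ofReal_coe_nnreal,
        ENNReal.ofReal_mul hm0.le, ENNReal.ofReal_toReal h4]
    have n1 : ∀ W ∈ P.support, 0 ≤ (P W : ℝ) * klFun (m.toReal * v W) := fun W _ =>
      mul_nonneg (P W).coe_nonneg (klFun_nonneg (mul_nonneg hm0.le (hv0 W)))
    have n2 : ∀ W ∈ P.support, 0 ≤ (P W : ℝ) * (m.toReal * klFun (v W)) := fun W _ =>
      mul_nonneg (P W).coe_nonneg (mul_nonneg hm0.le (hk W))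
    rw [Finset.sum_congr rfl e6, Finset.sum_congr rfl e7, ← ENNReal.ofReal_sum_of_nonneg n1,
      ← ENNReal.ofReal_sum_of_nonneg n2,
      ← ENNReal.ofReal_add (Finset.sum_nonneg n2) (klFun_nonneg hm0.le)]
    congr 1
    have e8 : ∀ W ∈ P.support, (P W : ℝ) * klFun (m.toReal * v W) =
        P W * (m.toReal * klFun (v W)) + (P W * v W) * (m.toReal * Real.log m.toReal) +
        P W * (1 - m.toReal) := fun W _ => by
      rw [klFun_mul _ _ hm0 (hv0 W)]; ring
    rw [Finset.sum_congr rfl e8, Finset.sum_add_distrib, Finset.sum_add_distrib,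
      ← Finset.sum_mul, ← Finset.sum_mul, hsum, hPr, klFun_apply]
    ring

lemma ae_sum_rnDeriv_mixture (P : ProbabilityMeasure Ω →₀ ℝ≥0) :
    ∀ᵐ y ∂(mixture P), (∀ W ∈ P.support, (W : Measure Ω).rnDeriv (mixture P) y ≠ ∞) ∧
      ∑ W ∈ P.support, (P W : ℝ) * ((W : Measure Ω).rnDeriv (mixture P) y).toReal = 1 := by
  have h2 : ∀ᵐ y ∂(mixture P), ∀ W ∈ P.support, (W : Measure Ω).rnDeriv (mixture P) y ≠ ∞ :=
    (ae_ball_iff P.support.countable_toSet).mpr fun W hW => Measure.rnDeriv_ne_top _ _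
  filter_upwards [h2, rnDeriv_mixture (ν := mixture P) fun W hW => absolutelyContinuous_mixture hW,
    Measure.rnDeriv_self (mixture P)] with y h2 h3 h4
  refine ⟨h2, ?_⟩
  rw [h4] at h3
  have e5 := congrArg ENNReal.toReal h3
  rw [ENNReal.toReal_sum fun W hW => ENNReal.mul_ne_top (by simp) (h2 W hW)] at e5
  simpa using e5.symm

/-- Each density relative to the mixture is at most `1 / P W`, and `klFun v ≤ 1 + v²`. -/
lemma klSum_mixture_ne_top {P : ProbabilityMeasure Ω →₀ ℝ≥0} : klSum P (mixture P) ≠ ∞ := by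
  refine (ENNReal.sum_lt_top.mpr fun W hW => ?_).ne
  refine ENNReal.mul_lt_top (by simp) ?_
  have hPW : 0 < (P W : ℝ) := by
    have : P W ≠ 0 := by simpa using hW
    exact_mod_cast pos_iff_ne_zero.mpr this
  rw [klDiv_eq_lintegral_klFun_of_ac (absolutelyContinuous_mixture hW)]
  have hle : ∀ᵐ y ∂(mixture P),
      ENNReal.ofReal (klFun ((W : Measure Ω).rnDeriv (mixture P) y).toReal) ≤
      ENNReal.ofReal (1 + (1 / P W : ℝ) ^ 2) := by
    filter_upwards [ae_sum_rnDeriv_mixture P] with y hy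
    refine ENNReal.ofReal_le_ofReal ?_
    set v := ((W : Measure Ω).rnDeriv (mixture P) y).toReal with hv
    have hv0 : 0 ≤ v := ENNReal.toReal_nonneg
    have h1 : (P W : ℝ) * v ≤ 1 := by
      rw [← hy.2]
      exact Finset.single_le_sum (f := fun W => (P W : ℝ) *
        ((W : Measure Ω).rnDeriv (mixture P) y).toReal) (fun V _ => by positivity) hW
    have h2 : v ≤ 1 / P W := by rw [le_div_iff₀ hPW]; linarith
    have h3 : klFun v ≤ 1 + v ^ 2 := by
      have h4 : Real.log v ≤ v := (Real.log_le_self hv0)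
      rw [klFun_apply]
      nlinarith [mul_le_mul_of_nonneg_left h4 hv0]
    have h5 : v ^ 2 ≤ (1 / P W : ℝ) ^ 2 := by gcongr
    linarith
  refine lt_of_le_of_lt (lintegral_mono_ae hle) ?_
  rw [lintegral_const]
  exact ENNReal.mul_lt_top ENNReal.ofReal_lt_top (measure_lt_top _ _)

/-- Replacing `v log v` by `klFun v` adds terms `P W (1 - v)` that sum to zero, and makes the
integrand nonnegative. -/
lemma renyiInformation_one_eq {P : ProbabilityMeasure Ω →₀ ℝ≥0}
    (hP : ∑ W ∈ P.support, P W = 1) :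
    renyiInformation 1 P = (klSum P (mixture P)).toReal := by
  rw [renyiInformation, if_neg ENNReal.one_ne_top, if_pos rfl]
  have hmeas : ∀ W : ProbabilityMeasure Ω,
      Measurable fun y => klFun ((W : Measure Ω).rnDeriv (mixture P) y).toReal :=
    fun W => measurable_klFun.comp (Measure.measurable_rnDeriv _ _).ennreal_toReal
  have hnn : ∀ (W : ProbabilityMeasure Ω) y,
      0 ≤ (P W : ℝ) * klFun ((W : Measure Ω).rnDeriv (mixture P) y).toReal :=
    fun W y => mul_nonneg (P W).coe_nonneg (klFun_nonneg ENNReal.toReal_nonneg)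
  have h1 : (fun y => ∑ W ∈ P.support, posterior P W y * Real.log (posterior P W y / P W))
      =ᵐ[mixture P] fun y => ∑ W ∈ P.support,
        (P W : ℝ) * klFun ((W : Measure Ω).rnDeriv (mixture P) y).toReal := by
    filter_upwards [ae_sum_rnDeriv_mixture P] with y hy
    have hPr : ∑ W ∈ P.support, (P W : ℝ) = 1 := by exact_mod_cast hP
    have e : ∀ W ∈ P.support, (P W : ℝ) * klFun ((W : Measure Ω).rnDeriv (mixture P) y).toReal =
        posterior P W y * Real.log (posterior P W y / P W) + (P W : ℝ) -
        (P W : ℝ) * ((W : Measure Ω).rnDeriv (mixture P) y).toReal := by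
      intro W hW
      have hPW : (P W : ℝ) ≠ 0 := by simpa using hW
      rw [posterior, klFun_apply, mul_div_cancel_left₀ _ hPW]
      ring
    rw [Finset.sum_congr rfl e, Finset.sum_sub_distrib, Finset.sum_add_distrib, hy.2, hPr]
    ring
  rw [integral_congr_ae h1, integral_eq_lintegral_of_nonneg_ae
    (Eventually.of_forall fun y => Finset.sum_nonneg fun W _ => hnn W y)
    (Finset.measurable_fun_sum _ fun W _ => (hmeas W).const_mul _).aestronglyMeasurable]
  congr 1
  have h2 : ∀ y, ENNReal.ofReal (∑ W ∈ P.support,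
      (P W : ℝ) * klFun ((W : Measure Ω).rnDeriv (mixture P) y).toReal) =
      ∑ W ∈ P.support, (P W : ℝ≥0∞) *
        ENNReal.ofReal (klFun ((W : Measure Ω).rnDeriv (mixture P) y).toReal) := by
    intro y
    rw [ENNReal.ofReal_sum_of_nonneg fun W _ => hnn W y]
    refine Finset.sum_congr rfl fun W _ => ?_
    rw [ENNReal.ofReal_mul (P W).coe_nonneg, ENNReal.ofReal_coe_nnreal]
  rw [lintegral_congr h2, lintegral_finsetSum _ fun W _ => (hmeas W).ennreal_ofReal.const_mul _]
  refine Finset.sum_congr rfl fun W hW => ?_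
  beta_reduce
  rw [lintegral_const_mul _ (hmeas W).ennreal_ofReal,
    klDiv_eq_lintegral_klFun_of_ac (absolutelyContinuous_mixture hW)]

end KullbackLeibler

/-! ### Order one: lower semicontinuity, a Pinsker type bound and the system. -/

section KullbackLeiblerLimit

variable {Ω : Type*} [MeasurableSpace Ω]

/-- The integrand `f log (f / g) + g - f` of the Kullback-Leibler divergence, written as a supremum
of affine functions. -/
def klPerspective (f g : ℝ) : ℝ≥0∞ := ⨆ s : ℝ, ENNReal.ofReal (s * f - g * (Real.exp s - 1))

lemma klPerspective_zero_right {f : ℝ} (hf : 0 < f) : klPerspective f 0 = ∞ := by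
  rw [klPerspective, iSup_eq_top]
  intro b hb
  refine ⟨(b.toReal + 1) / f, ?_⟩
  rw [zero_mul, sub_zero, div_mul_cancel₀ _ hf.ne', ← ENNReal.ofReal_toReal hb.ne,
    ENNReal.ofReal_lt_ofReal_iff (by positivity), ENNReal.toReal_ofReal ENNReal.toReal_nonneg]
  linarith

/-- Legendre duality: `s v - (exp s - 1) ≤ klFun v`, with equality at `s = log v`, or in the limit
`s → -∞` when `v = 0`. -/
lemma klPerspective_mul {g v : ℝ} (hg : 0 ≤ g) (hv : 0 ≤ v) :
    klPerspective (g * v) g = ENNReal.ofReal (g * klFun v) := by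
  apply le_antisymm
  · refine iSup_le fun s => ENNReal.ofReal_le_ofReal ?_
    have h : s * v - (Real.exp s - 1) ≤ klFun v := by
      rcases hv.eq_or_lt with rfl | hv
      · rw [klFun_zero]; linarith [Real.exp_pos s]
      · have h1 := Real.log_le_sub_one_of_pos (div_pos (Real.exp_pos s) hv)
        rw [Real.log_div (Real.exp_pos s).ne' hv.ne', Real.log_exp] at h1
        have h2 := mul_le_mul_of_nonneg_left h1 hv.le
        have h3 : v * (Real.exp s / v - 1) = Real.exp s - v := by field_simp
        rw [h3] at h2
        rw [klFun_apply]
        linarith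
    have := mul_le_mul_of_nonneg_left h hg
    linarith
  · rcases hv.eq_or_lt with rfl | hv
    · have h1 : Tendsto (fun s : ℝ => ENNReal.ofReal (s * (g * 0) - g * (Real.exp s - 1))) atBot
          (𝓝 (ENNReal.ofReal (g * klFun 0))) := by
        refine (ENNReal.continuous_ofReal.tendsto _).comp ?_
        have := ((Real.tendsto_exp_atBot.sub_const 1).const_mul g).const_sub 0
        simpa [klFun_zero] using this
      exact le_of_tendsto' h1 fun s =>
        le_iSup (fun s : ℝ => ENNReal.ofReal (s * (g * 0) - g * (Real.exp s - 1))) s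
    · refine le_trans (le_of_eq ?_) (le_iSup _ (Real.log v))
      rw [Real.exp_log hv, klFun_apply]
      congr 1; ring

/-- A supremum of functions continuous in `g` is lower semicontinuous. -/
lemma klPerspective_le_liminf (f : ℝ) {g : ℝ} {u : ℕ → ℝ} (hu : Tendsto u atTop (𝓝 g)) :
    klPerspective f g ≤ liminf (fun n => klPerspective f (u n)) atTop := by
  refine iSup_le fun s => ?_
  have h : Tendsto (fun n => ENNReal.ofReal (s * f - u n * (Real.exp s - 1))) atTop
      (𝓝 (ENNReal.ofReal (s * f - g * (Real.exp s - 1)))) :=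
    (ENNReal.continuous_ofReal.tendsto _).comp ((hu.mul_const _).const_sub _)
  rw [← h.liminf_eq]
  refine liminf_le_liminf (Eventually.of_forall fun n => ?_)
  exact le_iSup (fun s : ℝ => ENNReal.ofReal (s * f - u n * (Real.exp s - 1))) s

lemma measurable_klPerspective {f g : Ω → ℝ} (hf : Measurable f) (hg : Measurable g) :
    Measurable fun y => klPerspective (f y) (g y) := by
  have h : ∀ f g : ℝ, klPerspective f g =
      ⨆ s : ℚ, ENNReal.ofReal ((s : ℝ) * f - g * (Real.exp s - 1)) := by
    intro f g
    have hc : Continuous fun s : ℝ => ENNReal.ofReal (s * f - g * (Real.exp s - 1)) :=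
      ENNReal.continuous_ofReal.comp (by fun_prop)
    apply le_antisymm
    · refine iSup_le fun s => ?_
      have hcl : IsClosed {s : ℝ | ENNReal.ofReal (s * f - g * (Real.exp s - 1)) ≤
          ⨆ s : ℚ, ENNReal.ofReal ((s : ℝ) * f - g * (Real.exp s - 1))} :=
        isClosed_le hc continuous_const
      have hd : DenseRange ((↑) : ℚ → ℝ) := Rat.denseRange_cast
      exact hd.induction_on (p := fun s : ℝ => ENNReal.ofReal (s * f - g * (Real.exp s - 1)) ≤
          ⨆ s : ℚ, ENNReal.ofReal ((s : ℝ) * f - g * (Real.exp s - 1))) s hcl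
        fun s => le_iSup (fun s : ℚ => ENNReal.ofReal ((s : ℝ) * f - g * (Real.exp s - 1))) s
    · exact iSup_le fun s => le_iSup
        (fun s : ℝ => ENNReal.ofReal (s * f - g * (Real.exp s - 1))) s
  simp_rw [h]
  exact Measurable.iSup fun s => by fun_prop

/-- A formula over a fixed reference measure, needed since the second argument varies in the limit.
If absolute continuity fails, the perspective is infinite on a set of positive measure. -/
lemma klDiv_eq_lintegral_klPerspective {p q : Measure Ω} [IsFiniteMeasure p] [IsFiniteMeasure q]
    {ν : Measure Ω} [IsFiniteMeasure ν] (hp : p ≪ ν) (hq : q ≪ ν) :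
    klDiv p q = ∫⁻ y, klPerspective (p.rnDeriv ν y).toReal (q.rnDeriv ν y).toReal ∂ν := by
  by_cases hpq : p ≪ q
  · have hm : Measurable fun y => ENNReal.ofReal (klFun (p.rnDeriv q y).toReal) :=
      (measurable_klFun.comp (Measure.measurable_rnDeriv _ _).ennreal_toReal).ennreal_ofReal
    rw [klDiv_eq_lintegral_klFun_of_ac hpq, ← lintegral_rnDeriv_mul hq hm.aemeasurable]
    refine lintegral_congr_ae ?_
    filter_upwards [ae_rnDeriv_eq_mul (ν := ν) hpq, Measure.rnDeriv_ne_top q ν] with y h1 h2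
    rw [h1, ENNReal.toReal_mul, klPerspective_mul ENNReal.toReal_nonneg ENNReal.toReal_nonneg,
      ENNReal.ofReal_mul ENNReal.toReal_nonneg, ENNReal.ofReal_toReal h2]
  · rw [klDiv_of_not_ac hpq]
    symm
    by_contra hne
    apply hpq
    have h1 := ae_lt_top' (measurable_klPerspective (Measure.measurable_rnDeriv p ν).ennreal_toReal
      (Measure.measurable_rnDeriv q ν).ennreal_toReal).aemeasurable hne
    have h2 : ∀ᵐ y ∂ν, q.rnDeriv ν y = 0 → p.rnDeriv ν y = 0 := by
      filter_upwards [h1, Measure.rnDeriv_ne_top p ν] with y h3 h4 h5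
      by_contra h6
      rw [h5, ENNReal.toReal_zero, klPerspective_zero_right (ENNReal.toReal_pos h6 h4)] at h3
      exact lt_irrefl _ h3
    rw [← Measure.withDensity_rnDeriv_eq p ν hp, ← Measure.withDensity_rnDeriv_eq q ν hq]
    refine Measure.AbsolutelyContinuous.mk fun A hA h0 => ?_
    rw [withDensity_apply _ hA] at h0 ⊢
    rw [lintegral_eq_zero_iff (Measure.measurable_rnDeriv _ _)] at h0 ⊢
    filter_upwards [h0, ae_restrict_of_ae h2] with y h7 h8 using h8 h7

/-- With `u` the square root of the density, `log u ≥ 1 - 1 / u` gives `u² + 1 ≤ klFun (u²) + 2 u`;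
then integrate. -/
lemma affinity_ge_of_klDiv_le {p q : ProbabilityMeasure Ω} {η : ℝ} (hη : 0 ≤ η)
    (h : klDiv (p : Measure Ω) (q : Measure Ω) ≤ ENNReal.ofReal η) :
    ENNReal.ofReal (1 - η / 2) ≤ hellinger (1 / 2) p q := by
  have hpq : (p : Measure Ω) ≪ (q : Measure Ω) := by
    by_contra hcon
    rw [klDiv_of_not_ac hcon] at h
    exact absurd h (by simp)
  have hm : Measurable fun y =>
      ENNReal.ofReal (klFun ((p : Measure Ω).rnDeriv (q : Measure Ω) y).toReal) :=
    (measurable_klFun.comp (Measure.measurable_rnDeriv _ _).ennreal_toReal).ennreal_ofReal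
  rw [klDiv_eq_lintegral_klFun_of_ac hpq] at h
  have hB := hellinger_eq_of_withDensity (a := 1 / 2) (by norm_num) (p := p) (q := q)
    (ν := (q : Measure Ω)) (f := (p : Measure Ω).rnDeriv q) (g := fun _ => 1)
    (Measure.measurable_rnDeriv _ _) measurable_const
    (Measure.withDensity_rnDeriv_eq _ _ hpq).symm (by simp)
  simp only [ENNReal.one_rpow, mul_one] at hB
  have hpt : ∀ᵐ y ∂(q : Measure Ω), (p : Measure Ω).rnDeriv q y + 1 ≤
      ENNReal.ofReal (klFun ((p : Measure Ω).rnDeriv (q : Measure Ω) y).toReal) +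
      2 * (p : Measure Ω).rnDeriv q y ^ (1 / 2 : ℝ) := by
    filter_upwards [Measure.rnDeriv_ne_top (p : Measure Ω) (q : Measure Ω)] with y hy
    set f := (p : Measure Ω).rnDeriv q y
    have hf : f = ENNReal.ofReal f.toReal := (ENNReal.ofReal_toReal hy).symm
    set u := Real.sqrt f.toReal with hu
    have hu0 : 0 ≤ u := Real.sqrt_nonneg _
    have hu2 : f.toReal = u ^ 2 := (Real.sq_sqrt ENNReal.toReal_nonneg).symm
    have e1 : f ^ (1 / 2 : ℝ) = ENNReal.ofReal u := by
      rw [hf, ENNReal.ofReal_rpow_of_nonneg ENNReal.toReal_nonneg (by norm_num), hu,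
        Real.sqrt_eq_rpow]
    have hk : u ^ 2 + 1 ≤ klFun (u ^ 2) + 2 * u := by
      rcases hu0.eq_or_lt with h0 | h0
      · rw [← h0]; simp [klFun_zero]
      · have h1 := Real.one_sub_inv_le_log_of_pos h0
        have h2 := mul_le_mul_of_nonneg_left h1 (by positivity : 0 ≤ 2 * u ^ 2)
        have h3 : 2 * u ^ 2 * (1 - u⁻¹) = 2 * u ^ 2 - 2 * u := by field_simp
        rw [h3] at h2
        rw [klFun_apply, Real.log_pow]
        push_cast
        linarith
    rw [e1, hf, hu2, ← ENNReal.ofReal_one, ← ENNReal.ofReal_add (by positivity) zero_le_one,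
      ENNReal.toReal_ofReal (by positivity), ← ENNReal.ofReal_ofNat 2,
      ← ENNReal.ofReal_mul (by norm_num),
      ← ENNReal.ofReal_add (klFun_nonneg (by positivity)) (by positivity)]
    exact ENNReal.ofReal_le_ofReal hk
  have hint := lintegral_mono_ae hpt
  rw [lintegral_add_left (Measure.measurable_rnDeriv _ _), lintegral_add_left hm,
    lintegral_const_mul _ (by fun_prop), ← hB, Measure.lintegral_rnDeriv hpq] at hint
  simp only [measure_univ, lintegral_const, mul_one] at hint
  have h2 := hint.trans (add_le_add_left h _)
  have hBt : hellinger (1 / 2) p q ≠ ∞ :=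
    ne_top_of_le_ne_top ENNReal.one_ne_top (hellinger_le_one (by norm_num) (by norm_num) p q)
  have h3 := ENNReal.toReal_mono (by finiteness) h2
  rw [ENNReal.toReal_add (by finiteness) (by finiteness),
    ENNReal.toReal_add (by finiteness) (by finiteness), ENNReal.toReal_mul,
    ENNReal.toReal_ofReal hη] at h3
  rw [← ENNReal.ofReal_toReal hBt]
  refine ENNReal.ofReal_le_ofReal ?_
  norm_num at h3
  linarith

/-- The system of the order one. -/
def sibsonSystemOne (W₀ : ProbabilityMeasure Ω) : SibsonSystem 1 Ω where
  ψ x := x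
  center := mixtureCenter W₀
  Bound P q x := 0 ≤ x ∧ klSum P (q : Measure Ω) ≤ ENNReal.ofReal x
  strictMono := strictMono_id
  continuous := continuous_id
  div_center_le P hP q x h := by
    obtain ⟨h0, h⟩ := h
    rw [renyiDiv_one_le_iff, toMeasure_mixtureCenter W₀ hP.2]
    have hne : klSum P (q : Measure Ω) ≠ ∞ := ne_top_of_le_ne_top ENNReal.ofReal_ne_top h
    have hac : ∀ W ∈ P.support, (W : Measure Ω) ≪ (q : Measure Ω) := by
      intro W hW
      by_contra hcon
      refine hne (ENNReal.sum_eq_top.mpr ⟨W, hW, ?_⟩)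
      have : P W ≠ 0 := by simpa using hW
      beta_reduce
      rw [klDiv_of_not_ac hcon, ENNReal.mul_top (by simpa using this)]
    have hcomp := klSum_eq_add hP.2 hac
    have hkl : klDiv (mixture P) (q : Measure Ω) ≠ ∞ := fun hcon => by
      rw [hcon, add_top] at hcomp
      exact hne hcomp
    have h1 := ENNReal.toReal_mono ENNReal.ofReal_ne_top h
    rw [hcomp, ENNReal.toReal_add klSum_mixture_ne_top hkl, ← renyiInformation_one_eq hP.2,
      ENNReal.toReal_ofReal h0] at h1
    have h2 : (klDiv (mixture P) (q : Measure Ω)).toReal ≤ x := by linarith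
    refine ⟨ENNReal.toReal_nonneg.trans h2, ?_⟩
    rw [← ENNReal.ofReal_toReal hkl]
    exact ENNReal.ofReal_le_ofReal h2
  close_of_div_le δ hδ := by
    -- Then the affinity is at least `1 - δ² / 8`, as `setwiseClose_of_affinity` requires.
    refine ⟨δ ^ 2 / 4, by positivity, fun p q h => ?_⟩
    rw [renyiDiv_one_le_iff] at h
    exact setwiseClose_of_affinity hδ (by linarith) (affinity_ge_of_klDiv_le h.1 h.2)
  nonneg_of_div_le p q x h := ((renyiDiv_one_le_iff p q x).mp h).1
  bound_or_bound P hP P' hP' s t hs ht hst a b h := by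
    have hR := mix_mem_priors hP hP' hst
    rw [renyiInformation_one_eq hR.2] at h
    rw [toMeasure_mixtureCenter W₀ hR.2]
    have hne := klSum_mixture_ne_top (P := s • P + t • P')
    set κ := mixture (s • P + t • P')
    rw [klSum_mix] at h hne
    have hS : klSum P κ ≠ ∞ := fun hcon => hne (by
      rw [hcon, ENNReal.mul_top (by simpa using hs.ne'), top_add])
    have hS' : klSum P' κ ≠ ∞ := fun hcon => hne (by
      rw [hcon, ENNReal.mul_top (by simpa using ht.ne'), add_top])
    rw [ENNReal.toReal_add (by finiteness) (by finiteness), ENNReal.toReal_mul,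
      ENNReal.toReal_mul, ENNReal.coe_toReal, ENNReal.coe_toReal] at h
    have key : ∀ {z : ℝ} {S : ℝ≥0∞}, S ≠ ∞ → S.toReal ≤ z → 0 ≤ z ∧ S ≤ ENNReal.ofReal z :=
      fun hS hz => ⟨ENNReal.toReal_nonneg.trans hz, by
        rw [← ENNReal.ofReal_toReal hS]; exact ENNReal.ofReal_le_ofReal hz⟩
    rcases le_or_gt (klSum P κ).toReal a with ha | ha
    · exact Or.inl (key hS ha)
    · refine Or.inr (key hS' ?_)
      have e1 := mul_lt_mul_of_pos_left ha (show (0 : ℝ) < s from hs)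
      by_contra! hb
      have e2 := mul_lt_mul_of_pos_left hb (show (0 : ℝ) < t from ht)
      linarith
  div_le_of_close W q c h := by
    have hc : 0 ≤ c := by
      obtain ⟨q', -, h2⟩ := h 1 one_pos
      exact ((renyiDiv_one_le_iff _ _ _).mp h2).1
    obtain ⟨u, ν, hν, hu, hW, hq, hun, hlim⟩ := exists_seq_tendsto_densities (W := W) h
    rw [renyiDiv_one_le_iff]
    refine ⟨hc, ?_⟩
    rw [klDiv_eq_lintegral_klPerspective hW hq]
    have h1 : ∀ᵐ y ∂ν, klPerspective ((W : Measure Ω).rnDeriv ν y).toReal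
        ((q : Measure Ω).rnDeriv ν y).toReal ≤
        liminf (fun n => klPerspective ((W : Measure Ω).rnDeriv ν y).toReal
        ((u n : Measure Ω).rnDeriv ν y).toReal) atTop := by
      filter_upwards [hlim, Measure.rnDeriv_ne_top (q : Measure Ω) ν] with y hy hqy
      exact klPerspective_le_liminf _ ((ENNReal.tendsto_toReal hqy).comp hy)
    refine (lintegral_mono_ae h1).trans ((lintegral_liminf_le fun n =>
      measurable_klPerspective (Measure.measurable_rnDeriv _ _).ennreal_toReal
        (Measure.measurable_rnDeriv _ _).ennreal_toReal).trans ?_)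
    refine liminf_le_of_frequently_le' (Frequently.of_forall fun n => ?_)
    rw [← klDiv_eq_lintegral_klPerspective hW (hun n)]
    exact ((renyiDiv_one_le_iff _ _ _).mp (hu n)).2
  bound_of_forall P hP q c h := by
    obtain ⟨W, hW⟩ := exists_mem_support hP.2
    refine ⟨((renyiDiv_one_le_iff _ _ _).mp (h W hW)).1, ?_⟩
    rw [← sum_coe_mul_const hP.2 (ENNReal.ofReal _)]
    refine Finset.sum_le_sum fun W hW => ?_
    have := ((renyiDiv_one_le_iff _ _ _).mp (h W hW)).2
    dsimp only
    gcongr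
  div_le_of_bound_single W q c h := by
    rw [klSum_single] at h
    exact (renyiDiv_one_le_iff _ _ _).mpr h

end KullbackLeiblerLimit

/-! ### Every positive order has a system. -/

section Nonempty

variable {Ω : Type*} [MeasurableSpace Ω]

theorem nonempty_sibsonSystem (W₀ : ProbabilityMeasure Ω) {α : ℝ≥0∞} (hα : 0 < α) :
    Nonempty (SibsonSystem α Ω) := by
  by_cases h : α = ∞
  · subst h; exact ⟨sibsonSystemTop W₀⟩
  rcases lt_trichotomy α.toReal 1 with h1 | h1 | h1
  · exact ⟨sibsonSystemLtOne W₀ hα h h1⟩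
  · rw [ENNReal.toReal_eq_one_iff] at h1
    subst h1; exact ⟨sibsonSystemOne W₀⟩
  · exact ⟨sibsonSystemOneLt W₀ h h1⟩

end Nonempty

/-! ### Divergences of product measures. -/

section ProductDivergence

variable {T : Type*} [Fintype T] {Ω : T → Type*} [∀ t, MeasurableSpace (Ω t)]

lemma ae_pi_forall {ν : ∀ t, Measure (Ω t)} [∀ t, SigmaFinite (ν t)] {p : ∀ t, Ω t → Prop}
    (h : ∀ t, ∀ᵐ y ∂(ν t), p t y) : ∀ᵐ y ∂(Measure.pi ν), ∀ t, p t (y t) :=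
  eventually_all.mpr fun t => Measure.tendsto_eval_ae_ae.eventually (h t)

lemma measurable_prod_eval {f : ∀ t, Ω t → ℝ≥0∞} (hf : ∀ t, Measurable (f t)) :
    Measurable fun y : ∀ t, Ω t => ∏ t, f t (y t) :=
  Finset.measurable_fun_prod _ fun t _ => (hf t).comp (measurable_pi_apply t)

lemma hellinger_pi {a : ℝ} (ha : 0 < a) (W q : ∀ t, ProbabilityMeasure (Ω t)) :
    hellinger a (ProbabilityMeasure.pi W) (ProbabilityMeasure.pi q) =
      ∏ t, hellinger a (W t) (q t) := by
  choose ν f g hν hf hg hW hq hft hgt _ _ using fun t => exists_densities (W t) (q t)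
  rw [hellinger_eq_of_withDensity (p := ProbabilityMeasure.pi W) (q := ProbabilityMeasure.pi q) ha
    (measurable_prod_eval hf) (measurable_prod_eval hg)
    (pi_eq_withDensity hf hW) (pi_eq_withDensity hg hq)]
  -- Finiteness of the `g t` is needed because `1 - a` may be negative.
  have h : ∀ᵐ y ∂(Measure.pi ν), (∏ t, f t (y t)) ^ a * (∏ t, g t (y t)) ^ (1 - a) =
      ∏ t, (f t (y t) ^ a * g t (y t) ^ (1 - a)) := by
    filter_upwards [ae_pi_forall hgt] with y hy
    rw [← ENNReal.prod_rpow_of_nonneg ha.le, ← ENNReal.prod_rpow_of_ne_top fun t _ => hy t,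
      Finset.prod_mul_distrib]
  rw [lintegral_congr_ae h, lintegral_pi_prod (fun t y => f t y ^ a * g t y ^ (1 - a))
    fun t => by have := hf t; have := hg t; fun_prop]
  exact Finset.prod_congr rfl fun t _ =>
    (hellinger_eq_of_withDensity ha (hf t) (hg t) (hW t) (hq t)).symm

lemma pi_eq_withDensity_rnDeriv {μ ν : ∀ t, Measure (Ω t)} [∀ t, IsFiniteMeasure (μ t)]
    [∀ t, IsFiniteMeasure (ν t)] (h : ∀ t, μ t ≪ ν t) :
    Measure.pi μ = (Measure.pi ν).withDensity fun y => ∏ t, (μ t).rnDeriv (ν t) (y t) :=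
  pi_eq_withDensity (fun _ => Measure.measurable_rnDeriv _ _)
    fun t => (Measure.withDensity_rnDeriv_eq _ _ (h t)).symm

lemma rnDeriv_pi {μ ν : ∀ t, Measure (Ω t)} [∀ t, IsFiniteMeasure (μ t)]
    [∀ t, IsFiniteMeasure (ν t)] (h : ∀ t, μ t ≪ ν t) :
    (Measure.pi μ).rnDeriv (Measure.pi ν) =ᵐ[Measure.pi ν]
      fun y => ∏ t, (μ t).rnDeriv (ν t) (y t) := by
  rw [pi_eq_withDensity_rnDeriv h]
  exact Measure.rnDeriv_withDensity _
    (measurable_prod_eval fun _ => Measure.measurable_rnDeriv _ _)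

/-- The Kullback-Leibler divergence is additive over products. -/
lemma klDiv_pi {μ κ : ∀ t, Measure (Ω t)} [∀ t, IsProbabilityMeasure (μ t)]
    [∀ t, IsProbabilityMeasure (κ t)] (h : ∀ t, klDiv (μ t) (κ t) ≠ ∞) :
    klDiv (Measure.pi μ) (Measure.pi κ) = ∑ t, klDiv (μ t) (κ t) := by
  have hac : ∀ t, μ t ≪ κ t := fun t => (klDiv_ne_top_iff.mp (h t)).1
  have hint : ∀ t, Integrable (llr (μ t) (κ t)) (μ t) := fun t => (klDiv_ne_top_iff.mp (h t)).2
  have hacpi : Measure.pi μ ≪ Measure.pi κ := by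
    rw [pi_eq_withDensity_rnDeriv hac]
    exact withDensity_absolutelyContinuous _ _
  have hllr : llr (Measure.pi μ) (Measure.pi κ) =ᵐ[Measure.pi μ]
      fun y => ∑ t, llr (μ t) (κ t) (y t) := by
    filter_upwards [hacpi.ae_le (rnDeriv_pi hac),
      ae_pi_forall fun t => Measure.rnDeriv_pos (hac t),
      ae_pi_forall fun t => (hac t).ae_le (Measure.rnDeriv_ne_top (μ t) (κ t))] with y h1 h2 h3
    rw [llr, h1, ENNReal.toReal_prod,
      Real.log_prod fun t _ => (ENNReal.toReal_pos (h2 t).ne' (h3 t)).ne']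
    rfl
  have hintt : ∀ t, Integrable (fun y : ∀ t, Ω t => llr (μ t) (κ t) (y t)) (Measure.pi μ) :=
    fun t => integrable_comp_eval (hint t)
  have hintpi : Integrable (llr (Measure.pi μ) (Measure.pi κ)) (Measure.pi μ) :=
    (integrable_finsetSum _ fun t _ => hintt t).congr hllr.symm
  rw [← ENNReal.toReal_eq_toReal_iff' (klDiv_ne_top hacpi hintpi)
    (ENNReal.sum_ne_top.mpr fun t _ => h t), ENNReal.toReal_sum fun t _ => h t,
    toReal_klDiv_of_measure_eq hacpi (by simp), integral_congr_ae hllr,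
    integral_finsetSum _ fun t _ => hintt t]
  refine Finset.sum_congr rfl fun t _ => ?_
  rw [integral_comp_eval (hint t).1, toReal_klDiv_of_measure_eq (hac t) (by simp)]

/-- Only the upper bound is needed; with real bounds `c t`, no sum of extended reals arises. -/
theorem renyiDiv_pi_le {α : ℝ≥0∞} (hα : 0 < α) {W q : ∀ t, ProbabilityMeasure (Ω t)} {c : T → ℝ}
    (h : ∀ t, renyiDiv α (W t) (q t) ≤ (c t : EReal)) :
    renyiDiv α (ProbabilityMeasure.pi W) (ProbabilityMeasure.pi q) ≤ ((∑ t, c t : ℝ) : EReal) := by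
  by_cases htop : α = ∞
  · subst htop
    rw [renyiDiv_top_le_iff]
    simp_rw [renyiDiv_top_le_iff] at h
    choose ν f g hν hf hg hW hq hft hgt _ _ using fun t => exists_densities (W t) (q t)
    refine (forall_measure_le_iff_ae_le (measurable_prod_eval hf) (measurable_prod_eval hg)
      (pi_eq_withDensity hf hW) (pi_eq_withDensity hg hq) _).mpr ?_
    filter_upwards [ae_pi_forall fun t =>
      (forall_measure_le_iff_ae_le (hf t) (hg t) (hW t) (hq t) _).mp (h t)] with y hy
    rw [Real.exp_sum, ENNReal.ofReal_prod_of_nonneg fun t _ => (Real.exp_pos _).le,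
      ← Finset.prod_mul_distrib]
    exact Finset.prod_le_prod' fun t _ => hy t
  have ha : 0 < α.toReal := ENNReal.toReal_pos hα.ne' htop
  have hexp : ENNReal.ofReal (Real.exp ((α.toReal - 1) * ∑ t, c t)) =
      ∏ t, ENNReal.ofReal (Real.exp ((α.toReal - 1) * c t)) := by
    rw [Finset.mul_sum, Real.exp_sum, ENNReal.ofReal_prod_of_nonneg fun t _ => (Real.exp_pos _).le]
  rcases lt_trichotomy α.toReal 1 with h1 | h1 | h1
  · simp_rw [renyiDiv_le_iff_of_lt_one htop h1] at h ⊢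
    rw [hellinger_pi ha, hexp]
    exact Finset.prod_le_prod' fun t _ => h t
  · rw [ENNReal.toReal_eq_one_iff] at h1
    subst h1
    simp_rw [renyiDiv_one_le_iff] at h ⊢
    refine ⟨Finset.sum_nonneg fun t _ => (h t).1, ?_⟩
    rw [ProbabilityMeasure.toMeasure_pi, ProbabilityMeasure.toMeasure_pi,
      klDiv_pi fun t => ne_top_of_le_ne_top ENNReal.ofReal_ne_top (h t).2,
      ENNReal.ofReal_sum_of_nonneg fun t _ => (h t).1]
    exact Finset.sum_le_sum fun t _ => (h t).2
  · simp_rw [renyiDiv_le_iff_of_one_lt htop h1] at h ⊢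
    rw [hellinger_pi ha, hexp]
    exact Finset.prod_le_prod' fun t _ => h t

end ProductDivergence

/-! ### Product priors and additivity of the information. -/

section ProductPrior

variable {T : Type*} [Fintype T] {Ω : T → Type*} [∀ t, MeasurableSpace (Ω t)]
  (P : ∀ t, ProbabilityMeasure (Ω t) →₀ ℝ≥0)

open Classical in
/-- The finite set of families of measures in the supports. -/
def supportFamilies : Finset (∀ t, ProbabilityMeasure (Ω t)) :=
  Fintype.piFinset fun t => (P t).support

lemma mem_supportFamilies {V : ∀ t, ProbabilityMeasure (Ω t)} :
    V ∈ supportFamilies P ↔ ∀ t, V t ∈ (P t).support := by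
  classical
  exact Fintype.mem_piFinset

lemma prod_sum_support {R : Type*} [CommSemiring R]
    (f : ∀ t, ProbabilityMeasure (Ω t) → R) :
    ∏ t, ∑ W ∈ (P t).support, f t W = ∑ V ∈ supportFamilies P, ∏ t, f t (V t) := by
  classical
  exact Finset.prod_univ_sum _ _

/-- The product of priors, a prior on product measures. -/
def productPrior : ProbabilityMeasure (∀ t, Ω t) →₀ ℝ≥0 :=
  ∑ V ∈ supportFamilies P, Finsupp.single (ProbabilityMeasure.pi V) (∏ t, P t (V t))

/-- Additivity of `g` allows atoms to coincide, so injectivity of `V ↦ ProbabilityMeasure.pi V`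
plays no role. -/
lemma sum_productPrior {M : Type*} [AddCommMonoid M]
    (g : ProbabilityMeasure (∀ t, Ω t) → ℝ≥0 → M) (h0 : ∀ W, g W 0 = 0)
    (hadd : ∀ W x y, g W (x + y) = g W x + g W y) :
    ∑ W ∈ (productPrior P).support, g W (productPrior P W) =
      ∑ V ∈ supportFamilies P, g (ProbabilityMeasure.pi V) (∏ t, P t (V t)) := by
  have := Finsupp.sum_finsetSum_index (s := supportFamilies P)
    (g := fun V => Finsupp.single (ProbabilityMeasure.pi V) (∏ t, P t (V t))) (h := g) h0 hadd
  simp only [Finsupp.sum_single_index (h0 _)] at this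
  exact this.symm

lemma sum_productPrior_mul (φ : ProbabilityMeasure (∀ t, Ω t) → ℝ≥0∞) :
    ∑ W ∈ (productPrior P).support, (productPrior P W : ℝ≥0∞) * φ W =
      ∑ V ∈ supportFamilies P, (∏ t, (P t (V t) : ℝ≥0∞)) * φ (ProbabilityMeasure.pi V) := by
  rw [sum_productPrior P (fun W x => (x : ℝ≥0∞) * φ W) (by simp)
    (by intros; push_cast; ring)]
  simp only [ENNReal.ofNNReal_finsetProd]

lemma exists_of_mem_support_productPrior {W : ProbabilityMeasure (∀ t, Ω t)}
    (hW : W ∈ (productPrior P).support) :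
    ∃ V ∈ supportFamilies P, W = ProbabilityMeasure.pi V := by
  classical
  obtain ⟨V, hV, h⟩ := Finset.mem_biUnion.mp (Finsupp.support_finsetSum hW)
  refine ⟨V, hV, ?_⟩
  have := Finsupp.support_single_subset h
  simpa using this

lemma pi_mem_support_productPrior {V : ∀ t, ProbabilityMeasure (Ω t)}
    (hV : V ∈ supportFamilies P) : ProbabilityMeasure.pi V ∈ (productPrior P).support := by
  rw [Finsupp.mem_support_iff, productPrior, Finsupp.finsetSum_apply]
  have hpos : 0 < ∏ t, P t (V t) := Finset.prod_pos fun t _ => by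
    have := (mem_supportFamilies P).mp hV t
    rw [Finsupp.mem_support_iff] at this
    exact pos_iff_ne_zero.mpr this
  refine (lt_of_lt_of_le hpos ?_).ne'
  refine le_trans (le_of_eq ?_) (Finset.single_le_sum (fun _ _ => zero_le) hV)
  rw [Finsupp.single_eq_same]

lemma productPrior_mem_priors {𝒲 : ∀ t, Set (ProbabilityMeasure (Ω t))}
    (hP : ∀ t, P t ∈ priors (𝒲 t)) : productPrior P ∈ priors (productFamily 𝒲) := by
  constructor
  · intro W hW
    obtain ⟨V, hV, rfl⟩ := exists_of_mem_support_productPrior P hW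
    exact ⟨V, fun t => (hP t).1 _ ((mem_supportFamilies P).mp hV t), rfl⟩
  · rw [sum_productPrior P (fun _ x => x) (fun _ => rfl) (fun _ _ _ => rfl),
      ← prod_sum_support P fun t W => P t W]
    exact Finset.prod_eq_one fun t _ => (hP t).2

/-- For finite `α` this is the distributive law; for `α = ∞` the maxima in the separate coordinates
are attained by one family. -/
lemma weightedMean_productPrior {α : ℝ≥0∞} {w : ∀ t, ProbabilityMeasure (Ω t) → Ω t → ℝ≥0∞}
    {ω : ProbabilityMeasure (∀ t, Ω t) → (∀ t, Ω t) → ℝ≥0∞} {y : ∀ t, Ω t}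
    (hP : ∀ t, ∑ W ∈ (P t).support, P t W = 1)
    (h : ∀ V ∈ supportFamilies P, ω (ProbabilityMeasure.pi V) y = ∏ t, w t (V t) (y t)) :
    weightedMean α (productPrior P) ω y = ∏ t, weightedMean α (P t) (w t) (y t) := by
  unfold weightedMean
  split_ifs with hα
  · apply le_antisymm
    · refine iSup₂_le fun W hW => ?_
      obtain ⟨V, hV, rfl⟩ := exists_of_mem_support_productPrior P hW
      rw [h V hV]
      exact Finset.prod_le_prod' fun t _ => le_iSup₂ (f := fun W (_ : W ∈ (P t).support) =>
        w t W (y t)) (V t) ((mem_supportFamilies P).mp hV t)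
    · have hmax : ∀ t, ∃ W ∈ (P t).support, ∀ W' ∈ (P t).support, w t W' (y t) ≤ w t W (y t) :=
        fun t => Finset.exists_max_image _ _ (exists_mem_support (hP t))
      choose V hV hVmax using hmax
      have hVm := (mem_supportFamilies P).mpr hV
      calc ∏ t, ⨆ W ∈ (P t).support, w t W (y t) ≤ ∏ t, w t (V t) (y t) :=
            Finset.prod_le_prod' fun t _ => iSup₂_le (hVmax t)
        _ = ω (ProbabilityMeasure.pi V) y := (h V hVm).symm
        _ ≤ _ := le_iSup₂ (f := fun W (_ : W ∈ (productPrior P).support) => ω W y) _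
            (pi_mem_support_productPrior P hVm)
  · rw [ENNReal.prod_rpow_of_nonneg (by positivity), prod_sum_support P
      fun t W => (P t W : ℝ≥0∞) * w t W (y t) ^ α.toReal, sum_productPrior_mul P
      fun W => ω W y ^ α.toReal]
    congr 1
    refine Finset.sum_congr rfl fun V hV => ?_
    rw [h V hV, Finset.prod_mul_distrib, ENNReal.prod_rpow_of_nonneg ENNReal.toReal_nonneg]

/-- Relative to the product of the mixtures the mean density factorizes, and Tonelli's theorem
applies. -/
lemma meanMeasure_univ_productPrior {α : ℝ≥0∞} (hα : 0 < α)
    (hP : ∀ t, ∑ W ∈ (P t).support, P t W = 1) :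
    meanMeasure α (productPrior P) Set.univ = ∏ t, meanMeasure α (P t) Set.univ := by
  set ν : Measure (∀ t, Ω t) := Measure.pi fun t => mixture (P t) with hν
  have hac : ∀ V ∈ supportFamilies P, ∀ t, (V t : Measure (Ω t)) ≪ mixture (P t) := fun V hV t =>
    absolutelyContinuous_mixture ((mem_supportFamilies P).mp hV t)
  have hsupp : ∀ W ∈ (productPrior P).support, (W : Measure (∀ t, Ω t)) =
      ν.withDensity ((W : Measure (∀ t, Ω t)).rnDeriv ν) := fun W hW => by
    obtain ⟨V, hV, rfl⟩ := exists_of_mem_support_productPrior P hW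
    refine (Measure.withDensity_rnDeriv_eq _ _ ?_).symm
    rw [ProbabilityMeasure.toMeasure_pi, pi_eq_withDensity_rnDeriv (hac V hV)]
    exact withDensity_absolutelyContinuous _ _
  have hae : ∀ᵐ y ∂ν, ∀ V ∈ supportFamilies P,
      (ProbabilityMeasure.pi V : Measure (∀ t, Ω t)).rnDeriv ν y =
      ∏ t, (V t : Measure (Ω t)).rnDeriv (mixture (P t)) (y t) :=
    (ae_ball_iff (supportFamilies P).countable_toSet).mpr fun V hV => rnDeriv_pi (hac V hV)
  rw [meanMeasure_eq_withDensity hα (fun W => Measure.measurable_rnDeriv _ _) hsupp,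
    withDensity_apply _ MeasurableSet.univ, Measure.restrict_univ]
  have hcongr : ∀ᵐ y ∂ν, weightedMean α (productPrior P)
      (fun W => (W : Measure (∀ t, Ω t)).rnDeriv ν) y =
      ∏ t, meanDensity α (P t) (mixture (P t)) (y t) := by
    filter_upwards [hae] with y hy
    exact weightedMean_productPrior P (w := fun t W => (W : Measure (Ω t)).rnDeriv (mixture (P t)))
      hP hy
  rw [lintegral_congr_ae hcongr, lintegral_pi_prod
    (fun t => meanDensity α (P t) (mixture (P t))) fun t =>
      measurable_weightedMean fun W => Measure.measurable_rnDeriv _ _]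
  refine Finset.prod_congr rfl fun t _ => ?_
  rw [meanMeasure, withDensity_apply _ MeasurableSet.univ, Measure.restrict_univ]

lemma mixture_productPrior : mixture (productPrior P) = Measure.pi fun t => mixture (P t) := by
  refine (Measure.pi_eq fun s hs => ?_).symm
  rw [mixture_apply, sum_productPrior_mul P fun W => (W : Measure (∀ t, Ω t)) (Set.univ.pi s)]
  simp_rw [mixture_apply]
  rw [prod_sum_support P fun t W => (P t W : ℝ≥0∞) * (W : Measure (Ω t)) (s t)]
  refine Finset.sum_congr rfl fun V hV => ?_
  rw [ProbabilityMeasure.toMeasure_pi, Measure.pi_pi, Finset.prod_mul_distrib]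

lemma sum_prod_mul_sum (hP : ∀ t, ∑ W ∈ (P t).support, P t W = 1)
    (k : ∀ t, ProbabilityMeasure (Ω t) → ℝ≥0∞) :
    ∑ V ∈ supportFamilies P, (∏ t, (P t (V t) : ℝ≥0∞)) * ∑ t, k t (V t) =
      ∑ t, ∑ W ∈ (P t).support, (P t W : ℝ≥0∞) * k t W := by
  classical
  simp_rw [Finset.mul_sum]
  rw [Finset.sum_comm]
  refine Finset.sum_congr rfl fun s _ => ?_
  -- The single term `k s` is absorbed into the product; all the other factors then sum to one.
  have h1 : ∀ V : ∀ t, ProbabilityMeasure (Ω t), (∏ t, (P t (V t) : ℝ≥0∞)) * k s (V s) =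
      ∏ t, ((P t (V t) : ℝ≥0∞) * if t = s then k t (V t) else 1) := by
    intro V
    rw [Finset.prod_mul_distrib, Finset.prod_ite_eq' Finset.univ s fun t => k t (V t),
      if_pos (Finset.mem_univ s)]
  simp_rw [h1]
  rw [← prod_sum_support P fun t W => (P t W : ℝ≥0∞) * if t = s then k t W else 1,
    Finset.prod_eq_single s]
  · simp
  · intro t _ hts
    simp [hts, ← ENNReal.ofNNReal_finsetSum, hP t]
  · simp

lemma klSum_productPrior (hP : ∀ t, ∑ W ∈ (P t).support, P t W = 1) :
    klSum (productPrior P) (mixture (productPrior P)) = ∑ t, klSum (P t) (mixture (P t)) := by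
  have hprob : ∀ t, IsProbabilityMeasure (mixture (P t)) := fun t => ⟨mixture_univ (hP t)⟩
  have h1 : klSum (productPrior P) (mixture (productPrior P)) =
      ∑ V ∈ supportFamilies P, (∏ t, (P t (V t) : ℝ≥0∞)) *
        klDiv (ProbabilityMeasure.pi V : Measure (∀ t, Ω t)) (mixture (productPrior P)) :=
    sum_productPrior_mul P fun W => klDiv (W : Measure (∀ t, Ω t)) (mixture (productPrior P))
  have h2 : ∀ V ∈ supportFamilies P, (∏ t, (P t (V t) : ℝ≥0∞)) *
        klDiv (ProbabilityMeasure.pi V : Measure (∀ t, Ω t)) (mixture (productPrior P)) =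
      (∏ t, (P t (V t) : ℝ≥0∞)) * ∑ t, klDiv (V t : Measure (Ω t)) (mixture (P t)) := by
    intro V hV
    rw [mixture_productPrior, ProbabilityMeasure.toMeasure_pi, klDiv_pi fun t => ?_]
    have hVt := (mem_supportFamilies P).mp hV t
    -- Finiteness of each divergence, required by `klDiv_pi`, follows from that of the average, as
    -- the weights are nonzero.
    have h3 := ENNReal.sum_ne_top.mp (klSum_mixture_ne_top (P := P t)) (V t) hVt
    have h4 : (P t (V t) : ℝ≥0∞) ≠ 0 := by simpa using hVt
    intro hcon
    beta_reduce at h3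
    rw [hcon, ENNReal.mul_top h4] at h3
    exact h3 rfl
  rw [h1, Finset.sum_congr rfl h2,
    sum_prod_mul_sum P hP fun t W => klDiv (W : Measure (Ω t)) (mixture (P t))]
  rfl

/-- The Rényi information is additive over products of priors. -/
theorem renyiInformation_productPrior {α : ℝ≥0∞} (hα : 0 < α)
    (hP : ∀ t, ∑ W ∈ (P t).support, P t W = 1) :
    renyiInformation α (productPrior P) = ∑ t, renyiInformation α (P t) := by
  have hlog : Real.log (meanMeasure α (productPrior P) Set.univ).toReal =
      ∑ t, Real.log (meanMeasure α (P t) Set.univ).toReal := by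
    rw [meanMeasure_univ_productPrior P hα hP, ENNReal.toReal_prod,
      Real.log_prod fun t _ => ?_]
    exact (ENNReal.toReal_pos (meanMeasure_univ_ne_zero hα (hP t))
      (meanMeasure_univ_ne_top hα (hP t))).ne'
  by_cases htop : α = ∞
  · simp only [renyiInformation, if_pos htop, hlog]
  by_cases h1 : α = 1
  · subst h1
    have hPP : ∑ W ∈ (productPrior P).support, productPrior P W = 1 :=
      (productPrior_mem_priors P (𝒲 := fun _ => Set.univ)
        fun t => ⟨fun _ _ => Set.mem_univ _, hP t⟩).2
    rw [renyiInformation_one_eq hPP, klSum_productPrior P hP,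
      ENNReal.toReal_sum fun t _ => klSum_mixture_ne_top]
    exact Finset.sum_congr rfl fun t _ => (renyiInformation_one_eq (hP t)).symm
  · simp only [renyiInformation, if_neg htop, if_neg h1, hlog, Finset.mul_sum]

end ProductPrior

/-! ### Capacity and center of the product family. -/

section Capacity

lemma coe_sum_eq {ι : Type*} (s : Finset ι) (c : ι → ℝ) :
    ((∑ t ∈ s, c t : ℝ) : EReal) = ∑ t ∈ s, (c t : EReal) := by
  classical
  induction s using Finset.induction_on with
  | empty => simp
  | insert a s ha ih => rw [Finset.sum_insert ha, Finset.sum_insert ha, EReal.coe_add, ih]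

variable {T : Type*} [Fintype T] {Ω : T → Type*} [∀ t, MeasurableSpace (Ω t)]
  {𝒲 : ∀ t, Set (ProbabilityMeasure (Ω t))} {α : ℝ≥0∞}

lemma sum_information_le (hα : 0 < α) {P : ∀ t, ProbabilityMeasure (Ω t) →₀ ℝ≥0}
    (hP : ∀ t, P t ∈ priors (𝒲 t)) :
    ((∑ t, renyiInformation α (P t) : ℝ) : EReal) ≤ renyiCapacity α (productFamily 𝒲) := by
  rw [← renyiInformation_productPrior P hα fun t => (hP t).2]
  exact information_le_renyiCapacity (productPrior_mem_priors P hP)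

/-- Fix point priors in the other coordinates and vary only the prior at `t`: additivity bounds its
information by a constant. -/
lemma capacity_lt_top_of_product (hα : 0 < α) (h𝒲 : ∀ t, (𝒲 t).Nonempty)
    (hfin : renyiCapacity α (productFamily 𝒲) < ⊤) (t : T) : renyiCapacity α (𝒲 t) < ⊤ := by
  classical
  choose W hW using h𝒲
  set P₀ : ∀ t, ProbabilityMeasure (Ω t) →₀ ℝ≥0 := fun t => Finsupp.single (W t) 1 with hP₀
  have hP₀m : ∀ t, P₀ t ∈ priors (𝒲 t) := fun t => single_mem_priors (hW t)
  have hbot : renyiCapacity α (productFamily 𝒲) ≠ ⊥ := fun h => by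
    have := sum_information_le hα hP₀m
    rw [h, le_bot_iff] at this
    exact EReal.coe_ne_bot _ this
  obtain ⟨c, hc⟩ : ∃ c : ℝ, renyiCapacity α (productFamily 𝒲) = c :=
    ⟨_, (EReal.coe_toReal hfin.ne hbot).symm⟩
  refine lt_of_le_of_lt (b := ((c - ∑ s ∈ Finset.univ.erase t, renyiInformation α (P₀ s) : ℝ) :
    EReal)) (iSup₂_le fun P hP => ?_) (EReal.coe_lt_top _)
  have hm : ∀ s, Function.update P₀ t P s ∈ priors (𝒲 s) := by
    intro s
    by_cases hs : s = t
    · subst hs; simpa using hP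
    · simpa [Function.update_of_ne hs] using hP₀m s
  have h := sum_information_le hα hm
  rw [hc, EReal.coe_le_coe_iff, ← Finset.add_sum_erase _ _ (Finset.mem_univ t),
    Function.update_self] at h
  have h2 : ∑ s ∈ Finset.univ.erase t, renyiInformation α (Function.update P₀ t P s) =
      ∑ s ∈ Finset.univ.erase t, renyiInformation α (P₀ s) :=
    Finset.sum_congr rfl fun s hs => by rw [Function.update_of_ne (Finset.ne_of_mem_erase hs)]
  rw [h2] at h
  exact EReal.coe_le_coe_iff.mpr (by linarith)

lemma sum_capacity_le (hα : 0 < α) (h𝒲 : ∀ t, (𝒲 t).Nonempty) :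
    ∑ t, renyiCapacity α (𝒲 t) ≤ renyiCapacity α (productFamily 𝒲) := by
  rcases eq_or_ne (renyiCapacity α (productFamily 𝒲)) ⊤ with h | h
  · rw [h]; exact le_top
  have hfin := lt_top_iff_ne_top.mpr h
  choose c hc happ using fun t =>
    exists_renyiCapacity_eq_coe (h𝒲 t) (capacity_lt_top_of_product hα h𝒲 hfin t)
  simp_rw [hc]
  rw [← coe_sum_eq, ← EReal.le_of_forall_lt_iff_le]
  intro z hz
  rw [EReal.coe_le_coe_iff]
  refine le_of_forall_pos_le_add fun ε hε => ?_
  -- The `+ 1` covers an empty index set.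
  have hcard : (0 : ℝ) < Fintype.card T + 1 := by positivity
  choose P hP hPI using fun t => happ t (ε / (Fintype.card T + 1)) (by positivity)
  have h1 := (sum_information_le hα hP).trans hz.le
  rw [EReal.coe_le_coe_iff] at h1
  have h2 : ∑ t, (c t - ε / (Fintype.card T + 1)) ≤ ∑ t, renyiInformation α (P t) :=
    Finset.sum_le_sum fun t _ => (hPI t).le
  rw [Finset.sum_sub_distrib, Finset.sum_const, Finset.card_univ, nsmul_eq_mul] at h2
  have h3 : (Fintype.card T : ℝ) * (ε / (Fintype.card T + 1)) ≤ ε := by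
    rw [mul_div_assoc', div_le_iff₀ hcard]
    nlinarith
  linarith

/-- A product of Rényi centers of families of finite capacity bounds the capacity of the product
family. -/
lemma iSup_renyiDiv_pi_le (hα : 0 < α) {q : ∀ t, ProbabilityMeasure (Ω t)} {c : T → ℝ}
    (hc : ∀ t, renyiCapacity α (𝒲 t) = c t) (hq : ∀ t, IsRenyiCenter α (𝒲 t) (q t)) :
    ⨆ W ∈ productFamily 𝒲, renyiDiv α W (ProbabilityMeasure.pi q) ≤
      ∑ t, renyiCapacity α (𝒲 t) := by
  simp_rw [hc]
  rw [← coe_sum_eq]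
  refine iSup₂_le fun W hW => ?_
  obtain ⟨V, hV, rfl⟩ := hW
  refine renyiDiv_pi_le hα fun t => ?_
  rw [← hc t, hq t]
  exact le_iSup₂ (f := fun W (_ : W ∈ 𝒲 t) => renyiDiv α W (q t)) (V t) (hV t)

theorem existsUnique_isRenyiCenter {Ω : Type*} [MeasurableSpace Ω]
    {𝒲 : Set (ProbabilityMeasure Ω)} (hα : 0 < α) (h𝒲 : 𝒲.Nonempty)
    (hfin : renyiCapacity α 𝒲 < ⊤) : ∃! q, IsRenyiCenter α 𝒲 q := by
  obtain ⟨S⟩ := nonempty_sibsonSystem h𝒲.some hα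
  exact S.existsUnique_isRenyiCenter h𝒲 hfin

/-- The chain `C(𝒲) ≤ radius at the product of centers ≤ ∑ C(𝒲 t) ≤ C(𝒲)` closes up, so all terms
are equal. -/
lemma product_capacity_and_center (hα : 0 < α) (h𝒲 : ∀ t, (𝒲 t).Nonempty)
    (hfin : ∀ t, renyiCapacity α (𝒲 t) < ⊤) {q : ∀ t, ProbabilityMeasure (Ω t)}
    (hq : ∀ t, IsRenyiCenter α (𝒲 t) (q t)) :
    renyiCapacity α (productFamily 𝒲) = ∑ t, renyiCapacity α (𝒲 t) ∧
      IsRenyiCenter α (productFamily 𝒲) (ProbabilityMeasure.pi q) := by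
  choose c hc _ using fun t => exists_renyiCapacity_eq_coe (h𝒲 t) (hfin t)
  obtain ⟨S⟩ := nonempty_sibsonSystem (ProbabilityMeasure.pi q) hα
  have h1 := S.capacity_le_iSup (𝒲 := productFamily 𝒲) (ProbabilityMeasure.pi q)
  have h2 := iSup_renyiDiv_pi_le hα hc hq
  have h3 := sum_capacity_le hα h𝒲
  exact ⟨le_antisymm (h1.trans h2) h3, le_antisymm h1 (h2.trans h3)⟩

lemma renyiCapacity_productFamily (hα : 0 < α) (h𝒲 : ∀ t, (𝒲 t).Nonempty) :
    renyiCapacity α (productFamily 𝒲) = ∑ t, renyiCapacity α (𝒲 t) := by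
  rcases eq_or_ne (renyiCapacity α (productFamily 𝒲)) ⊤ with h | h
  · by_cases hfin : ∀ t, renyiCapacity α (𝒲 t) < ⊤
    · choose q hq _ using fun t => existsUnique_isRenyiCenter hα (h𝒲 t) (hfin t)
      exact (product_capacity_and_center hα h𝒲 hfin hq).1
    · push Not at hfin
      obtain ⟨t, ht⟩ := hfin
      classical
      rw [h, ← Finset.add_sum_erase _ _ (Finset.mem_univ t), top_le_iff.mp ht,
        EReal.top_add_of_ne_bot]
      -- In `EReal`, `⊤ + ⊥ = ⊥`, so the remaining summands must be shown to differ from `⊥`.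
      have hbot : ∀ s, renyiCapacity α (𝒲 s) ≠ ⊥ := fun s hs => by
        have := information_le_renyiCapacity (α := α) (single_mem_priors (h𝒲 s).some_mem)
        rw [hs, le_bot_iff] at this
        exact EReal.coe_ne_bot _ this
      refine Finset.sum_induction _ (· ≠ ⊥) (fun a b ha hb => ?_) EReal.zero_ne_bot
        fun s _ => hbot s
      exact EReal.add_ne_bot_iff.mpr ⟨ha, hb⟩
  · have hfin := capacity_lt_top_of_product hα h𝒲 (lt_top_iff_ne_top.mpr h)
    choose q hq _ using fun t => existsUnique_isRenyiCenter hα (h𝒲 t) (hfin t)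
    exact (product_capacity_and_center hα h𝒲 hfin hq).1

end Capacity

end RenyiCapacity

end

theorem mainTheorem9 {T : Type*} [Fintype T] {Ω : T → Type*} [∀ t, MeasurableSpace (Ω t)]
    (𝒲 : ∀ t, Set (ProbabilityMeasure (Ω t))) (h𝒲 : ∀ t, (𝒲 t).Nonempty) :
    ∀ α : ℝ≥0∞, 0 < α →
      RenyiCapacity.renyiCapacity α (RenyiCapacity.productFamily 𝒲) =
          ∑ t, RenyiCapacity.renyiCapacity α (𝒲 t) ∧
      (RenyiCapacity.renyiCapacity α (RenyiCapacity.productFamily 𝒲) < ⊤ →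
        (∀ t, ∃! q, RenyiCapacity.IsRenyiCenter α (𝒲 t) q) ∧
        (∃! Q, RenyiCapacity.IsRenyiCenter α (RenyiCapacity.productFamily 𝒲) Q) ∧
        ∀ (q : ∀ t, ProbabilityMeasure (Ω t)) (Q : ProbabilityMeasure (∀ t, Ω t)),
          (∀ t, RenyiCapacity.IsRenyiCenter α (𝒲 t) (q t)) →
          RenyiCapacity.IsRenyiCenter α (RenyiCapacity.productFamily 𝒲) Q →
          Q = ProbabilityMeasure.pi q) := by
  intro α hα
  refine ⟨RenyiCapacity.renyiCapacity_productFamily hα h𝒲, fun hfin => ?_⟩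
  have hfin' := RenyiCapacity.capacity_lt_top_of_product hα h𝒲 hfin
  have hne : (RenyiCapacity.productFamily 𝒲).Nonempty := by
    choose W hW using h𝒲
    exact ⟨_, W, hW, rfl⟩
  have hQ := RenyiCapacity.existsUnique_isRenyiCenter hα hne hfin
  exact ⟨fun t => RenyiCapacity.existsUnique_isRenyiCenter hα (h𝒲 t) (hfin' t), hQ,
    fun q Q hq hQc =>
      hQ.unique hQc (RenyiCapacity.product_capacity_and_center hα h𝒲 hfin' hq).2⟩
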